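/- Let $(M_p)_{p\in\mathbb N_0}$ be a sequence of positive real numbers with $M_0=1$ such that - (M.1) $M_p^2\le M_{p-1}M_{p+1}$ for $p\ge 1$; - (M.2) there are $A,H>0$ with $M_p\le A H^p\min_{0\le q\le p}M_qM_{p-q}$ for $p\ge 0$; - (M.3)'' there are $C,L>0$ with $p^{p/2}\le C L^pM_p$ for $p\ge 0$ (with $0^0=1$). Let $M(\rho)=\sup_{p\in\mathbb N_0}\log(\rho^p/M_p)$ for $\rho>0$ and $M(0)=0$. For $m>0$ let $\mathcal S^{M_p,m}(\mathbb R^d)$ be the space of smooth functions $\varphi:\mathbb R^d\to\mathbb C$ with $$\|\varphi\|_{m}=\sup_{\alpha,\beta\in\mathbb N_0^d}\frac{m^{|\alpha|+|\beta|}}{M_{|\alpha|}M_{|\beta|}}\,\bigl\|(1+x^2)^{\beta/2}\varphi^{(\alpha)}\bigr\|_{L^\infty}<\infty,\qquad (1+x^2)^{\beta/2}=\prod_{k=1}^d(1+x_k^2)^{\beta_k/2},$$ normed by $\|\cdot\|_m$, and let $\mathcal S^{\{M_p\}}(\mathbb R^d)=\bigcup_{m>0}\mathcal S^{M_p,m}(\mathbb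 R^d)$ with the locally convex inductive limit topology (the finest locally convex vector space topology for which all the inclusions of the spaces $\mathcal S^{M_p,m}(\mathbb R^d)$ are continuous). For $\theta\in(0,\infty)^d$ let $\mathbf s_{M_p,\theta}$ be the space of complex multisequences $(a_n)_{n\in\mathbb N_0^d}$ with $$\|(a_n)\|_\theta=\Bigl(\sum_{n\in\mathbb N_0^d}|a_n|^2\exp\Bigl[\sum_{k=1}^dM(\theta_k\sqrt{n_k})\Bigr]\Bigr)^{1/2}<\infty,$$ normed by $\|\cdot\|_\theta$, and let $\mathbf s_{\{M_p\}}=\bigcup_{\theta}\mathbf s_{M_p,\theta}$ (the sequences of ultrafast falloff), again with the locally convex inductive limit topology. Let $$\mathcal H_j(t)=(-1)^j\pi^{-1/4}2^{-j/2}(j!)^{-1/2}e^{t^2/2}\frac{d^j}{dt^j}e^{-t^2}\quad(j\in\mathbb N_0,\ t\in\mathbb R),\qquad \mathcal H_n(x)=\prod_{k=1}^d\mathcal H_{n_k}(x_k)\quad(n\in\mathbb N_0^d,\ x\in\mathbb R^d).$$ **Theorem.** The map assigning to $\varphi\in\mathcal S^{\{M_p\}}(\mathbb R^d)$ its sequence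 of Fourier–Hermite coefficients $a_n(\varphi)=\int_{\mathbb R^d}\varphi(x)\mathcal H_n(x)\,dx$, $n\in\mathbb N_0^d$ (the integrals converge absolutely), is a linear topological isomorphism of $\mathcal S^{\{M_p\}}(\mathbb R^d)$ onto $\mathbf s_{\{M_p\}}$. Moreover, $\mathcal S^{\{M_p\}}(\mathbb R^d)$ is a nuclear space: it is Hausdorff and locally convex, and for every continuous seminorm $p$ there is a continuous seminorm $q\ge p$ such that the canonical map between the completions $\widehat E_q\to\widehat E_p$ of $E=\mathcal S^{\{M_p\}}(\mathbb R^d)$ with respect to $q$ and $p$ is a nuclear operator. -/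

import Mathlib

open scoped ContDiff

noncomputable section

namespace GelfandShilovHermite

/-! ## Weight sequences -/

/-- A sequence `(M_p)` of positive real numbers with `M_0 = 1`. -/
structure WeightSequence where
  toFun : ℕ → ℝ
  pos' : ∀ p, 0 < toFun p
  zero' : toFun 0 = 1

instance : CoeFun WeightSequence (fun _ => ℕ → ℝ) := ⟨WeightSequence.toFun⟩

/-- Condition (M.1), logarithmic convexity: `M_p² ≤ M_{p-1} M_{p+1}` for `p ≥ 1`. -/
def LogConvex (M : WeightSequence) : Prop :=
  ∀ p : ℕ, 1 ≤ p → M p ^ 2 ≤ M (p - 1) * M (p + 1)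

/-- Condition (M.2): `M_p ≤ A H^p min_{0 ≤ q ≤ p} M_q M_{p-q}`. -/
def Separative (M : WeightSequence) : Prop :=
  ∃ A H : ℝ, 0 < A ∧ 0 < H ∧
    ∀ p q : ℕ, q ≤ p → M p ≤ A * H ^ p * (M q * M (p - q))

/-- Condition (M.3)'': `p^{p/2} ≤ C L^p M_p` (with `0^0 = 1`). -/
def NonTrivial (M : WeightSequence) : Prop :=
  ∃ C L : ℝ, 0 < C ∧ 0 < L ∧
    ∀ p : ℕ, (p : ℝ) ^ ((p : ℝ) / 2) ≤ C * L ^ p * M p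

/-- The associated function `M(ρ) = sup_p log (ρ^p / M_p)`. The supremum is finite under (M.3)''
(see `bddAbove_assoc`). At `ρ = 0` the value is `0`, the value given by the term `p = 0`. -/
def assoc (M : WeightSequence) (ρ : ℝ) : ℝ :=
  ⨆ p : ℕ, Real.log (ρ ^ p / M p)

/-! ## Locally convex inductive limits -/

section InductiveLimit

variable {ι : Type*} {X : ι → Type*} [∀ i, AddCommGroup (X i)] [∀ i, Module ℂ (X i)]
  [∀ i, TopologicalSpace (X i)] {E : Type*} [AddCommGroup E] [Module ℂ E]

/-- The locally convex inductive limit topology on `E` with respect to linear maps `j i : X i → E`: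
the finest locally convex vector space topology for which all `j i` are continuous. -/
@[reducible] def inductiveLimitTopology (j : ∀ i, X i →ₗ[ℂ] E) : TopologicalSpace E :=
  sInf {t | @IsTopologicalAddGroup E t _ ∧ @ContinuousSMul ℂ E _ _ t ∧
    @LocallyConvexSpace ℝ E _ _ _ _ t ∧ ∀ i, @Continuous (X i) E _ t (j i)}

theorem inductiveLimitTopology_isTopologicalAddGroup (j : ∀ i, X i →ₗ[ℂ] E) :
    @IsTopologicalAddGroup E (inductiveLimitTopology j) _ :=
  topologicalAddGroup_sInf fun _ h => h.1

theorem inductiveLimitTopology_continuousSMul (j : ∀ i, X i →ₗ[ℂ] E) :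
    @ContinuousSMul ℂ E _ _ (inductiveLimitTopology j) :=
  continuousSMul_sInf fun _ h => h.2.1

end InductiveLimit

/-! ## Nuclear spaces -/

/-- A bounded operator `u` between normed spaces is nuclear if `u x = ∑ f_k(x) y_k` with
`∑ ‖f_k‖ ‖y_k‖ < ∞`. -/
def IsNuclearMap {X Y : Type*} [NormedAddCommGroup X] [NormedSpace ℂ X]
    [NormedAddCommGroup Y] [NormedSpace ℂ Y] (u : X →L[ℂ] Y) : Prop :=
  ∃ (f : ℕ → X →L[ℂ] ℂ) (y : ℕ → Y),
    Summable (fun k => ‖f k‖ * ‖y k‖) ∧ ∀ x, HasSum (fun k => f k x • y k) (u x)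

section Nuclear

variable {E : Type*} [AddCommGroup E] [Module ℂ E]

/-- The space `E` equipped with the single seminorm `p`. -/
def WithSeminorm (_p : Seminorm ℂ E) : Type _ := E

instance (p : Seminorm ℂ E) : SeminormedAddCommGroup (WithSeminorm p) :=
  p.toAddGroupSeminorm.toSeminormedAddCommGroup

instance (p : Seminorm ℂ E) : Module ℂ (WithSeminorm p) := inferInstanceAs (Module ℂ E)

instance (p : Seminorm ℂ E) : NormedSpace ℂ (WithSeminorm p) where
  norm_smul_le c x := (map_smul_eq_mul p c x).le

/-- The Banach space `Ê_p`, the (Hausdorff) completion of `E` for the seminorm `p`. -/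
abbrev LocalBanach (p : Seminorm ℂ E) : Type _ := UniformSpace.Completion (WithSeminorm p)

/-- For `p ≤ q`, the identity of `E` as a map from `(E, q)` to `(E, p)`. -/
def idOfLE {p q : Seminorm ℂ E} (h : p ≤ q) : WithSeminorm q →L[ℂ] WithSeminorm p :=
  LinearMap.mkContinuous
    ({ toFun := fun x => (show E from x)
       map_add' := fun _ _ => rfl
       map_smul' := fun _ _ => rfl } : WithSeminorm q →ₗ[ℂ] WithSeminorm p) 1
    (fun x => by rw [one_mul]; exact h x)

/-- For `p ≤ q`, the canonical map `Ê_q → Ê_p`. -/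
def canonicalMap {p q : Seminorm ℂ E} (h : p ≤ q) : LocalBanach q →L[ℂ] LocalBanach p :=
  (idOfLE h).completion

/-- A nuclear space: a Hausdorff locally convex space such that for every continuous seminorm `p`
there is a continuous seminorm `q ≥ p` for which the canonical map `Ê_q → Ê_p` is nuclear. -/
def IsNuclearSpace (E : Type*) [AddCommGroup E] [Module ℂ E] [TopologicalSpace E]
    [IsTopologicalAddGroup E] [ContinuousSMul ℂ E] : Prop :=
  T2Space E ∧ LocallyConvexSpace ℝ E ∧
    ∀ p : Seminorm ℂ E, Continuous p →
      ∃ q : Seminorm ℂ E, Continuous q ∧ ∃ h : p ≤ q, IsNuclearMap (canonicalMap h)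

end Nuclear

/-! ## Generalized Gelfand-Shilov spaces -/

variable {d : ℕ}

/-- The partial derivative `∂f/∂x_i`. -/
def partialDeriv (i : Fin d) (f : (Fin d → ℝ) → ℂ) : (Fin d → ℝ) → ℂ :=
  fun x => fderiv ℝ f x (Pi.single i 1)

/-- `φ^{(α)} = (∂/∂x_1)^{α_1} ⋯ (∂/∂x_d)^{α_d} φ`. -/
def multiDeriv (α : Fin d → ℕ) (φ : (Fin d → ℝ) → ℂ) : (Fin d → ℝ) → ℂ :=
  (List.finRange d).foldr (fun i g => (partialDeriv i)^[α i] g) φ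

theorem contDiff_partialDeriv (i : Fin d) {f : (Fin d → ℝ) → ℂ} (hf : ContDiff ℝ ∞ f) :
    ContDiff ℝ ∞ (partialDeriv i f) :=
  (hf.fderiv_right (m := ∞) (by simp)).clm_apply contDiff_const

theorem partialDeriv_add (i : Fin d) {f g : (Fin d → ℝ) → ℂ} (hf : ContDiff ℝ ∞ f)
    (hg : ContDiff ℝ ∞ g) : partialDeriv i (f + g) = partialDeriv i f + partialDeriv i g := by
  funext x
  have h1 := (hf.differentiable (by simp)) x
  have h2 := (hg.differentiable (by simp)) x
  simp [partialDeriv, fderiv_add h1 h2]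

theorem partialDeriv_smul (i : Fin d) {f : (Fin d → ℝ) → ℂ} (hf : ContDiff ℝ ∞ f) (c : ℂ) :
    partialDeriv i (c • f) = c • partialDeriv i f := by
  funext x
  have h1 := (hf.differentiable (by simp)) x
  simp [partialDeriv, fderiv_const_smul h1]

theorem iterate_partialDeriv_aux (i : Fin d) (k : ℕ) {f g : (Fin d → ℝ) → ℂ}
    (hf : ContDiff ℝ ∞ f) (hg : ContDiff ℝ ∞ g) (c : ℂ) :
    ContDiff ℝ ∞ ((partialDeriv i)^[k] f) ∧
    (partialDeriv i)^[k] (f + g) = (partialDeriv i)^[k] f + (partialDeriv i)^[k] g ∧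
    (partialDeriv i)^[k] (c • f) = c • (partialDeriv i)^[k] f := by
  induction k generalizing f g with
  | zero => simp [hf]
  | succ k ih =>
    simp only [Function.iterate_succ, Function.comp_apply]
    rw [partialDeriv_add i hf hg, partialDeriv_smul i hf c]
    exact ih (contDiff_partialDeriv i hf) (contDiff_partialDeriv i hg)

theorem multiDeriv_aux (α : Fin d → ℕ) {f g : (Fin d → ℝ) → ℂ}
    (hf : ContDiff ℝ ∞ f) (hg : ContDiff ℝ ∞ g) (c : ℂ) :
    ContDiff ℝ ∞ (multiDeriv α f) ∧
    multiDeriv α (f + g) = multiDeriv α f + multiDeriv α g ∧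
    multiDeriv α (c • f) = c • multiDeriv α f := by
  have key : ∀ l : List (Fin d),
      ContDiff ℝ ∞ (l.foldr (fun i u => (partialDeriv i)^[α i] u) f) ∧
      ContDiff ℝ ∞ (l.foldr (fun i u => (partialDeriv i)^[α i] u) g) ∧
      l.foldr (fun i u => (partialDeriv i)^[α i] u) (f + g) =
        l.foldr (fun i u => (partialDeriv i)^[α i] u) f +
        l.foldr (fun i u => (partialDeriv i)^[α i] u) g ∧
      l.foldr (fun i u => (partialDeriv i)^[α i] u) (c • f) =
        c • l.foldr (fun i u => (partialDeriv i)^[α i] u) f := by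
    intro l
    induction l with
    | nil => simp [hf, hg]
    | cons i l ih =>
      obtain ⟨h1, h2, h3, h4⟩ := ih
      simp only [List.foldr_cons]
      rw [h3, h4]
      have a1 := iterate_partialDeriv_aux i (α i) h1 h2 c
      have a2 := iterate_partialDeriv_aux i (α i) h2 h1 c
      exact ⟨a1.1, a2.1, a1.2.1, a1.2.2⟩
  obtain ⟨h1, -, h3, h4⟩ := key (List.finRange d)
  exact ⟨h1, h3, h4⟩

/-- The quantity `m^{|α|+|β|} / (M_{|α|} M_{|β|}) · |(1+x²)^{β/2} φ^{(α)}(x)|`, where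
`(1+x²)^{β/2} = ∏_k (1+x_k²)^{β_k/2}`; the index is `(α, β, x)`. -/
def weightedDeriv (M : WeightSequence) (m : ℝ) (φ : (Fin d → ℝ) → ℂ)
    (t : (Fin d → ℕ) × (Fin d → ℕ) × (Fin d → ℝ)) : ℝ :=
  m ^ ((∑ k, t.1 k) + ∑ k, t.2.1 k) / (M (∑ k, t.1 k) * M (∑ k, t.2.1 k)) *
    ((∏ k, (1 + t.2.2 k ^ 2) ^ ((t.2.1 k : ℝ) / 2)) * ‖multiDeriv t.1 φ t.2.2‖)

section WeightedDeriv

variable (M : WeightSequence) (m : Set.Ioi (0 : ℝ))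

theorem weightedDeriv_nonneg (φ : (Fin d → ℝ) → ℂ)
    (t : (Fin d → ℕ) × (Fin d → ℕ) × (Fin d → ℝ)) : 0 ≤ weightedDeriv M m φ t := by
  have h0 : (0 : ℝ) < m := m.2
  have h1 := M.pos' (∑ k, t.1 k)
  have h2 := M.pos' (∑ k, t.2.1 k)
  unfold weightedDeriv
  positivity

theorem weightedDeriv_add_le {f g : (Fin d → ℝ) → ℂ} (hf : ContDiff ℝ ∞ f) (hg : ContDiff ℝ ∞ g)
    (t : (Fin d → ℕ) × (Fin d → ℕ) × (Fin d → ℝ)) :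
    weightedDeriv M m (f + g) t ≤ weightedDeriv M m f t + weightedDeriv M m g t := by
  have h0 : (0 : ℝ) < m := m.2
  have h1 := M.pos' (∑ k, t.1 k)
  have h2 := M.pos' (∑ k, t.2.1 k)
  unfold weightedDeriv
  rw [(multiDeriv_aux t.1 hf hg 0).2.1, ← mul_add, ← mul_add]
  gcongr
  exact norm_add_le _ _

theorem weightedDeriv_smul {f : (Fin d → ℝ) → ℂ} (hf : ContDiff ℝ ∞ f) (c : ℂ)
    (t : (Fin d → ℕ) × (Fin d → ℕ) × (Fin d → ℝ)) :
    weightedDeriv M m (c • f) t = ‖c‖ * weightedDeriv M m f t := by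
  unfold weightedDeriv
  rw [(multiDeriv_aux t.1 hf hf c).2.2, Pi.smul_apply, norm_smul]
  ring

end WeightedDeriv

/-- The underlying vector space of `S^{M_p,m}(ℝ^d)`: smooth functions `φ` for which
`sup_{α,β} m^{|α|+|β|} / (M_{|α|} M_{|β|}) ‖(1+x²)^{β/2} φ^{(α)}‖_∞` is finite. -/
def stepFunctions (M : WeightSequence) (d : ℕ) (m : Set.Ioi (0 : ℝ)) :
    Submodule ℂ ((Fin d → ℝ) → ℂ) where
  carrier := {φ | ContDiff ℝ ∞ φ ∧ ∃ C : ℝ, ∀ t, weightedDeriv M m φ t ≤ C}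
  zero_mem' := by
    refine ⟨contDiff_const, 0, fun t => ?_⟩
    have h := weightedDeriv_smul M m (f := (0 : (Fin d → ℝ) → ℂ)) contDiff_const 0 t
    simp only [smul_zero, norm_zero, zero_mul] at h
    exact h.le
  add_mem' := by
    rintro f g ⟨hf, C, hC⟩ ⟨hg, D, hD⟩
    exact ⟨hf.add hg, C + D, fun t =>
      (weightedDeriv_add_le M m hf hg t).trans (add_le_add (hC t) (hD t))⟩
  smul_mem' := by
    rintro c f ⟨hf, C, hC⟩
    refine ⟨contDiff_const.smul hf, ‖c‖ * C, fun t => ?_⟩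
    rw [weightedDeriv_smul M m hf]
    exact mul_le_mul_of_nonneg_left (hC t) (norm_nonneg _)

/-- The space `S^{M_p,m}(ℝ^d)`, with the norm below. -/
def GelfandShilovStep (M : WeightSequence) (d : ℕ) (m : Set.Ioi (0 : ℝ)) : Type :=
  ↥(stepFunctions M d m)

namespace GelfandShilovStep

variable (M : WeightSequence) (m : Set.Ioi (0 : ℝ))

instance : AddCommGroup (GelfandShilovStep M d m) :=
  inferInstanceAs (AddCommGroup ↥(stepFunctions M d m))

instance : Module ℂ (GelfandShilovStep M d m) :=
  inferInstanceAs (Module ℂ ↥(stepFunctions M d m))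

/-- `‖φ‖ = sup_{α,β} m^{|α|+|β|} / (M_{|α|} M_{|β|}) ‖(1+x²)^{β/2} φ^{(α)}‖_∞`. -/
instance : Norm (GelfandShilovStep M d m) := ⟨fun φ => ⨆ t, weightedDeriv M m φ.1 t⟩

theorem bddAbove (φ : GelfandShilovStep M d m) :
    BddAbove (Set.range fun t => weightedDeriv M m φ.1 t) := by
  obtain ⟨C, hC⟩ := φ.2.2
  exact ⟨C, by rintro _ ⟨t, rfl⟩; exact hC t⟩

theorem normCore : NormedSpace.Core ℂ (GelfandShilovStep M d m) where
  norm_nonneg φ := Real.iSup_nonneg fun t => weightedDeriv_nonneg M m φ.1 t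
  norm_smul c φ := by
    change (⨆ t, weightedDeriv M m (c • φ.1) t) = ‖c‖ * ⨆ t, weightedDeriv M m φ.1 t
    rw [Real.mul_iSup_of_nonneg (norm_nonneg _)]
    exact iSup_congr fun t => weightedDeriv_smul M m φ.2.1 c t
  norm_triangle φ ψ := by
    change (⨆ t, weightedDeriv M m (φ.1 + ψ.1) t) ≤
      (⨆ t, weightedDeriv M m φ.1 t) + ⨆ t, weightedDeriv M m ψ.1 t
    exact ciSup_le fun t => (weightedDeriv_add_le M m φ.2.1 ψ.2.1 t).trans
      (add_le_add (le_ciSup (bddAbove M m φ) t) (le_ciSup (bddAbove M m ψ) t))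
  norm_eq_zero_iff φ := by
    constructor
    · intro h
      apply Subtype.ext
      funext x
      have h1 : weightedDeriv M m φ.1 (0, 0, x) ≤ 0 := by
        exact (le_ciSup (bddAbove M m φ) (0, 0, x)).trans h.le
      have h2 : multiDeriv (0 : Fin d → ℕ) φ.1 = φ.1 := by
        simp [multiDeriv]
      simp [weightedDeriv, h2, M.zero'] at h1
      exact h1
    · rintro rfl
      change (⨆ t, weightedDeriv M m (0 : (Fin d → ℝ) → ℂ) t) = 0
      have h : ∀ t, weightedDeriv M m (0 : (Fin d → ℝ) → ℂ) t = 0 := fun t => by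
        have h := weightedDeriv_smul M m (f := (0 : (Fin d → ℝ) → ℂ)) contDiff_const 0 t
        simpa only [smul_zero, norm_zero, zero_mul] using h
      simp [h]

instance : NormedAddCommGroup (GelfandShilovStep M d m) := NormedAddCommGroup.ofCore (normCore M m)

instance : NormedSpace ℂ (GelfandShilovStep M d m) := NormedSpace.ofCore (normCore M m)

end GelfandShilovStep

/-- The space `S^{M_p}(ℝ^d)` of Roumieu type: the union (sum) of the increasing family of spaces
`S^{M_p,m}(ℝ^d)`, `m → 0`. -/
def GelfandShilov (M : WeightSequence) (d : ℕ) : Type :=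
  ↥(⨆ m : Set.Ioi (0 : ℝ), stepFunctions M d m)

namespace GelfandShilov

variable (M : WeightSequence) (d : ℕ)

instance : AddCommGroup (GelfandShilov M d) :=
  inferInstanceAs (AddCommGroup ↥(⨆ m : Set.Ioi (0 : ℝ), stepFunctions M d m))

instance : Module ℂ (GelfandShilov M d) :=
  inferInstanceAs (Module ℂ ↥(⨆ m : Set.Ioi (0 : ℝ), stepFunctions M d m))

variable {M d} in
/-- The function `ℝ^d → ℂ` underlying an element of `S^{M_p}(ℝ^d)`. -/
def toFun (φ : GelfandShilov M d) : (Fin d → ℝ) → ℂ := Subtype.val φ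

instance : CoeFun (GelfandShilov M d) (fun _ => (Fin d → ℝ) → ℂ) := ⟨toFun⟩

/-- The inclusion `S^{M_p,m} → S^{M_p}`. -/
def incl (m : Set.Ioi (0 : ℝ)) : GelfandShilovStep M d m →ₗ[ℂ] GelfandShilov M d :=
  Submodule.inclusion (le_iSup (fun m : Set.Ioi (0 : ℝ) => stepFunctions M d m) m)

instance : TopologicalSpace (GelfandShilov M d) := inductiveLimitTopology (incl M d)

instance : IsTopologicalAddGroup (GelfandShilov M d) :=
  inductiveLimitTopology_isTopologicalAddGroup _

instance : ContinuousSMul ℂ (GelfandShilov M d) := inductiveLimitTopology_continuousSMul _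

end GelfandShilov

/-! ## Sequences of ultrafast falloff -/

/-- The weight `exp[∑_k M(θ_k √n_k)]`. -/
def seqWeight (M : WeightSequence) (θ : Fin d → ℝ) (n : Fin d → ℕ) : ℝ :=
  Real.exp (∑ k, assoc M (θ k * √(n k : ℝ)))

theorem minkowski_aux {ι : Type*} {w : ι → ℝ} (hw : ∀ n, 0 < w n) {a b : ι → ℂ}
    (ha : Summable fun n => ‖a n‖ ^ 2 * w n) (hb : Summable fun n => ‖b n‖ ^ 2 * w n) :
    (Summable fun n => ‖a n + b n‖ ^ 2 * w n) ∧
    √(∑' n, ‖a n + b n‖ ^ 2 * w n) ≤ √(∑' n, ‖a n‖ ^ 2 * w n) + √(∑' n, ‖b n‖ ^ 2 * w n) := by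
  have e : ∀ (r : ℝ) n, r ^ 2 * w n = (r * √(w n)) ^ (2 : ℝ) := fun r n => by
    rw [Real.rpow_two, mul_pow, Real.sq_sqrt (hw n).le]
  have hle : ∀ n, ‖a n + b n‖ ^ 2 * w n ≤ (‖a n‖ * √(w n) + ‖b n‖ * √(w n)) ^ (2 : ℝ) := by
    intro n
    rw [e, ← add_mul]
    gcongr
    exact norm_add_le _ _
  simp only [e ‖a _‖, e ‖b _‖] at ha hb ⊢
  obtain ⟨h1, h2⟩ := Real.Lp_add_le_tsum_of_nonneg one_le_two (fun n => by positivity)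
    (fun n => by positivity) ha hb
  have h3 : Summable fun n => ‖a n + b n‖ ^ 2 * w n :=
    Summable.of_nonneg_of_le (fun n => mul_nonneg (sq_nonneg _) (hw n).le) hle h1
  refine ⟨h3, ?_⟩
  rw [Real.sqrt_eq_rpow, Real.sqrt_eq_rpow, Real.sqrt_eq_rpow]
  refine le_trans ?_ h2
  exact Real.rpow_le_rpow (tsum_nonneg fun n => mul_nonneg (sq_nonneg _) (hw n).le)
    (h3.tsum_le_tsum hle h1) (by norm_num)

/-- The set `ℝ^d_+` of parameters. -/
abbrev Param (d : ℕ) : Type := {θ : Fin d → ℝ // ∀ k, 0 < θ k}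

/-- The underlying vector space of `s_{M_p,θ}`: multisequences `a` with
`∑_n |a_n|² exp[∑_k M(θ_k √n_k)] < ∞`. -/
def stepSequences (M : WeightSequence) (d : ℕ) (θ : Param d) :
    Submodule ℂ ((Fin d → ℕ) → ℂ) where
  carrier := {a | Summable fun n => ‖a n‖ ^ 2 * seqWeight M θ.1 n}
  zero_mem' := by simp [summable_zero]
  add_mem' := fun ha hb => (minkowski_aux (fun _ => Real.exp_pos _) ha hb).1
  smul_mem' := by
    intro c a ha
    have h : (fun n => ‖(c • a) n‖ ^ 2 * seqWeight M θ.1 n) =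
        fun n => ‖c‖ ^ 2 * (‖a n‖ ^ 2 * seqWeight M θ.1 n) := by
      funext n; rw [Pi.smul_apply, norm_smul]; ring
    change Summable _
    rw [h]
    exact Summable.mul_left _ ha

/-- The space `s_{M_p,θ}`, with the norm below. -/
def FalloffStep (M : WeightSequence) (d : ℕ) (θ : Param d) : Type := ↥(stepSequences M d θ)

namespace FalloffStep

variable (M : WeightSequence) (θ : Param d)

instance : AddCommGroup (FalloffStep M d θ) := inferInstanceAs (AddCommGroup ↥(stepSequences M d θ))

instance : Module ℂ (FalloffStep M d θ) := inferInstanceAs (Module ℂ ↥(stepSequences M d θ))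

/-- `‖a‖_θ = (∑_n |a_n|² exp[∑_k M(θ_k √n_k)])^{1/2}`. -/
instance : Norm (FalloffStep M d θ) := ⟨fun a => √(∑' n, ‖a.1 n‖ ^ 2 * seqWeight M θ.1 n)⟩

theorem normCore : NormedSpace.Core ℂ (FalloffStep M d θ) where
  norm_nonneg a := Real.sqrt_nonneg _
  norm_smul c a := by
    change √(∑' n, ‖c • a.1 n‖ ^ 2 * seqWeight M θ.1 n) =
      ‖c‖ * √(∑' n, ‖a.1 n‖ ^ 2 * seqWeight M θ.1 n)
    simp only [norm_smul, mul_pow, mul_assoc]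
    rw [tsum_mul_left, Real.sqrt_mul (sq_nonneg _), Real.sqrt_sq (norm_nonneg _)]
  norm_triangle a b := (minkowski_aux (fun _ => Real.exp_pos _) a.2 b.2).2
  norm_eq_zero_iff a := by
    constructor
    · intro h
      have hs : Summable fun n => ‖a.1 n‖ ^ 2 * seqWeight M θ.1 n := a.2
      have h0 : ∀ n, 0 ≤ ‖a.1 n‖ ^ 2 * seqWeight M θ.1 n := fun n =>
        mul_nonneg (sq_nonneg _) (Real.exp_pos _).le
      have h1 : (∑' n, ‖a.1 n‖ ^ 2 * seqWeight M θ.1 n) = 0 :=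
        (Real.sqrt_eq_zero (tsum_nonneg h0)).1 h
      have h2 := (hasSum_zero_iff_of_nonneg h0).1 (h1 ▸ hs.hasSum)
      apply Subtype.ext
      funext n
      have h3 : ‖a.1 n‖ ^ 2 * seqWeight M θ.1 n = 0 := congrFun h2 n
      have h4 : seqWeight M θ.1 n ≠ 0 := (Real.exp_pos _).ne'
      have h5 : a.1 n = 0 := by simpa [h4] using h3
      exact h5
    · rintro rfl
      change √(∑' n, ‖(0 : (Fin d → ℕ) → ℂ) n‖ ^ 2 * seqWeight M θ.1 n) = 0
      simp

instance : NormedAddCommGroup (FalloffStep M d θ) := NormedAddCommGroup.ofCore (normCore M θ)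

instance : NormedSpace ℂ (FalloffStep M d θ) := NormedSpace.ofCore (normCore M θ)

end FalloffStep

/-- The space `s_{M_p}` of sequences of ultrafast falloff: the union (sum) of the directed family of
spaces `s_{M_p,θ}`, `θ ∈ ℝ^d_+`. -/
def UltrafastFalloff (M : WeightSequence) (d : ℕ) : Type :=
  ↥(⨆ θ : Param d, stepSequences M d θ)

namespace UltrafastFalloff

variable (M : WeightSequence) (d : ℕ)

instance : AddCommGroup (UltrafastFalloff M d) :=
  inferInstanceAs (AddCommGroup ↥(⨆ θ : Param d, stepSequences M d θ))

instance : Module ℂ (UltrafastFalloff M d) :=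
  inferInstanceAs (Module ℂ ↥(⨆ θ : Param d, stepSequences M d θ))

variable {M d} in
/-- The multisequence underlying an element of `s_{M_p}`. -/
def toFun (a : UltrafastFalloff M d) : (Fin d → ℕ) → ℂ := Subtype.val a

instance : CoeFun (UltrafastFalloff M d) (fun _ => (Fin d → ℕ) → ℂ) := ⟨toFun⟩

/-- The inclusion `s_{M_p,θ} → s_{M_p}`. -/
def incl (θ : Param d) : FalloffStep M d θ →ₗ[ℂ] UltrafastFalloff M d :=
  Submodule.inclusion (le_iSup (fun θ : Param d => stepSequences M d θ) θ)

instance : TopologicalSpace (UltrafastFalloff M d) := inductiveLimitTopology (incl M d)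

end UltrafastFalloff

/-! ## Hermite functions -/

/-- `H_n(x) = (-1)^n π^{-1/4} 2^{-n/2} (n!)^{-1/2} e^{x²/2} (d/dx)^n (e^{-x²})`. -/
def hermiteFun (n : ℕ) (x : ℝ) : ℝ :=
  (-1) ^ n * Real.pi ^ (-(1 / 4) : ℝ) * (2 : ℝ) ^ (-(n : ℝ) / 2) *
    (n.factorial : ℝ) ^ (-(1 / 2) : ℝ) * Real.exp (x ^ 2 / 2) *
    iteratedDeriv n (fun y : ℝ => Real.exp (-y ^ 2)) x

/-- `H_n(x) = H_{n_1}(x_1) ⋯ H_{n_d}(x_d)`. -/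
def hermiteFunMulti (n : Fin d → ℕ) (x : Fin d → ℝ) : ℝ := ∏ k, hermiteFun (n k) (x k)

/-! ## The sums of step spaces are unions, and the associated function is finite -/

theorem stepFunctions_anti (M : WeightSequence) (d : ℕ) {m m' : Set.Ioi (0 : ℝ)} (h : m' ≤ m) :
    stepFunctions M d m ≤ stepFunctions M d m' := by
  rintro φ ⟨hφ, C, hC⟩
  refine ⟨hφ, C, fun t => le_trans ?_ (hC t)⟩
  have h0 : (0 : ℝ) < m' := m'.2
  have h1 := M.pos' (∑ k, t.1 k)
  have h2 := M.pos' (∑ k, t.2.1 k)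
  have h3 : (m' : ℝ) ≤ m := h
  unfold weightedDeriv
  gcongr

/-- `S^{M_p}(ℝ^d)` is the set of functions that lie in some `S^{M_p,m}(ℝ^d)`. -/
theorem mem_iSup_stepFunctions (M : WeightSequence) (d : ℕ) (φ : (Fin d → ℝ) → ℂ) :
    φ ∈ (⨆ m : Set.Ioi (0 : ℝ), stepFunctions M d m) ↔
      ∃ m : Set.Ioi (0 : ℝ), φ ∈ stepFunctions M d m := by
  have : Nonempty (Set.Ioi (0 : ℝ)) := ⟨⟨1, Set.mem_Ioi.2 one_pos⟩⟩
  refine Submodule.mem_iSup_of_directed _ fun a b => ⟨min a b, ?_, ?_⟩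
  · exact stepFunctions_anti M d (min_le_left a b)
  · exact stepFunctions_anti M d (min_le_right a b)

theorem bddAbove_assoc {M : WeightSequence} (hM : NonTrivial M) {ρ : ℝ} (hρ : 0 ≤ ρ) :
    BddAbove (Set.range fun p : ℕ => Real.log (ρ ^ p / M p)) := by
  obtain ⟨C, L, hC, hL, h⟩ := hM
  rcases hρ.eq_or_lt with rfl | hρ
  · refine ⟨0, ?_⟩
    rintro _ ⟨p, rfl⟩
    rcases p with _ | p
    · simp [M.zero']
    · simp
  have key : ∀ p : ℕ, (max 1 (L * ρ)) ^ 2 ≤ p → ρ ^ p / M p ≤ C := by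
    intro p hp
    have hM := M.pos' p
    have h1 : (L * ρ) ^ p ≤ (p : ℝ) ^ ((p : ℝ) / 2) := by
      have h2 : L * ρ ≤ √(p : ℝ) :=
        Real.le_sqrt_of_sq_le (le_trans (by gcongr; exact le_max_right _ _) hp)
      calc (L * ρ) ^ p ≤ √(p : ℝ) ^ p := by gcongr
        _ = (p : ℝ) ^ ((p : ℝ) / 2) := by
          rw [Real.sqrt_eq_rpow, ← Real.rpow_natCast, ← Real.rpow_mul (Nat.cast_nonneg p)]
          ring_nf
    have h3 := h1.trans (h p)
    rw [mul_pow] at h3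
    rw [div_le_iff₀ hM]
    have hLp : 0 < L ^ p := pow_pos hL p
    nlinarith
  obtain ⟨N, hN⟩ := exists_nat_ge ((max 1 (L * ρ)) ^ 2)
  have hfin : BddAbove ((fun p : ℕ => Real.log (ρ ^ p / M p)) '' Set.Iio N) :=
    ((Set.finite_Iio N).image _).bddAbove
  obtain ⟨B, hB⟩ := hfin
  refine ⟨max B (Real.log C), ?_⟩
  rintro _ ⟨p, rfl⟩
  rcases lt_or_ge p N with hp | hp
  · exact (hB ⟨p, hp, rfl⟩).trans (le_max_left _ _)
  · refine le_trans (Real.log_le_log (div_pos (pow_pos hρ p) (M.pos' p)) (key p ?_))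
      (le_max_right _ _)
    exact hN.trans (by exact_mod_cast hp)

theorem assoc_mono {M : WeightSequence} (hM : NonTrivial M) {ρ ρ' : ℝ} (h0 : 0 ≤ ρ) (h : ρ ≤ ρ') :
    assoc M ρ ≤ assoc M ρ' := by
  have hb := bddAbove_assoc hM (h0.trans h)
  have hnn : 0 ≤ assoc M ρ' := by
    refine le_trans (le_of_eq ?_) (le_ciSup hb 0)
    simp [M.zero']
  refine ciSup_le fun p => ?_
  rcases h0.eq_or_lt with rfl | h0
  · rcases p with _ | p
    · simpa [M.zero'] using hnn
    · simpa using hnn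
  · refine le_trans (Real.log_le_log (div_pos (pow_pos h0 p) (M.pos' p)) ?_) (le_ciSup hb p)
    have := M.pos' p
    gcongr

/-- Under (M.3)'', `s_{M_p}` is the set of sequences that lie in some `s_{M_p,θ}`. -/
theorem mem_iSup_stepSequences {M : WeightSequence} (hM : NonTrivial M) (d : ℕ)
    (a : (Fin d → ℕ) → ℂ) :
    a ∈ (⨆ θ : Param d, stepSequences M d θ) ↔ ∃ θ : Param d, a ∈ stepSequences M d θ := by
  have : Nonempty (Param d) := ⟨⟨fun _ => 1, fun _ => one_pos⟩⟩
  have anti : ∀ {θ θ' : Param d}, (∀ k, θ'.1 k ≤ θ.1 k) →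
      stepSequences M d θ ≤ stepSequences M d θ' := by
    intro θ θ' h a ha
    refine Summable.of_nonneg_of_le (fun n => mul_nonneg (sq_nonneg _) (Real.exp_pos _).le)
      (fun n => ?_) ha
    refine mul_le_mul_of_nonneg_left (Real.exp_le_exp.2 (Finset.sum_le_sum fun k _ => ?_))
      (sq_nonneg _)
    exact assoc_mono hM (mul_nonneg (θ'.2 k).le (Real.sqrt_nonneg _))
      (mul_le_mul_of_nonneg_right (h k) (Real.sqrt_nonneg _))
  refine Submodule.mem_iSup_of_directed _ fun θ θ' =>
    ⟨⟨fun k => min (θ.1 k) (θ'.1 k), fun k => lt_min (θ.2 k) (θ'.2 k)⟩, ?_, ?_⟩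
  · exact anti fun k => min_le_left _ _
  · exact anti fun k => min_le_right _ _

end GelfandShilovHermite

end

/-!
Both directions of the isomorphism are quantitative statements about the oscillator operators.

*Decay of coefficients.* Integration by parts turns `x_k + ∂_k` on `φ` into a shift of the sequence
of Hermite coefficients, `a_n((x_k + ∂_k) φ) = √(2 (n_k + 1)) a_{n + e_k}(φ)`. By (M.1) the norm of
`S^{M_p,m}` controls all products of weights and derivatives by one quantity that depends only on
their total order (`controlledBy_of_weightedDeriv_le`). The commutators that arise when `x_k` is
moved past `s` derivatives cost a factor `s`, and `(s + 1) M_s ≤ K M_{s+2}` by (M.1) and (M.3)''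
(`exists_succ_mul_weight_le`); so `x_k + ∂_k` raises the order by one at the price of a constant
(`ControlledBy.annihilate`). Applying it `p ≤ n_k / 2` times gives `√n_k^p |a_n| ≤ C R^p M_p ‖φ‖`,
for larger `p` this is (M.3)'', and the infimum over `p` is a bound by `1 / exp M(ε √n_k)`.

*Convergence of series.* A word of length `N` in the `1 + |x_k|` and `∂_k` maps `H_n` to a
combination of Hermite functions with coefficients of size `(|n| + N)^{N/2}`, since `x_k H_n` and
`∂_k H_n` are combinations of `H_{n ± e_k}`. By (M.2) and (M.3)'' the norm of `H_n` in `S^{M_p,m}`,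
with `m` small, is therefore at most a constant times `∏_k exp M(ε √n_k)`, with `ε` as small as
desired (`exists_weightedDeriv_hermiteC_le`).

Condition (M.2) says that a power of `exp M(h ρ)` is dominated by `exp M(ρ)` for small `h`
(`exists_isoWeight_pow_le`), and `∏_k exp M(ε √n_k)` dominates the polynomial weight
`∏_k (1 + n_k)²`, whose inverse is summable. This bridges sums and suprema over `n`, and passes from
one variable to several. The coefficient and series maps are thus continuous between steps of the
inductive limits. They are mutually inverse by orthonormality and by completeness of the Hermite
functions: if all coefficients of `f` vanish, so does the Fourier transform of `f H_0`
(`eq_zero_of_hermiteCoeff_eq_zero`).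

*Nuclearity.* The Hermite expansion converges in `S^{M_p}` (`hasSum_hermiteElt`). Given a continuous
seminorm `p`, the seminorm `q(φ) = ∑_n |a_n(φ)| (p(H_n) + 1) ∏_k (1 + n_k)²` is continuous and
dominates `p`, and the functionals `a_n` have `q`-norms `‖a_n‖_q` with `∑_n ‖a_n‖_q p(H_n) < ∞`.
-/

open scoped ContDiff

namespace GelfandShilovHermite

open MeasureTheory

variable {d : ℕ} {M : WeightSequence}

/-! ### The associated weight function -/

/-- The exponential `exp M(ρ) = sup_p ρ^p / M_p` of the associated function. All growth conditions
on Hermite coefficients are phrased with it. -/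
noncomputable def expAssoc (M : WeightSequence) (ρ : ℝ) : ℝ := Real.exp (assoc M ρ)

theorem expAssoc_pos (ρ : ℝ) : 0 < expAssoc M ρ := Real.exp_pos _

theorem one_le_expAssoc (hM : NonTrivial M) {ρ : ℝ} (hρ : 0 ≤ ρ) : 1 ≤ expAssoc M ρ := by
  refine Real.one_le_exp ?_
  refine le_trans (le_of_eq ?_) (le_ciSup (bddAbove_assoc hM hρ) 0)
  simp [M.zero']

theorem expAssoc_mono (hM : NonTrivial M) {ρ ρ' : ℝ} (h0 : 0 ≤ ρ) (h : ρ ≤ ρ') :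
    expAssoc M ρ ≤ expAssoc M ρ' :=
  Real.exp_le_exp.2 (assoc_mono hM h0 h)

theorem pow_le_mul_expAssoc (hM : NonTrivial M) {ρ : ℝ} (hρ : 0 ≤ ρ) (p : ℕ) :
    ρ ^ p ≤ M p * expAssoc M ρ := by
  have hp := M.pos' p
  rcases (pow_nonneg hρ p).eq_or_lt with h | h
  · rw [← h]
    exact mul_nonneg hp.le (expAssoc_pos ρ).le
  · rw [mul_comm, ← div_le_iff₀ hp, ← Real.exp_log (div_pos h hp)]
    exact Real.exp_le_exp.2 (le_ciSup (bddAbove_assoc hM hρ) p)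

theorem mul_expAssoc_le {ρ c B : ℝ} (hρ : 0 ≤ ρ) (hc : 0 ≤ c)
    (h : ∀ p, c * ρ ^ p ≤ B * M p) : c * expAssoc M ρ ≤ B := by
  have h0 : c ≤ B := by simpa [M.zero'] using h 0
  rcases hc.eq_or_lt with rfl | hc
  · simpa using h0
  rw [mul_comm, ← le_div_iff₀ hc]
  have hB : 0 < B / c := div_pos (hc.trans_le h0) hc
  rw [← Real.exp_log hB]
  refine Real.exp_le_exp.2 (ciSup_le fun p => ?_)
  rcases (pow_nonneg hρ p).eq_or_lt with hp | hp
  · rw [← hp, zero_div, Real.log_zero]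
    exact Real.log_nonneg ((one_le_div hc).2 h0)
  · refine Real.log_le_log (div_pos hp (M.pos' p)) ?_
    rw [div_le_div_iff₀ (M.pos' p) hc, mul_comm]
    exact h p

/-- Condition (M.2) in the form `M_{p+q} ≤ A H^{p+q} M_p M_q`, with `A, H ≥ 1`. -/
theorem exists_weight_add_le (hM2 : Separative M) : ∃ A H : ℝ, 1 ≤ A ∧ 1 ≤ H ∧
    ∀ p q : ℕ, M (p + q) ≤ A * H ^ (p + q) * (M p * M q) := by
  obtain ⟨A, H, hA, hH, h⟩ := hM2
  refine ⟨max 1 A, max 1 H, le_max_left _ _, le_max_left _ _, fun p q => ?_⟩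
  have h1 := h (p + q) p (by omega)
  rw [Nat.add_sub_cancel_left] at h1
  refine h1.trans ?_
  have := M.pos' p
  have := M.pos' q
  gcongr
  · exact le_max_right _ _
  · exact le_max_right _ _

/-- Powers of `exp M` are absorbed by a dilation of the argument: this is what (M.2) says about the
associated function. -/
theorem exists_expAssoc_pow_le (hM2 : Separative M) (hM3 : NonTrivial M) (D : ℕ) :
    ∃ C h : ℝ, 1 ≤ C ∧ 0 < h ∧ h ≤ 1 ∧
      ∀ ρ : ℝ, 0 ≤ ρ → expAssoc M (h * ρ) ^ D ≤ C * expAssoc M ρ := by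
  obtain ⟨A, H, hA, hH, hAH⟩ := exists_weight_add_le hM2
  have hH0 : 0 < H := by linarith
  have sq : ∀ ρ : ℝ, 0 ≤ ρ → expAssoc M ρ ^ 2 ≤ A * expAssoc M (H * ρ) := by
    intro ρ hρ
    have key : ∀ p q : ℕ, ρ ^ q * ρ ^ p ≤ (A * M q * expAssoc M (H * ρ)) * M p := by
      intro p q
      have h1 := pow_le_mul_expAssoc hM3 (mul_nonneg hH0.le hρ) (p + q)
      have h2 : M (p + q) * expAssoc M (H * ρ) ≤
          A * H ^ (p + q) * (M p * M q) * expAssoc M (H * ρ) :=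
        mul_le_mul_of_nonneg_right (hAH p q) (expAssoc_pos _).le
      have h3 := h1.trans h2
      rw [mul_pow] at h3
      have h4 : 0 < H ^ (p + q) := by positivity
      refine le_of_mul_le_mul_left ?_ h4
      calc H ^ (p + q) * (ρ ^ q * ρ ^ p) = H ^ (p + q) * ρ ^ (p + q) := by ring
        _ ≤ _ := h3
        _ = _ := by ring
    have h1 : ∀ q : ℕ, ρ ^ q * expAssoc M ρ ≤ A * M q * expAssoc M (H * ρ) := fun q =>
      mul_expAssoc_le hρ (pow_nonneg hρ q) fun p => key p q
    have h2 : expAssoc M ρ * expAssoc M ρ ≤ A * expAssoc M (H * ρ) :=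
      mul_expAssoc_le hρ (expAssoc_pos _).le fun q => by
        have := h1 q
        nlinarith
    rwa [pow_two]
  have it : ∀ r : ℕ, ∃ C : ℝ, 1 ≤ C ∧
      ∀ ρ : ℝ, 0 ≤ ρ → expAssoc M ρ ^ (2 ^ r) ≤ C * expAssoc M (H ^ r * ρ) := by
    intro r
    induction r with
    | zero => exact ⟨1, le_rfl, fun ρ _ => by simp⟩
    | succ r ih =>
      obtain ⟨C, hC, h⟩ := ih
      refine ⟨C ^ 2 * A, one_le_mul_of_one_le_of_one_le (one_le_pow₀ hC) hA, fun ρ hρ => ?_⟩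
      have h1 := h ρ hρ
      have hE := (expAssoc_pos (M := M) ρ).le
      calc expAssoc M ρ ^ (2 ^ (r + 1)) = (expAssoc M ρ ^ (2 ^ r)) ^ 2 := by
            rw [← pow_mul, pow_succ]
        _ ≤ (C * expAssoc M (H ^ r * ρ)) ^ 2 := by gcongr
        _ = C ^ 2 * expAssoc M (H ^ r * ρ) ^ 2 := by ring
        _ ≤ C ^ 2 * (A * expAssoc M (H * (H ^ r * ρ))) := by
            gcongr
            exact sq _ (by positivity)
        _ = C ^ 2 * A * expAssoc M (H ^ (r + 1) * ρ) := by
            rw [pow_succ]; ring_nf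
  obtain ⟨C, hC, h⟩ := it D
  have hD : 1 ≤ H ^ D := one_le_pow₀ hH
  refine ⟨C, (H ^ D)⁻¹, hC, by positivity, inv_le_one_of_one_le₀ hD, fun ρ hρ => ?_⟩
  have h1 := h ((H ^ D)⁻¹ * ρ) (by positivity)
  rw [mul_inv_cancel_left₀ (by positivity)] at h1
  refine le_trans ?_ h1
  exact pow_le_pow_right₀ (one_le_expAssoc hM3 (by positivity)) Nat.lt_two_pow_self.le

/-- `M_p M_q ≤ M_{p+q}`, by logarithmic convexity and `M_0 = 1`. -/
theorem weight_mul_le (hM1 : LogConvex M) (p q : ℕ) : M p * M q ≤ M (p + q) := by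
  have ratio : ∀ p q : ℕ, p ≤ q → M (p + 1) * M q ≤ M p * M (q + 1) := by
    intro p q hpq
    induction q, hpq using Nat.le_induction with
    | base => rw [mul_comm]
    | succ q hq ih =>
      have h1 := hM1 (q + 1) (by omega)
      simp only [Nat.add_sub_cancel] at h1
      have a := M.pos' q
      have b := M.pos' (q + 1)
      have c := M.pos' p
      have e := M.pos' (q + 1 + 1)
      have f := M.pos' (p + 1)
      refine le_of_mul_le_mul_left ?_ a
      calc M q * (M (p + 1) * M (q + 1)) = (M (p + 1) * M q) * M (q + 1) := by ring
        _ ≤ (M p * M (q + 1)) * M (q + 1) := by gcongr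
        _ = M p * M (q + 1) ^ 2 := by ring
        _ ≤ M p * (M q * M (q + 1 + 1)) := by gcongr
        _ = _ := by ring
  induction p with
  | zero => simp [M.zero']
  | succ p ih =>
    have h := ratio p (p + q) (by omega)
    have c := M.pos' p
    have a := M.pos' (p + 1)
    refine le_of_mul_le_mul_left ?_ c
    calc M p * (M (p + 1) * M q) = M (p + 1) * (M p * M q) := by ring
      _ ≤ M (p + 1) * M (p + q) := by gcongr
      _ ≤ _ := h
      _ = _ := by rw [show p + 1 + q = p + q + 1 by ring]

theorem exists_sqrt_pow_le (hM3 : NonTrivial M) : ∃ C L : ℝ, 1 ≤ C ∧ 1 ≤ L ∧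
    ∀ p : ℕ, √(p : ℝ) ^ p ≤ C * L ^ p * M p := by
  obtain ⟨C, L, hC, hL, h⟩ := hM3
  refine ⟨max 1 C, max 1 L, le_max_left _ _, le_max_left _ _, fun p => ?_⟩
  have e : √(p : ℝ) ^ p = (p : ℝ) ^ ((p : ℝ) / 2) := by
    rw [Real.sqrt_eq_rpow, ← Real.rpow_natCast, ← Real.rpow_mul (Nat.cast_nonneg p)]
    ring_nf
  rw [e]
  refine (h p).trans ?_
  have := M.pos' p
  gcongr
  · exact le_max_right _ _
  · exact le_max_right _ _

/-- The quotients `M_{s+1} / M_s` increase by (M.1), and their geometric means grow like `√s` by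
(M.3)''; so each of them is at least a constant times `√s`. Commutators of `x` and `∂` cost such a
factor. -/
theorem exists_succ_mul_weight_le (hM1 : LogConvex M) (hM3 : NonTrivial M) :
    ∃ K : ℝ, 0 < K ∧ ∀ s : ℕ, ((s : ℝ) + 1) * M s ≤ K * M (s + 2) := by
  obtain ⟨C, L, hC, hL, h⟩ := exists_sqrt_pow_le hM3
  have hCL : 0 < C * L := by positivity
  refine ⟨(C * L) ^ 2, by positivity, fun s => ?_⟩
  set r : ℕ → ℝ := fun s => M (s + 1) / M s with hr
  have hr0 : ∀ s, 0 < r s := fun s => div_pos (M.pos' _) (M.pos' _)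
  have hrm : ∀ s, r s ≤ r (s + 1) := fun s => by
    rw [hr]
    simp only
    rw [div_le_div_iff₀ (M.pos' _) (M.pos' _)]
    have := hM1 (s + 1) (by omega)
    simp only [Nat.add_sub_cancel] at this
    nlinarith
  have hr' : Monotone r := monotone_nat_of_le_succ hrm
  have hp : ∀ t, t ≤ s + 1 → M t ≤ r s ^ t := by
    intro t
    induction t with
    | zero => simp [M.zero']
    | succ t ih =>
      intro ht
      have h1 := ih (by omega)
      have h2 : M (t + 1) = M t * r t := by
        rw [hr]; field_simp [(M.pos' t).ne']
      rw [h2, pow_succ]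
      have := hr0 s
      have := hr0 t
      have h3 : r t ≤ r s := hr' (by omega)
      gcongr
  have h1 : √((s : ℝ) + 1) ≤ C * L * r s := by
    have h2 : √((s : ℝ) + 1) ^ (s + 1) ≤ (C * L * r s) ^ (s + 1) := by
      have h3 := h (s + 1)
      push_cast at h3
      refine h3.trans ?_
      rw [mul_pow, mul_pow]
      have h4 := hp (s + 1) le_rfl
      have h5 : C ≤ C ^ (s + 1) := le_self_pow₀ hC (by omega)
      have := M.pos' (s + 1)
      gcongr
    exact le_of_pow_le_pow_left₀ (by omega) (mul_nonneg hCL.le (hr0 s).le) h2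
  have h2 : (s : ℝ) + 1 ≤ (C * L) ^ 2 * (r s * r (s + 1)) := by
    calc (s : ℝ) + 1 = √((s : ℝ) + 1) ^ 2 := (Real.sq_sqrt (by positivity)).symm
      _ ≤ (C * L * r s) ^ 2 := by gcongr
      _ = (C * L) ^ 2 * (r s * r s) := by ring
      _ ≤ _ := by
        have := hr0 s
        gcongr
        exact hrm s
  have h3 : r s * r (s + 1) = M (s + 2) / M s := by
    have a := (M.pos' s).ne'
    have b := (M.pos' (s + 1)).ne'
    rw [hr]; simp only [add_assoc, one_add_one_eq_two]; field_simp
  rw [h3] at h2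
  have a := M.pos' s
  calc ((s : ℝ) + 1) * M s ≤ (C * L) ^ 2 * (M (s + 2) / M s) * M s := by gcongr
    _ = _ := by field_simp

/-- The polynomial weight `∏_k (1 + n_k)²` on multi-indices; its inverse is summable. -/
noncomputable def polyWeight {d : ℕ} (n : Fin d → ℕ) : ℝ := ∏ k, (1 + (n k : ℝ)) ^ 2

theorem one_le_polyWeight {d : ℕ} (n : Fin d → ℕ) : 1 ≤ polyWeight n :=
  Finset.one_le_prod fun k _ => one_le_pow₀ (by simp)

theorem polyWeight_pos {d : ℕ} (n : Fin d → ℕ) : 0 < polyWeight n :=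
  one_pos.trans_le (one_le_polyWeight n)

theorem summable_inv_polyWeight (d : ℕ) : Summable fun n : Fin d → ℕ => (polyWeight n)⁻¹ := by
  have h1 : Summable fun j : ℕ => ((1 + (j : ℝ)) ^ 2)⁻¹ := by
    have := (summable_nat_add_iff 1).2 (Real.summable_nat_pow_inv.2 one_lt_two)
    simpa [add_comm] using this
  refine summable_of_sum_le (c := (∑' j : ℕ, ((1 + (j : ℝ)) ^ 2)⁻¹) ^ d)
    (fun n => inv_nonneg.2 (polyWeight_pos n).le) fun u => ?_
  obtain ⟨N, hN⟩ : ∃ N : ℕ, ∀ n ∈ u, ∀ k, n k < N := by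
    refine ⟨u.sup (fun n => ∑ k, n k) + 1, fun n hn k => Nat.lt_succ_of_le ?_⟩
    exact (Finset.single_le_sum (f := n) (fun _ _ => Nat.zero_le _) (Finset.mem_univ k)).trans
      (Finset.le_sup (f := fun n : Fin d → ℕ => ∑ k, n k) hn)
  have hsub : u ⊆ Fintype.piFinset fun _ : Fin d => Finset.range N := fun n hn => by
    simpa [Fintype.mem_piFinset] using hN n hn
  calc ∑ n ∈ u, (polyWeight n)⁻¹
      ≤ ∑ n ∈ Fintype.piFinset fun _ : Fin d => Finset.range N, (polyWeight n)⁻¹ :=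
        Finset.sum_le_sum_of_subset_of_nonneg hsub fun n _ _ => inv_nonneg.2 (polyWeight_pos n).le
    _ = ∏ _k : Fin d, ∑ j ∈ Finset.range N, ((1 + (j : ℝ)) ^ 2)⁻¹ := by
        rw [Finset.prod_univ_sum]
        refine Finset.sum_congr rfl fun n _ => ?_
        rw [polyWeight, Finset.prod_inv_distrib]
    _ = (∑ j ∈ Finset.range N, ((1 + (j : ℝ)) ^ 2)⁻¹) ^ d := by simp
    _ ≤ _ := by
        gcongr
        exact h1.sum_le_tsum _ fun j _ => by positivity

theorem seqWeight_eq_prod {d : ℕ} (θ : Fin d → ℝ) (n : Fin d → ℕ) :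
    seqWeight M θ n = ∏ k, expAssoc M (θ k * √(n k : ℝ)) := Real.exp_sum _ _

/-- The product `∏_k exp M(ε √n_k)`, the weight of `s_{M_p,θ}` for constant `θ = ε`. -/
noncomputable def isoWeight (M : WeightSequence) {d : ℕ} (ε : ℝ) (n : Fin d → ℕ) : ℝ :=
  ∏ k, expAssoc M (ε * √(n k : ℝ))

theorem isoWeight_pos {d : ℕ} (ε : ℝ) (n : Fin d → ℕ) : 0 < isoWeight M ε n :=
  Finset.prod_pos fun _ _ => expAssoc_pos _

theorem one_le_isoWeight (hM3 : NonTrivial M) {d : ℕ} {ε : ℝ} (hε : 0 ≤ ε) (n : Fin d → ℕ) :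
    1 ≤ isoWeight M ε n :=
  Finset.one_le_prod fun _ _ => one_le_expAssoc hM3 (by positivity)

theorem isoWeight_le_seqWeight (hM3 : NonTrivial M) {d : ℕ} {ε : ℝ} (hε : 0 ≤ ε) {θ : Fin d → ℝ}
    (h : ∀ k, ε ≤ θ k) (n : Fin d → ℕ) : isoWeight M ε n ≤ seqWeight M θ n := by
  rw [seqWeight_eq_prod]
  refine Finset.prod_le_prod (fun _ _ => (expAssoc_pos _).le) fun k _ => ?_
  exact expAssoc_mono hM3 (by positivity) (by gcongr; exact h k)

theorem exists_isoWeight_pow_le (hM2 : Separative M) (hM3 : NonTrivial M) (d D : ℕ) :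
    ∃ C h : ℝ, 1 ≤ C ∧ 0 < h ∧ h ≤ 1 ∧
      ∀ (ε : ℝ) (n : Fin d → ℕ), 0 ≤ ε → isoWeight M (h * ε) n ^ D ≤ C * isoWeight M ε n := by
  obtain ⟨C, h, hC, h0, h1, H⟩ := exists_expAssoc_pow_le hM2 hM3 D
  refine ⟨C ^ d, h, one_le_pow₀ hC, h0, h1, fun ε n hε => ?_⟩
  rw [isoWeight, isoWeight, ← Finset.prod_pow]
  calc ∏ k, expAssoc M (h * ε * √(n k : ℝ)) ^ D ≤ ∏ k, (C * expAssoc M (ε * √(n k : ℝ))) := by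
        refine Finset.prod_le_prod (fun _ _ => pow_nonneg (expAssoc_pos _).le _) fun k _ => ?_
        rw [mul_assoc]
        exact H _ (by positivity)
    _ = _ := by rw [Finset.prod_mul_distrib]; simp

theorem exists_polyWeight_le (hM3 : NonTrivial M) (d : ℕ) {ε : ℝ} (hε : 0 < ε) :
    ∃ C : ℝ, 1 ≤ C ∧ ∀ n : Fin d → ℕ, polyWeight n ≤ C * isoWeight M ε n := by
  set c : ℝ := 4 * (1 + M 4 / ε ^ 4) with hc
  have h4 := M.pos' 4
  have hc1 : 1 ≤ c := by
    have : 0 < M 4 / ε ^ 4 := by positivity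
    rw [hc]; linarith
  refine ⟨c ^ d, one_le_pow₀ hc1, fun n => ?_⟩
  have : c ^ d * isoWeight M ε n = ∏ k, (c * expAssoc M (ε * √(n k : ℝ))) := by
    rw [Finset.prod_mul_distrib]; simp [isoWeight]
  rw [this, polyWeight]
  refine Finset.prod_le_prod (fun _ _ => by positivity) fun k _ => ?_
  set E := expAssoc M (ε * √(n k : ℝ)) with hE
  have h1 : 1 ≤ E := one_le_expAssoc hM3 (by positivity)
  have h2 : (n k : ℝ) ^ 2 ≤ M 4 / ε ^ 4 * E := by
    have h3 := pow_le_mul_expAssoc hM3 (show 0 ≤ ε * √(n k : ℝ) by positivity) 4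
    have h5 : (ε * √(n k : ℝ)) ^ 4 = ε ^ 4 * (n k : ℝ) ^ 2 := by
      rw [mul_pow, show √(n k : ℝ) ^ 4 = (√(n k : ℝ) ^ 2) ^ 2 by ring,
        Real.sq_sqrt (Nat.cast_nonneg _)]
    rw [h5] at h3
    rw [div_mul_eq_mul_div, le_div_iff₀ (by positivity), mul_comm]
    exact h3
  have h3 : (1 + (n k : ℝ)) ^ 2 ≤ 2 + 2 * (n k : ℝ) ^ 2 := by nlinarith [sq_nonneg ((n k : ℝ) - 1)]
  have h6 : 0 ≤ M 4 / ε ^ 4 * E := by positivity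
  rw [hc]
  nlinarith

/-! ### Hermite functions in one variable -/

theorem hasDerivAt_iteratedDeriv_gaussian (n : ℕ) (x : ℝ) :
    HasDerivAt (iteratedDeriv n fun y : ℝ => Real.exp (-y ^ 2))
      (iteratedDeriv (n + 1) (fun y : ℝ => Real.exp (-y ^ 2)) x) x := by
  have hg : ContDiff ℝ ∞ fun y : ℝ => Real.exp (-y ^ 2) := by fun_prop
  rw [iteratedDeriv_succ]
  exact ((hg.differentiable_iteratedDeriv n
    (by exact_mod_cast WithTop.coe_lt_top n)) x).hasDerivAt

theorem iteratedDeriv_gaussian_succ (n : ℕ) (x : ℝ) :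
    iteratedDeriv (n + 1) (fun y : ℝ => Real.exp (-y ^ 2)) x =
      -2 * x * iteratedDeriv n (fun y : ℝ => Real.exp (-y ^ 2)) x -
        2 * n * iteratedDeriv (n - 1) (fun y : ℝ => Real.exp (-y ^ 2)) x := by
  induction n generalizing x with
  | zero =>
    rw [zero_add, iteratedDeriv_one]
    have : HasDerivAt (fun y : ℝ => Real.exp (-y ^ 2)) (Real.exp (-x ^ 2) * -(2 * x)) x := by
      simpa using ((hasDerivAt_pow 2 x).neg).exp
    rw [this.deriv]
    simp
    ring
  | succ n ih =>
    have h1 := hasDerivAt_iteratedDeriv_gaussian (n + 1) x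
    have h2 : HasDerivAt (fun x => -2 * x * iteratedDeriv n (fun y : ℝ => Real.exp (-y ^ 2)) x -
        2 * n * iteratedDeriv (n - 1) (fun y : ℝ => Real.exp (-y ^ 2)) x)
        (-2 * iteratedDeriv n (fun y : ℝ => Real.exp (-y ^ 2)) x +
          -2 * x * iteratedDeriv (n + 1) (fun y : ℝ => Real.exp (-y ^ 2)) x -
        2 * n * iteratedDeriv n (fun y : ℝ => Real.exp (-y ^ 2)) x) x := by
      refine HasDerivAt.sub ?_ ?_
      · have := ((hasDerivAt_id' x).const_mul (-2 : ℝ)).fun_mul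
          (hasDerivAt_iteratedDeriv_gaussian n x)
        simpa using this
      · rcases n with _ | n
        · simpa using hasDerivAt_const x (0 : ℝ)
        · exact (hasDerivAt_iteratedDeriv_gaussian n x).const_mul _
    have h3 := h1.unique (h2.congr_of_eventuallyEq (Filter.Eventually.of_forall ih))
    rw [h3]
    push_cast
    ring

theorem hermiteFun_const_succ (n : ℕ) :
    √(2 * ((n : ℝ) + 1)) * (Real.pi ^ (-(1 / 4) : ℝ) * (2 : ℝ) ^ (-((n + 1 : ℕ) : ℝ) / 2) *
      ((n + 1).factorial : ℝ) ^ (-(1 / 2) : ℝ)) =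
    Real.pi ^ (-(1 / 4) : ℝ) * (2 : ℝ) ^ (-(n : ℝ) / 2) * (n.factorial : ℝ) ^ (-(1 / 2) : ℝ) := by
  have h1 : (2 : ℝ) ^ (-((n + 1 : ℕ) : ℝ) / 2) = (2 : ℝ) ^ (-(n : ℝ) / 2) * (√2)⁻¹ := by
    rw [Real.sqrt_eq_rpow, ← Real.rpow_neg (by norm_num), ← Real.rpow_add (by norm_num)]
    push_cast; ring_nf
  have h2 : ((n + 1).factorial : ℝ) ^ (-(1 / 2) : ℝ) =
      (√((n : ℝ) + 1))⁻¹ * (n.factorial : ℝ) ^ (-(1 / 2) : ℝ) := by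
    rw [Nat.factorial_succ]
    push_cast
    rw [Real.mul_rpow (by positivity) (by positivity), Real.sqrt_eq_rpow,
      ← Real.rpow_neg (by positivity)]
  rw [h1, h2, Real.sqrt_mul (by norm_num)]
  have : √((n : ℝ) + 1) ≠ 0 := by positivity
  field_simp

/-- Creation operator: `(x - d/dx) H_n = √(2(n+1)) H_{n+1}`. -/
theorem hasDerivAt_hermiteFun (n : ℕ) (x : ℝ) :
    HasDerivAt (hermiteFun n)
      (x * hermiteFun n x - √(2 * ((n : ℝ) + 1)) * hermiteFun (n + 1) x) x := by
  have h1 : HasDerivAt (fun x : ℝ => Real.exp (x ^ 2 / 2)) (Real.exp (x ^ 2 / 2) * x) x := by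
    have := ((hasDerivAt_pow 2 x).div_const 2).exp
    simpa using this
  have h2 := (h1.mul (hasDerivAt_iteratedDeriv_gaussian n x)).const_mul
    ((-1) ^ n * (Real.pi ^ (-(1 / 4) : ℝ) * (2 : ℝ) ^ (-(n : ℝ) / 2) *
    (n.factorial : ℝ) ^ (-(1 / 2) : ℝ)))
  have e : hermiteFun n = fun x => ((-1) ^ n * (Real.pi ^ (-(1 / 4) : ℝ) *
      (2 : ℝ) ^ (-(n : ℝ) / 2) * (n.factorial : ℝ) ^ (-(1 / 2) : ℝ))) *
      (Real.exp (x ^ 2 / 2) * iteratedDeriv n (fun y : ℝ => Real.exp (-y ^ 2)) x) := by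
    funext x; rw [hermiteFun]; ring
  have h3 : √(2 * ((n : ℝ) + 1)) * hermiteFun (n + 1) x = (-1) ^ (n + 1) *
      (√(2 * ((n : ℝ) + 1)) * (Real.pi ^ (-(1 / 4) : ℝ) * (2 : ℝ) ^ (-((n + 1 : ℕ) : ℝ) / 2) *
      ((n + 1).factorial : ℝ) ^ (-(1 / 2) : ℝ))) *
      (Real.exp (x ^ 2 / 2) * iteratedDeriv (n + 1) (fun y : ℝ => Real.exp (-y ^ 2)) x) := by
    rw [hermiteFun]; ring
  rw [h3, hermiteFun_const_succ]
  rw [e]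
  refine h2.congr_deriv ?_
  simp only
  ring

theorem sqrt_two_mul_id_mul_hermiteFun (n : ℕ) (x : ℝ) :
    √2 * (x * hermiteFun n x) =
      √((n : ℝ) + 1) * hermiteFun (n + 1) x + √(n : ℝ) * hermiteFun (n - 1) x := by
  set c : ℕ → ℝ := fun n => Real.pi ^ (-(1 / 4) : ℝ) * (2 : ℝ) ^ (-(n : ℝ) / 2) *
    (n.factorial : ℝ) ^ (-(1 / 2) : ℝ) with hc
  have e : ∀ n, hermiteFun n x = (-1) ^ n * c n *
      (Real.exp (x ^ 2 / 2) * iteratedDeriv n (fun y : ℝ => Real.exp (-y ^ 2)) x) := fun n => by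
    rw [hermiteFun, hc]; ring
  have hs : ∀ n : ℕ, √(2 : ℝ) * √((n : ℝ) + 1) * c (n + 1) = c n := fun n => by
    rw [← Real.sqrt_mul (by norm_num)]; exact hermiteFun_const_succ n
  have h2 : √(2 : ℝ) * √2 = 2 := Real.mul_self_sqrt (by norm_num)
  have h20 : √(2 : ℝ) ≠ 0 := by positivity
  refine mul_left_cancel₀ h20 ?_
  rw [e n, e (n + 1), e (n - 1), iteratedDeriv_gaussian_succ]
  rcases n with _ | n
  · have := hs 0
    simp only [Nat.cast_zero, zero_add] at this
    simp only [pow_zero, one_mul, zero_add, pow_one, Nat.cast_zero, Real.sqrt_zero, zero_mul,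
      add_zero, mul_zero, sub_zero]
    linear_combination (x * c 0 * (Real.exp (x ^ 2 / 2) *
      iteratedDeriv 0 (fun y : ℝ => Real.exp (-y ^ 2)) x)) * h2 - 2 * x * (Real.exp (x ^ 2 / 2) *
      iteratedDeriv 0 (fun y : ℝ => Real.exp (-y ^ 2)) x) * this
  · have a := hs (n + 1)
    have b := hs n
    push_cast at a ⊢
    have h3 : √((n : ℝ) + 1) * √((n : ℝ) + 1) = (n : ℝ) + 1 :=
      Real.mul_self_sqrt (by positivity)
    set E := Real.exp (x ^ 2 / 2)
    set D := iteratedDeriv n (fun y : ℝ => Real.exp (-y ^ 2)) x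
    set D' := iteratedDeriv (n + 1) (fun y : ℝ => Real.exp (-y ^ 2)) x
    set s := √((n : ℝ) + 1)
    set t := √(2 : ℝ)
    have h4 : c n * t * s = 2 * ((n : ℝ) + 1) * c (n + 1) := by
      rw [← b, ← h3, ← h2]; ring
    rw [pow_succ, pow_succ]
    linear_combination ((-1) ^ n * (-1) * c (n + 1) * (E * D') * x) * h2 -
      ((-1) ^ n * E * (-2 * x * D' - 2 * (n + 1) * D)) * a - (-1) ^ n * E * D * h4

theorem sqrt_two_mul_deriv_hermiteFun (n : ℕ) (x : ℝ) :
    √2 * deriv (hermiteFun n) x =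
      √(n : ℝ) * hermiteFun (n - 1) x - √((n : ℝ) + 1) * hermiteFun (n + 1) x := by
  rw [(hasDerivAt_hermiteFun n x).deriv, mul_sub, sqrt_two_mul_id_mul_hermiteFun,
    Real.sqrt_mul (by norm_num)]
  have h2 : √(2 : ℝ) * √2 = 2 := Real.mul_self_sqrt (by norm_num)
  linear_combination (-√((n : ℝ) + 1) * hermiteFun (n + 1) x) * h2

theorem differentiable_hermiteFun (n : ℕ) : Differentiable ℝ (hermiteFun n) :=
  fun x => (hasDerivAt_hermiteFun n x).differentiableAt

theorem continuous_hermiteFun (n : ℕ) : Continuous (hermiteFun n) :=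
  (differentiable_hermiteFun n).continuous

theorem contDiff_hermiteFun (n : ℕ) : ContDiff ℝ ∞ (hermiteFun n) := by
  have h : ∀ k : ℕ, ∀ n, ContDiff ℝ k (hermiteFun n) := by
    intro k
    induction k with
    | zero => intro n; exact contDiff_zero.2 (continuous_hermiteFun n)
    | succ k ih =>
      intro n
      push_cast
      rw [contDiff_succ_iff_deriv]
      refine ⟨differentiable_hermiteFun n, by simp, ?_⟩
      have : deriv (hermiteFun n) =
          fun x => x * hermiteFun n x - √(2 * ((n : ℝ) + 1)) * hermiteFun (n + 1) x :=
        funext fun x => (hasDerivAt_hermiteFun n x).deriv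
      rw [this]
      exact (contDiff_id.mul (ih n)).sub (contDiff_const.mul (ih (n + 1)))
  exact contDiff_infty.2 fun k => h k n

theorem hermiteFun_zero (x : ℝ) :
    hermiteFun 0 x = Real.pi ^ (-(1 / 4) : ℝ) * Real.exp (-(x ^ 2 / 2)) := by
  simp only [hermiteFun, pow_zero, Nat.cast_zero, neg_zero, zero_div, Real.rpow_zero,
    Nat.factorial_zero, Nat.cast_one, Real.one_rpow, iteratedDeriv_zero, mul_one, one_mul,
    mul_assoc, ← Real.exp_add]
  ring_nf

theorem exists_abs_hermiteFun_le (n b : ℕ) :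
    ∃ C : ℝ, 0 < C ∧ ∀ x : ℝ, |x| ^ b * |hermiteFun n x| ≤ C * Real.exp (-(1 / 4) * x ^ 2) := by
  induction n using Nat.strong_induction_on generalizing b with
  | _ n ih =>
  rcases n with _ | n
  · have hc : 0 < Real.pi ^ (-(1 / 4) : ℝ) := by positivity
    refine ⟨(1 + 4 ^ b * b.factorial) * Real.pi ^ (-(1 / 4) : ℝ), by positivity, fun x => ?_⟩
    rw [hermiteFun_zero, abs_of_nonneg (mul_nonneg hc.le (Real.exp_pos _).le)]
    have h1 : |x| ^ b ≤ 1 + (x ^ 2) ^ b := by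
      rcases le_total (|x|) 1 with h | h
      · have := pow_le_one₀ (abs_nonneg x) h (n := b)
        have : 0 ≤ (x ^ 2) ^ b := by positivity
        linarith
      · have : |x| ^ b ≤ (|x| ^ 2) ^ b := by
          gcongr; nlinarith
        rw [sq_abs] at this
        linarith
    have h2 : (x ^ 2) ^ b ≤ 4 ^ b * b.factorial * Real.exp (x ^ 2 / 4) := by
      have := Real.pow_div_factorial_le_exp (x ^ 2 / 4) (by positivity) b
      rw [div_le_iff₀ (by positivity), div_pow, div_le_iff₀ (by positivity)] at this
      linarith
    have h3 : 1 ≤ Real.exp (x ^ 2 / 4) := Real.one_le_exp (by positivity)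
    have h4 : Real.exp (-(x ^ 2 / 2)) = Real.exp (-(1 / 4) * x ^ 2) * (Real.exp (x ^ 2 / 4))⁻¹ := by
      rw [← Real.exp_neg, ← Real.exp_add]; ring_nf
    rw [h4]
    have h5 : |x| ^ b ≤ (1 + 4 ^ b * b.factorial) * Real.exp (x ^ 2 / 4) := by
      rw [add_mul]; linarith
    have h6 := Real.exp_pos (x ^ 2 / 4)
    calc _ ≤ (1 + 4 ^ b * b.factorial) * Real.exp (x ^ 2 / 4) * (Real.pi ^ (-(1 / 4) : ℝ) *
          (Real.exp (-(1 / 4) * x ^ 2) * (Real.exp (x ^ 2 / 4))⁻¹)) := by gcongr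
      _ = _ := by field_simp
  · obtain ⟨C1, hC1, h1⟩ := ih n (by omega) (b + 1)
    obtain ⟨C2, hC2, h2⟩ := ih (n - 1) (by omega) b
    refine ⟨√2 * C1 + √(n : ℝ) * C2, by positivity, fun x => ?_⟩
    have hr := sqrt_two_mul_id_mul_hermiteFun n x
    have hs : 1 ≤ √((n : ℝ) + 1) := Real.one_le_sqrt.2 (by simp)
    have h3 : |hermiteFun (n + 1) x| ≤ √2 * (|x| * |hermiteFun n x|) +
        √(n : ℝ) * |hermiteFun (n - 1) x| := by
      calc |hermiteFun (n + 1) x| ≤ √((n : ℝ) + 1) * |hermiteFun (n + 1) x| :=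
            le_mul_of_one_le_left (abs_nonneg _) hs
        _ = |√2 * (x * hermiteFun n x) - √(n : ℝ) * hermiteFun (n - 1) x| := by
            rw [hr, add_sub_cancel_right, abs_mul, abs_of_nonneg (Real.sqrt_nonneg _)]
        _ ≤ _ := by
            refine (abs_sub _ _).trans (le_of_eq ?_)
            simp only [abs_mul, abs_of_nonneg (Real.sqrt_nonneg _)]
    have h4 := h1 x
    have h5 := h2 x
    rw [pow_succ] at h4
    calc |x| ^ b * |hermiteFun (n + 1) x|
        ≤ |x| ^ b * (√2 * (|x| * |hermiteFun n x|) + √(n : ℝ) * |hermiteFun (n - 1) x|) := by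
          gcongr
      _ = √2 * (|x| ^ b * |x| * |hermiteFun n x|) +
          √(n : ℝ) * (|x| ^ b * |hermiteFun (n - 1) x|) := by ring
      _ ≤ √2 * (C1 * Real.exp (-(1 / 4) * x ^ 2)) +
          √(n : ℝ) * (C2 * Real.exp (-(1 / 4) * x ^ 2)) := by gcongr
      _ = _ := by ring

theorem integrable_hermiteFun_mul (m n : ℕ) :
    Integrable fun x => hermiteFun m x * hermiteFun n x := by
  obtain ⟨C, hC, h⟩ := exists_abs_hermiteFun_le m 0
  obtain ⟨C', hC', h'⟩ := exists_abs_hermiteFun_le n 0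
  refine Integrable.mono' ((integrable_exp_neg_mul_sq (show (0 : ℝ) < 1 / 2 by norm_num)).const_mul
    (C * C')) ((continuous_hermiteFun m).mul (continuous_hermiteFun n)).aestronglyMeasurable
    (Filter.Eventually.of_forall fun x => ?_)
  have h1 := h x
  have h2 := h' x
  simp only [pow_zero, one_mul] at h1 h2
  rw [Real.norm_eq_abs, abs_mul]
  calc _ ≤ C * Real.exp (-(1 / 4) * x ^ 2) * (C' * Real.exp (-(1 / 4) * x ^ 2)) := by gcongr
    _ = C * C' * (Real.exp (-(1 / 4) * x ^ 2) * Real.exp (-(1 / 4) * x ^ 2)) := by ring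
    _ = _ := by rw [← Real.exp_add]; ring_nf

/-- Integration by parts gives `⟨H_m, (x - d/dx) H_n⟩ = ⟨(x + d/dx) H_m, H_n⟩`. -/
theorem sqrt_succ_mul_integral_hermiteFun_mul (m n : ℕ) :
    √((n : ℝ) + 1) * ∫ x, hermiteFun m x * hermiteFun (n + 1) x =
      √(m : ℝ) * ∫ x, hermiteFun (m - 1) x * hermiteFun n x := by
  have h2 : √(2 : ℝ) * √2 = 2 := Real.mul_self_sqrt (by norm_num)
  have h20 : √(2 : ℝ) ≠ 0 := by positivity
  have hd : ∀ n x, deriv (hermiteFun n) x = (√2)⁻¹ *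
      (√(n : ℝ) * hermiteFun (n - 1) x - √((n : ℝ) + 1) * hermiteFun (n + 1) x) := fun n x => by
    rw [← sqrt_two_mul_deriv_hermiteFun, inv_mul_cancel_left₀ h20]
  have hint : ∀ m n, Integrable fun x => hermiteFun m x * deriv (hermiteFun n) x := fun m n => by
    simp only [hd]
    have := (((integrable_hermiteFun_mul m (n - 1)).const_mul (√(n : ℝ))).sub
      ((integrable_hermiteFun_mul m (n + 1)).const_mul (√((n : ℝ) + 1)))).const_mul (√2)⁻¹
    refine this.congr (Filter.Eventually.of_forall fun x => ?_)
    simp only [Pi.sub_apply]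
    ring
  have hparts : ∫ x, hermiteFun m x * deriv (hermiteFun n) x =
      - ∫ x, deriv (hermiteFun m) x * hermiteFun n x :=
    integral_mul_deriv_eq_deriv_mul_of_integrable
      (fun x _ => (differentiable_hermiteFun m x).hasDerivAt)
      (fun x _ => (differentiable_hermiteFun n x).hasDerivAt) (hint m n)
      ((hint n m).congr (Filter.Eventually.of_forall fun x => mul_comm _ _))
      (integrable_hermiteFun_mul m n)
  have e1 : ∀ x, √((n : ℝ) + 1) * (hermiteFun m x * hermiteFun (n + 1) x) =
      √(m : ℝ) * (hermiteFun (m - 1) x * hermiteFun n x) - (√2)⁻¹ * (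
        hermiteFun m x * deriv (hermiteFun n) x + deriv (hermiteFun m) x * hermiteFun n x) := by
    intro x
    have a := sqrt_two_mul_id_mul_hermiteFun m x
    have b := sqrt_two_mul_id_mul_hermiteFun n x
    have c := sqrt_two_mul_deriv_hermiteFun m x
    have d := sqrt_two_mul_deriv_hermiteFun n x
    have h3 : (√(2 : ℝ))⁻¹ = √2 / 2 := by field_simp; linarith
    rw [h3]
    linear_combination (hermiteFun n x / 2) * a - (hermiteFun m x / 2) * b
      + (hermiteFun n x / 2) * c + (hermiteFun m x / 2) * d
  rw [← integral_const_mul, ← integral_const_mul]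
  simp only [e1]
  rw [integral_sub, integral_const_mul (√2)⁻¹, integral_add, hparts]
  · simp
  · exact hint m n
  · exact (hint n m).congr (Filter.Eventually.of_forall fun x => mul_comm _ _)
  · exact (integrable_hermiteFun_mul _ _).const_mul _
  · exact ((hint m n).add
      ((hint n m).congr (Filter.Eventually.of_forall fun x => mul_comm _ _))).const_mul _

theorem integral_hermiteFun_mul (m n : ℕ) :
    ∫ x, hermiteFun m x * hermiteFun n x = if m = n then 1 else 0 := by
  have h0 : ∀ n : ℕ, ∫ x, hermiteFun 0 x * hermiteFun (n + 1) x = 0 := fun n => by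
    have h := sqrt_succ_mul_integral_hermiteFun_mul 0 n
    have h1 : √((n : ℝ) + 1) ≠ 0 := by positivity
    simpa [h1] using h
  induction n generalizing m with
  | zero =>
    rcases m with _ | m
    · have e : ∀ x, hermiteFun 0 x * hermiteFun 0 x =
          Real.pi ^ (-(1 / 2) : ℝ) * Real.exp (-1 * x ^ 2) := fun x => by
        have h1 : Real.pi ^ (-(1 / 2) : ℝ) =
            Real.pi ^ (-(1 / 4) : ℝ) * Real.pi ^ (-(1 / 4) : ℝ) := by
          rw [← Real.rpow_add Real.pi_pos]; norm_num
        have h2 : Real.exp (-1 * x ^ 2) = Real.exp (-(x ^ 2 / 2)) * Real.exp (-(x ^ 2 / 2)) := by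
          rw [← Real.exp_add]; ring_nf
        rw [hermiteFun_zero, h1, h2]; ring
      simp only [e]
      rw [integral_const_mul, integral_gaussian, div_one, Real.sqrt_eq_rpow,
        ← Real.rpow_add Real.pi_pos]
      norm_num
    · simp only [mul_comm (hermiteFun (m + 1) _), h0]
      simp
  | succ n ih =>
    rcases m with _ | m
    · rw [h0]; simp
    · have h := sqrt_succ_mul_integral_hermiteFun_mul (m + 1) n
      have h1 : √((n : ℝ) + 1) ≠ 0 := by positivity
      rw [Nat.add_sub_cancel, ih m] at h
      refine mul_left_cancel₀ h1 (h.trans ?_)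
      by_cases hmn : m = n
      · subst hmn; simp
      · simp [hmn]

/-- A uniform bound of polynomial growth: `H_n(x)² = 2 ∫_{-∞}^x H_n H_n'`, and `H_n'` is a
combination of two Hermite functions. -/
theorem hermiteFun_sq_le (n : ℕ) (x : ℝ) : hermiteFun n x ^ 2 ≤ 2 * (n : ℝ) + 2 := by
  set B : ℝ → ℝ := fun y => hermiteFun n y * hermiteFun n y +
    ((n : ℝ) * (hermiteFun (n - 1) y * hermiteFun (n - 1) y) +
      ((n : ℝ) + 1) * (hermiteFun (n + 1) y * hermiteFun (n + 1) y)) with hB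
  have hBi : Integrable B := (integrable_hermiteFun_mul n n).add
    (((integrable_hermiteFun_mul _ _).const_mul _).add
      ((integrable_hermiteFun_mul _ _).const_mul _))
  have hB0 : ∀ y, 0 ≤ B y := fun y => by
    have := mul_self_nonneg (hermiteFun n y)
    have := mul_self_nonneg (hermiteFun (n - 1) y)
    have := mul_self_nonneg (hermiteFun (n + 1) y)
    simp only [hB]
    positivity
  have hBint : ∫ y, B y = 2 * (n : ℝ) + 2 := by
    simp only [hB]
    rw [integral_add, integral_add, integral_const_mul, integral_const_mul]
    · simp only [integral_hermiteFun_mul, if_true]; ring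
    · exact (integrable_hermiteFun_mul _ _).const_mul _
    · exact (integrable_hermiteFun_mul _ _).const_mul _
    · exact integrable_hermiteFun_mul _ _
    · exact ((integrable_hermiteFun_mul _ _).const_mul _).add
        ((integrable_hermiteFun_mul _ _).const_mul _)
  have hle : ∀ y, |2 * (hermiteFun n y * deriv (hermiteFun n) y)| ≤ B y := by
    intro y
    have hd := sqrt_two_mul_deriv_hermiteFun n y
    have h1 : 2 * deriv (hermiteFun n) y ^ 2 ≤ 2 * ((n : ℝ) * (hermiteFun (n - 1) y *
        hermiteFun (n - 1) y) + ((n : ℝ) + 1) * (hermiteFun (n + 1) y * hermiteFun (n + 1) y)) := by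
      have h2 : 2 * deriv (hermiteFun n) y ^ 2 = (√2 * deriv (hermiteFun n) y) ^ 2 := by
        rw [mul_pow, Real.sq_sqrt (by norm_num)]
      rw [h2, hd]
      have a := Real.mul_self_sqrt (Nat.cast_nonneg (α := ℝ) n)
      have b := Real.mul_self_sqrt (show (0 : ℝ) ≤ (n : ℝ) + 1 by positivity)
      have e1 : (n : ℝ) * (hermiteFun (n - 1) y * hermiteFun (n - 1) y) =
          (√(n : ℝ) * hermiteFun (n - 1) y) ^ 2 := by
        linear_combination (-hermiteFun (n - 1) y ^ 2) * a
      have e2 : ((n : ℝ) + 1) * (hermiteFun (n + 1) y * hermiteFun (n + 1) y) =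
          (√((n : ℝ) + 1) * hermiteFun (n + 1) y) ^ 2 := by
        linear_combination (-hermiteFun (n + 1) y ^ 2) * b
      rw [e1, e2]
      nlinarith [sq_nonneg (√(n : ℝ) * hermiteFun (n - 1) y +
        √((n : ℝ) + 1) * hermiteFun (n + 1) y)]
    have h3 : B y = hermiteFun n y ^ 2 + ((n : ℝ) * (hermiteFun (n - 1) y *
        hermiteFun (n - 1) y) + ((n : ℝ) + 1) * (hermiteFun (n + 1) y * hermiteFun (n + 1) y)) := by
      simp only [hB]; ring
    rw [abs_le, h3]
    constructor <;> nlinarith [sq_nonneg (hermiteFun n y - deriv (hermiteFun n) y),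
      sq_nonneg (hermiteFun n y + deriv (hermiteFun n) y)]
  have hder : ∀ y, HasDerivAt (fun y => hermiteFun n y ^ 2)
      (2 * (hermiteFun n y * deriv (hermiteFun n) y)) y := fun y => by
    have := (differentiable_hermiteFun n y).hasDerivAt.fun_pow 2
    simpa [mul_assoc] using this
  have hint : Integrable fun y => 2 * (hermiteFun n y * deriv (hermiteFun n) y) := by
    refine hBi.mono' ?_ (Filter.Eventually.of_forall hle)
    refine Continuous.aestronglyMeasurable ?_
    exact continuous_const.mul ((continuous_hermiteFun n).mul
      ((contDiff_hermiteFun n).continuous_deriv (by simp)))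
  have hlim : Filter.Tendsto (fun y => hermiteFun n y ^ 2) Filter.atBot (nhds 0) := by
    refine tendsto_zero_of_hasDerivAt_of_integrableOn_Iic (a := x) (fun y _ => hder y)
      hint.integrableOn ?_
    simpa [pow_two] using (integrable_hermiteFun_mul n n).integrableOn (s := Set.Iic x)
  have hftc := integral_Iic_of_hasDerivAt_of_tendsto' (a := x) (fun y _ => hder y)
    hint.integrableOn hlim
  rw [sub_zero] at hftc
  rw [← hftc, ← hBint]
  calc _ ≤ ∫ y in Set.Iic x, B y :=
        setIntegral_mono hint.integrableOn hBi.integrableOn fun y => (le_abs_self _).trans (hle y)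
    _ ≤ _ := setIntegral_le_integral hBi (Filter.Eventually.of_forall hB0)

/-! ### Partial derivatives along words -/

/-- The iterated partial derivative along a word `l = [i₁, …, i_r]` of indices:
`∂_{i₁} ⋯ ∂_{i_r} f`. Words are more convenient for inductions than multi-indices. -/
noncomputable def wordDeriv (l : List (Fin d)) (f : (Fin d → ℝ) → ℂ) : (Fin d → ℝ) → ℂ :=
  l.foldr partialDeriv f

/-- The word in which the letter `i` occurs `α i` times, in increasing order. -/
def wordOf (α : Fin d → ℕ) : List (Fin d) :=
  (List.finRange d).flatMap fun i => List.replicate (α i) i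

@[simp] theorem wordDeriv_nil (f : (Fin d → ℝ) → ℂ) : wordDeriv [] f = f := rfl

@[simp] theorem wordDeriv_cons (i : Fin d) (l : List (Fin d)) (f : (Fin d → ℝ) → ℂ) :
    wordDeriv (i :: l) f = partialDeriv i (wordDeriv l f) := rfl

theorem wordDeriv_concat (i : Fin d) (l : List (Fin d)) (f : (Fin d → ℝ) → ℂ) :
    wordDeriv (l ++ [i]) f = wordDeriv l (partialDeriv i f) := by
  simp [wordDeriv]

theorem multiDeriv_eq_wordDeriv (α : Fin d → ℕ) (f : (Fin d → ℝ) → ℂ) :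
    multiDeriv α f = wordDeriv (wordOf α) f := by
  have h : ∀ (i : Fin d) (k : ℕ) (g : (Fin d → ℝ) → ℂ),
      (List.replicate k i).foldr partialDeriv g = (partialDeriv i)^[k] g := by
    intro i k g
    induction k with
    | zero => rfl
    | succ k ih => rw [List.replicate_succ, List.foldr_cons, ih, Function.iterate_succ_apply']
  unfold multiDeriv wordDeriv wordOf
  induction List.finRange d with
  | nil => rfl
  | cons i l ih => rw [List.foldr_cons, List.flatMap_cons, List.foldr_append, h, ih]

theorem length_wordOf (α : Fin d → ℕ) : (wordOf α).length = ∑ i, α i := by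
  simp [wordOf, List.length_flatMap, List.sum_ofFn, ← List.ofFn_eq_map]

theorem prod_map_wordOf (α : Fin d → ℕ) (f : Fin d → ℝ) :
    ((wordOf α).map f).prod = ∏ i, f i ^ α i := by
  have h : ∀ l : List (Fin d), ((l.flatMap fun i => List.replicate (α i) i).map f).prod =
      (l.map fun i => f i ^ α i).prod := by
    intro l
    induction l with
    | nil => rfl
    | cons i l ih =>
      rw [List.flatMap_cons, List.map_append, List.prod_append, ih]
      simp
  rw [wordOf, h, ← List.ofFn_eq_map, List.prod_ofFn]

theorem count_wordOf (α : Fin d → ℕ) (i : Fin d) : (wordOf α).count i = α i := by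
  rw [wordOf, List.count_flatMap]
  simp only [Function.comp_def, List.count_replicate]
  rw [← List.ofFn_eq_map, List.sum_ofFn]
  simp

theorem perm_wordOf_count (l : List (Fin d)) : l.Perm (wordOf fun i => l.count i) :=
  List.perm_iff_count.2 fun i => (count_wordOf (fun i => l.count i) i).symm

theorem contDiff_wordDeriv (l : List (Fin d)) {f : (Fin d → ℝ) → ℂ} (hf : ContDiff ℝ ∞ f) :
    ContDiff ℝ ∞ (wordDeriv l f) := by
  induction l with
  | nil => exact hf
  | cons i l ih => exact contDiff_partialDeriv i ih

theorem wordDeriv_add (l : List (Fin d)) {f g : (Fin d → ℝ) → ℂ} (hf : ContDiff ℝ ∞ f)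
    (hg : ContDiff ℝ ∞ g) : wordDeriv l (f + g) = wordDeriv l f + wordDeriv l g := by
  induction l with
  | nil => rfl
  | cons i l ih =>
    rw [wordDeriv_cons, ih, partialDeriv_add i (contDiff_wordDeriv l hf) (contDiff_wordDeriv l hg)]
    rfl

theorem wordDeriv_smul (l : List (Fin d)) {f : (Fin d → ℝ) → ℂ} (hf : ContDiff ℝ ∞ f) (c : ℂ) :
    wordDeriv l (c • f) = c • wordDeriv l f := by
  induction l with
  | nil => rfl
  | cons i l ih => rw [wordDeriv_cons, ih, partialDeriv_smul i (contDiff_wordDeriv l hf)]; rfl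

theorem partialDeriv_comm (i j : Fin d) {f : (Fin d → ℝ) → ℂ} (hf : ContDiff ℝ ∞ f) :
    partialDeriv i (partialDeriv j f) = partialDeriv j (partialDeriv i f) := by
  have key : ∀ (i j : Fin d) (x : Fin d → ℝ), partialDeriv i (partialDeriv j f) x =
      fderiv ℝ (fderiv ℝ f) x (Pi.single i 1) (Pi.single j 1) := by
    intro i j x
    have h1 : DifferentiableAt ℝ (fderiv ℝ f) x :=
      ((hf.fderiv_right (m := ∞) (by simp)).differentiable (by simp)) x
    have h2 := (h1.hasFDerivAt.clm_apply (hasFDerivAt_const (Pi.single j (1 : ℝ)) x)).fderiv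
    change fderiv ℝ (fun y => fderiv ℝ f y (Pi.single j 1)) x (Pi.single i 1) = _
    rw [h2]
    simp
  funext x
  rw [key, key]
  have h2 : minSmoothness ℝ 2 ≤ (∞ : WithTop ℕ∞) := by
    rw [minSmoothness_of_isRCLikeNormedField]
    exact WithTop.coe_le_coe.2 (le_top : (2 : ℕ∞) ≤ ⊤)
  exact (hf.contDiffAt.isSymmSndFDerivAt h2) _ _

theorem wordDeriv_perm {l l' : List (Fin d)} (h : l.Perm l') {f : (Fin d → ℝ) → ℂ}
    (hf : ContDiff ℝ ∞ f) : wordDeriv l f = wordDeriv l' f := by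
  induction h with
  | nil => rfl
  | cons i _ ih => rw [wordDeriv_cons, wordDeriv_cons, ih]
  | swap i j l => exact partialDeriv_comm _ _ (contDiff_wordDeriv l hf)
  | trans _ _ ih1 ih2 => exact ih1.trans ih2

theorem wordDeriv_eq_multiDeriv (l : List (Fin d)) {f : (Fin d → ℝ) → ℂ} (hf : ContDiff ℝ ∞ f) :
    wordDeriv l f = multiDeriv (fun i => l.count i) f := by
  rw [multiDeriv_eq_wordDeriv]
  exact wordDeriv_perm (perm_wordOf_count l) hf

theorem fderiv_eq_sum_partialDeriv (f : (Fin d → ℝ) → ℂ) (x : Fin d → ℝ) :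
    fderiv ℝ f x = ∑ i, (ContinuousLinearMap.proj (R := ℝ) (φ := fun _ : Fin d => ℝ) i).smulRight
      (partialDeriv i f x) := by
  ext v
  have hv : v = ∑ i, v i • (Pi.single i 1 : Fin d → ℝ) := by
    simpa using (pi_eq_sum_univ' v)
  conv_lhs => rw [hv]
  simp [partialDeriv, map_sum]

/-- Termwise differentiation: a series of smooth functions all of whose partial derivatives are
dominated by summable sequences is smooth and may be differentiated term by term. -/
theorem contDiff_tsum_of_wordDeriv {ι : Type*} {f : ι → (Fin d → ℝ) → ℂ}
    (hf : ∀ n, ContDiff ℝ ∞ (f n)) {u : List (Fin d) → ι → ℝ} (hu : ∀ l, Summable (u l))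
    (hb : ∀ l n x, ‖wordDeriv l (f n) x‖ ≤ u l n) :
    ContDiff ℝ ∞ (fun x => ∑' n, f n x) ∧
      ∀ l, wordDeriv l (fun x => ∑' n, f n x) = fun x => ∑' n, wordDeriv l (f n) x := by
  have step : ∀ (f : ι → (Fin d → ℝ) → ℂ) (u : List (Fin d) → ι → ℝ),
      (∀ n, ContDiff ℝ ∞ (f n)) → (∀ l, Summable (u l)) →
      (∀ l n x, ‖wordDeriv l (f n) x‖ ≤ u l n) →
      Differentiable ℝ (fun x => ∑' n, f n x) ∧
      ∀ i, partialDeriv i (fun x => ∑' n, f n x) = fun x => ∑' n, partialDeriv i (f n) x := by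
    intro f u hf hu hb
    have hbd : ∀ n x, ‖fderiv ℝ (f n) x‖ ≤ ∑ i, u [i] n := by
      intro n x
      rw [fderiv_eq_sum_partialDeriv]
      refine norm_sum_le_of_le _ fun i _ => ?_
      rw [ContinuousLinearMap.norm_smulRight_apply]
      have h1 : ‖ContinuousLinearMap.proj (R := ℝ) (φ := fun _ : Fin d => ℝ) i‖ ≤ 1 :=
        ContinuousLinearMap.opNorm_le_bound _ zero_le_one fun v => by
          simpa using norm_le_pi_norm v i
      calc _ ≤ 1 * ‖partialDeriv i (f n) x‖ := by gcongr
        _ ≤ _ := by rw [one_mul]; exact hb [i] n x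
    have hs : Summable fun n => ∑ i, u [i] n := summable_sum fun i _ => hu [i]
    have hs0 : ∀ x, Summable fun n => f n x := fun x =>
      Summable.of_norm_bounded (hu []) fun n => hb [] n x
    have hd : ∀ x, HasFDerivAt (fun x => ∑' n, f n x) (∑' n, fderiv ℝ (f n) x) x := fun x =>
      hasFDerivAt_tsum hs (fun n x => ((hf n).differentiable (by simp) x).hasFDerivAt) hbd
        (hs0 0) x
    refine ⟨fun x => (hd x).differentiableAt, fun i => funext fun x => ?_⟩
    have hsum : Summable fun n => fderiv ℝ (f n) x := Summable.of_norm_bounded hs fun n => hbd n x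
    have := (ContinuousLinearMap.apply ℝ ℂ (Pi.single i (1 : ℝ) : Fin d → ℝ)).map_tsum hsum
    rw [partialDeriv, (hd x).fderiv]
    exact this
  refine ⟨contDiff_infty.2 fun k => ?_, fun l => ?_⟩
  · induction k generalizing f u with
    | zero => exact contDiff_zero.2 (step f u hf hu hb).1.continuous
    | succ k ih =>
      obtain ⟨h1, h2⟩ := step f u hf hu hb
      push_cast
      rw [contDiff_succ_iff_fderiv]
      refine ⟨h1, by simp, ?_⟩
      rw [show fderiv ℝ (fun x => ∑' n, f n x) = fun x => _ from
        funext (fderiv_eq_sum_partialDeriv _)]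
      refine ContDiff.sum fun i _ => ?_
      rw [h2 i]
      refine contDiff_const.smulRight (ih (f := fun n => partialDeriv i (f n))
        (u := fun l => u (l ++ [i])) (fun n => contDiff_partialDeriv i (hf n)) (fun l => hu _)
        fun l n x => ?_)
      rw [← wordDeriv_concat]
      exact hb _ n x
  · induction l using List.reverseRecOn generalizing f u with
    | nil => rfl
    | append_singleton l i ih =>
      simp only [wordDeriv_concat, (step f u hf hu hb).2 i]
      refine ih (f := fun n => partialDeriv i (f n)) (u := fun l => u (l ++ [i]))
        (fun n => contDiff_partialDeriv i (hf n)) (fun l => hu _) fun l n x => ?_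
      rw [← wordDeriv_concat]
      exact hb _ n x

/-! ### Hermite functions in several variables -/

/-- The Hermite function `H_n` as a complex-valued function. -/
noncomputable def hermiteC (n : Fin d → ℕ) (x : Fin d → ℝ) : ℂ := (hermiteFunMulti n x : ℂ)

/-- The multi-index `n + e_k`. -/
def raise (n : Fin d → ℕ) (k : Fin d) : Fin d → ℕ := Function.update n k (n k + 1)

/-- The multi-index `n - e_k`, with truncated subtraction. -/
def lower (n : Fin d → ℕ) (k : Fin d) : Fin d → ℕ := Function.update n k (n k - 1)

theorem hermiteFunMulti_update (n : Fin d → ℕ) (k : Fin d) (j : ℕ) (x : Fin d → ℝ) :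
    hermiteFunMulti (Function.update n k j) x =
      hermiteFun j (x k) * ∏ i ∈ Finset.univ.erase k, hermiteFun (n i) (x i) := by
  rw [hermiteFunMulti, ← Finset.mul_prod_erase _ _ (Finset.mem_univ k)]
  simp only [Function.update_self]
  congr 1
  refine Finset.prod_congr rfl fun i hi => ?_
  rw [Function.update_of_ne (Finset.ne_of_mem_erase hi)]

theorem hermiteFunMulti_eq (n : Fin d → ℕ) (k : Fin d) (x : Fin d → ℝ) :
    hermiteFunMulti n x =
      hermiteFun (n k) (x k) * ∏ i ∈ Finset.univ.erase k, hermiteFun (n i) (x i) := by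
  rw [← hermiteFunMulti_update, Function.update_eq_self]

theorem contDiff_hermiteC (n : Fin d → ℕ) : ContDiff ℝ ∞ (hermiteC n) := by
  have h : ContDiff ℝ ∞ (fun x : Fin d → ℝ => ∏ k, hermiteFun (n k) (x k)) :=
    contDiff_prod fun k _ => (contDiff_hermiteFun (n k)).comp (contDiff_apply ℝ ℝ k)
  exact Complex.ofRealCLM.contDiff.comp h

theorem continuous_hermiteC (n : Fin d → ℕ) : Continuous (hermiteC n) :=
  (contDiff_hermiteC n).continuous

theorem ofReal_mul_hermiteC (n : Fin d → ℕ) (k : Fin d) (x : Fin d → ℝ) :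
    (x k : ℂ) * hermiteC n x = ((√((n k : ℝ) + 1) / √2 : ℝ) : ℂ) * hermiteC (raise n k) x +
      ((√(n k : ℝ) / √2 : ℝ) : ℂ) * hermiteC (lower n k) x := by
  simp only [hermiteC, raise, lower]
  norm_cast
  push_cast
  rw [hermiteFunMulti_eq n k, hermiteFunMulti_update, hermiteFunMulti_update]
  have h := sqrt_two_mul_id_mul_hermiteFun (n k) (x k)
  have h2 : √(2 : ℝ) ≠ 0 := by positivity
  set P := ∏ i ∈ Finset.univ.erase k, hermiteFun (n i) (x i)
  field_simp
  linear_combination P * h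

theorem partialDeriv_hermiteC (n : Fin d → ℕ) (k : Fin d) :
    partialDeriv k (hermiteC n) = ((√(n k : ℝ) / √2 : ℝ) : ℂ) • hermiteC (lower n k) +
      ((-(√((n k : ℝ) + 1) / √2) : ℝ) : ℂ) • hermiteC (raise n k) := by
  funext x
  have h1 : HasDerivAt (fun t => hermiteC n (Function.update x k t))
      (partialDeriv k (hermiteC n) x) (x k) := by
    have h := ((contDiff_hermiteC n).differentiable (by simp)
      (Function.update x k (x k))).hasFDerivAt.comp_hasDerivAt (x k) (hasDerivAt_update x k (x k))
    rw [Function.update_eq_self] at h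
    exact h
  have h2 : HasDerivAt (fun t => hermiteC n (Function.update x k t))
      ((deriv (hermiteFun (n k)) (x k) *
        ∏ i ∈ Finset.univ.erase k, hermiteFun (n i) (x i) : ℝ) : ℂ) (x k) := by
    have e : (fun t => hermiteC n (Function.update x k t)) = fun t => ((hermiteFun (n k) t *
        ∏ i ∈ Finset.univ.erase k, hermiteFun (n i) (x i) : ℝ) : ℂ) := by
      funext t
      rw [hermiteC, hermiteFunMulti_eq n k, Function.update_self]
      congr 2
      refine Finset.prod_congr rfl fun i hi => ?_
      rw [Function.update_of_ne (Finset.ne_of_mem_erase hi)]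
    rw [e]
    exact ((differentiable_hermiteFun (n k) (x k)).hasDerivAt.mul_const _).ofReal_comp
  rw [h1.unique h2]
  simp only [Pi.add_apply, Pi.smul_apply, smul_eq_mul, hermiteC, raise, lower]
  norm_cast
  push_cast
  rw [hermiteFunMulti_update, hermiteFunMulti_update]
  have h := sqrt_two_mul_deriv_hermiteFun (n k) (x k)
  have h2 : √(2 : ℝ) ≠ 0 := by positivity
  set P := ∏ i ∈ Finset.univ.erase k, hermiteFun (n i) (x i)
  field_simp
  linear_combination P * h

theorem norm_hermiteC_sq (n : Fin d → ℕ) (x : Fin d → ℝ) :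
    ‖hermiteC n x‖ ^ 2 = hermiteFunMulti n x * hermiteFunMulti n x := by
  rw [hermiteC, Complex.norm_real, Real.norm_eq_abs, sq_abs, pow_two]

theorem integrable_hermiteFunMulti_mul (m n : Fin d → ℕ) :
    Integrable fun x : Fin d → ℝ => hermiteFunMulti m x * hermiteFunMulti n x := by
  have := Integrable.fintype_prod (μ := fun _ : Fin d => (volume : Measure ℝ))
    (f := fun k t => hermiteFun (m k) t * hermiteFun (n k) t)
    fun k => integrable_hermiteFun_mul (m k) (n k)
  simp only [hermiteFunMulti, ← Finset.prod_mul_distrib]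
  exact this

theorem integral_hermiteFunMulti_mul (m n : Fin d → ℕ) :
    ∫ x : Fin d → ℝ, hermiteFunMulti m x * hermiteFunMulti n x = if m = n then 1 else 0 := by
  simp only [hermiteFunMulti, ← Finset.prod_mul_distrib]
  rw [integral_fintype_prod_volume_eq_prod
    (fun (k : Fin d) (t : ℝ) => hermiteFun (m k) t * hermiteFun (n k) t)]
  simp only [integral_hermiteFun_mul]
  by_cases h : m = n
  · subst h; simp
  · obtain ⟨k, hk⟩ := Function.ne_iff.1 h
    rw [if_neg h]
    exact Finset.prod_eq_zero (Finset.mem_univ k) (if_neg hk)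

theorem integrable_hermiteC_mul (m n : Fin d → ℕ) :
    Integrable fun x : Fin d → ℝ => hermiteC m x * hermiteC n x := by
  refine (integrable_hermiteFunMulti_mul m n).ofReal.congr (Filter.Eventually.of_forall fun x => ?_)
  simp [hermiteC]

theorem integral_hermiteC_mul (m n : Fin d → ℕ) :
    ∫ x : Fin d → ℝ, hermiteC m x * hermiteC n x = if m = n then 1 else 0 := by
  simp only [hermiteC, ← Complex.ofReal_mul]
  rw [integral_complex_ofReal, integral_hermiteFunMulti_mul]
  split_ifs <;> simp

theorem integral_norm_hermiteC_mul_le (m n : Fin d → ℕ) :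
    ∫ x : Fin d → ℝ, ‖hermiteC m x * hermiteC n x‖ ≤ 1 := by
  have hi : Integrable fun x : Fin d → ℝ => (1 / 2 : ℝ) *
      (hermiteFunMulti m x * hermiteFunMulti m x + hermiteFunMulti n x * hermiteFunMulti n x) :=
    ((integrable_hermiteFunMulti_mul m m).add (integrable_hermiteFunMulti_mul n n)).const_mul _
  calc _ ≤ ∫ x : Fin d → ℝ, (1 / 2 : ℝ) *
        (hermiteFunMulti m x * hermiteFunMulti m x +
          hermiteFunMulti n x * hermiteFunMulti n x) := by
        refine integral_mono (integrable_hermiteC_mul m n).norm hi fun x => ?_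
        simp only
        rw [norm_mul, ← norm_hermiteC_sq, ← norm_hermiteC_sq]
        nlinarith [sq_nonneg (‖hermiteC m x‖ - ‖hermiteC n x‖)]
    _ = 1 := by
        rw [integral_const_mul, integral_add (integrable_hermiteFunMulti_mul m m)
          (integrable_hermiteFunMulti_mul n n)]
        simp only [integral_hermiteFunMulti_mul, if_true]
        norm_num

/-- The total degree `|n| = ∑_k n_k`, as a real number. -/
def deg (n : Fin d → ℕ) : ℝ := ∑ k, (n k : ℝ)

theorem deg_nonneg (n : Fin d → ℕ) : 0 ≤ deg n := Finset.sum_nonneg fun _ _ => Nat.cast_nonneg _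

theorem le_deg (n : Fin d → ℕ) (k : Fin d) : (n k : ℝ) ≤ deg n :=
  Finset.single_le_sum (f := fun k => (n k : ℝ)) (fun _ _ => Nat.cast_nonneg _) (Finset.mem_univ k)

theorem deg_update (n : Fin d → ℕ) (k : Fin d) (j : ℕ) :
    deg (Function.update n k j) = deg n - n k + j := by
  rw [deg, deg, ← Finset.add_sum_erase _ _ (Finset.mem_univ k),
    ← Finset.add_sum_erase _ (fun k => (n k : ℝ)) (Finset.mem_univ k)]
  have : ∑ x ∈ Finset.univ.erase k, ((Function.update n k j x : ℕ) : ℝ) =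
      ∑ x ∈ Finset.univ.erase k, (n x : ℝ) := by
    refine Finset.sum_congr rfl fun i hi => ?_
    rw [Function.update_of_ne (Finset.ne_of_mem_erase hi)]
  rw [this, Function.update_self]
  ring

theorem deg_raise (n : Fin d → ℕ) (k : Fin d) : deg (raise n k) = deg n + 1 := by
  rw [raise, deg_update]; push_cast; ring

theorem deg_lower_le (n : Fin d → ℕ) (k : Fin d) : deg (lower n k) ≤ deg n + 1 := by
  rw [lower, deg_update]
  have : ((n k - 1 : ℕ) : ℝ) ≤ n k := by exact_mod_cast Nat.sub_le _ _
  linarith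

/-- The bound for a word of length `N` in the operators `1 + |x_k|` and `∂_k` applied to a Hermite
function of degree `s`; see `prod_mul_norm_wordDeriv_hermiteC_le`. -/
noncomputable def hermiteBound (d : ℕ) (s : ℝ) (N : ℕ) : ℝ :=
  3 ^ N * √(s + N + 1) ^ N * √(2 * (s + N + 1)) ^ d

theorem hermiteBound_nonneg (s : ℝ) (N : ℕ) : 0 ≤ hermiteBound d s N := by
  unfold hermiteBound; positivity

theorem hermiteBound_mono {s t : ℝ} (h : s ≤ t) (N : ℕ) :
    hermiteBound d s N ≤ hermiteBound d t N := by
  unfold hermiteBound; gcongr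

theorem mul_hermiteBound_le {s : ℝ} (hs : 0 ≤ s) (N : ℕ) :
    3 * √(s + 1) * hermiteBound d (s + 1) N ≤ hermiteBound d s (N + 1) := by
  unfold hermiteBound
  have h1 : √(s + 1) ≤ √(s + (N + 1 : ℕ) + 1) := by
    gcongr; push_cast; linarith [(Nat.cast_nonneg N : (0 : ℝ) ≤ N)]
  have h2 : s + 1 + N + 1 = s + (N + 1 : ℕ) + 1 := by push_cast; ring
  rw [h2]
  set r := √(s + (N + 1 : ℕ) + 1)
  calc 3 * √(s + 1) * (3 ^ N * r ^ N * √(2 * (s + (N + 1 : ℕ) + 1)) ^ d)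
      ≤ 3 * r * (3 ^ N * r ^ N * √(2 * (s + (N + 1 : ℕ) + 1)) ^ d) := by gcongr
    _ = _ := by ring

theorem norm_hermiteC_le (n : Fin d → ℕ) (x : Fin d → ℝ) :
    ‖hermiteC n x‖ ≤ hermiteBound d (deg n) 0 := by
  rw [hermiteC, Complex.norm_real, hermiteFunMulti, norm_prod, hermiteBound]
  simp only [pow_zero, one_mul, Nat.cast_zero, add_zero]
  calc ∏ k, ‖hermiteFun (n k) (x k)‖ ≤ ∏ _k : Fin d, √(2 * (deg n + 1)) := by
        refine Finset.prod_le_prod (fun _ _ => norm_nonneg _) fun k _ => ?_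
        refine Real.le_sqrt_of_sq_le ?_
        rw [Real.norm_eq_abs, sq_abs]
        refine (hermiteFun_sq_le _ _).trans ?_
        linarith [le_deg n k]
    _ = _ := by simp

theorem coeff_le (n : Fin d → ℕ) (k : Fin d) :
    √(n k : ℝ) / √2 ≤ √(deg n + 1) ∧ √((n k : ℝ) + 1) / √2 ≤ √(deg n + 1) := by
  have h2 : 1 ≤ √(2 : ℝ) := Real.one_le_sqrt.2 (by norm_num)
  have h := le_deg n k
  constructor
  · exact (div_le_self (Real.sqrt_nonneg _) h2).trans (Real.sqrt_le_sqrt (by linarith))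
  · exact (div_le_self (Real.sqrt_nonneg _) h2).trans (Real.sqrt_le_sqrt (by linarith))

/-- Each letter `x_k` or `∂_k` turns `H_n` into a combination of `H_{n ± e_k}` with coefficients at
most `√(|n| + 1)`. -/
theorem prod_mul_norm_wordDeriv_hermiteC_le (L l : List (Fin d)) (n : Fin d → ℕ)
    (x : Fin d → ℝ) :
    (L.map fun k => 1 + |x k|).prod * ‖wordDeriv l (hermiteC n) x‖ ≤
      hermiteBound d (deg n) (L.length + l.length) := by
  have hP : ∀ L : List (Fin d), 0 ≤ (L.map fun k => 1 + |x k|).prod := fun L =>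
    List.prod_nonneg fun a ha => by
      obtain ⟨k, -, rfl⟩ := List.mem_map.1 ha
      positivity
  induction l using List.reverseRecOn generalizing n with
  | nil =>
    simp only [wordDeriv_nil, List.length_nil, add_zero]
    induction L generalizing n with
    | nil => simpa using norm_hermiteC_le n x
    | cons k L ih =>
      simp only [List.map_cons, List.prod_cons, List.length_cons]
      have hc := coeff_le n k
      have h1 := ih n
      have h2 := ih (raise n k)
      have h3 := (ih (lower n k)).trans (hermiteBound_mono (deg_lower_le n k) _)
      rw [deg_raise] at h2
      have h4 := h1.trans (hermiteBound_mono (show deg n ≤ deg n + 1 by linarith) _)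
      set P := (L.map fun k => 1 + |x k|).prod
      set Q := hermiteBound d (deg n + 1) L.length with hQ
      have hQ0 : 0 ≤ Q := hermiteBound_nonneg _ _
      have h5 : |x k| * ‖hermiteC n x‖ ≤ √(deg n + 1) * ‖hermiteC (raise n k) x‖ +
          √(deg n + 1) * ‖hermiteC (lower n k) x‖ := by
        have : |x k| * ‖hermiteC n x‖ = ‖(x k : ℂ) * hermiteC n x‖ := by
          rw [norm_mul, Complex.norm_real, Real.norm_eq_abs]
        rw [this, ofReal_mul_hermiteC]
        refine (norm_add_le _ _).trans ?_
        rw [norm_mul, norm_mul, Complex.norm_real, Complex.norm_real, Real.norm_eq_abs,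
          Real.norm_eq_abs, abs_of_nonneg (by positivity), abs_of_nonneg (by positivity)]
        gcongr
        · exact hc.2
        · exact hc.1
      have hs : 1 ≤ √(deg n + 1) := Real.one_le_sqrt.2 (by linarith [deg_nonneg n])
      calc (1 + |x k|) * P * ‖hermiteC n x‖
          = P * ‖hermiteC n x‖ + P * (|x k| * ‖hermiteC n x‖) := by ring
        _ ≤ P * ‖hermiteC n x‖ + P * (√(deg n + 1) * ‖hermiteC (raise n k) x‖ +
            √(deg n + 1) * ‖hermiteC (lower n k) x‖) := by
            have := hP L
            gcongr
        _ = P * ‖hermiteC n x‖ + √(deg n + 1) * (P * ‖hermiteC (raise n k) x‖) +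
            √(deg n + 1) * (P * ‖hermiteC (lower n k) x‖) := by ring
        _ ≤ √(deg n + 1) * Q + √(deg n + 1) * Q + √(deg n + 1) * Q :=
            add_le_add (add_le_add (h4.trans (le_mul_of_one_le_left hQ0 hs)) (by gcongr))
              (by gcongr)
        _ = 3 * √(deg n + 1) * Q := by ring
        _ ≤ _ := mul_hermiteBound_le (deg_nonneg n) _
  | append_singleton l k ih =>
    have hc := coeff_le n k
    have h2 := ih (raise n k)
    have h3 := (ih (lower n k)).trans (hermiteBound_mono (deg_lower_le n k) _)
    rw [deg_raise] at h2
    have hPL := hP L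
    set P := (L.map fun k => 1 + |x k|).prod
    set Q := hermiteBound d (deg n + 1) (L.length + l.length) with hQ
    have hQ0 : 0 ≤ Q := hermiteBound_nonneg _ _
    have h5 : ‖wordDeriv (l ++ [k]) (hermiteC n) x‖ ≤
        √(deg n + 1) * ‖wordDeriv l (hermiteC (lower n k)) x‖ +
        √(deg n + 1) * ‖wordDeriv l (hermiteC (raise n k)) x‖ := by
      rw [wordDeriv_concat, partialDeriv_hermiteC, wordDeriv_add, wordDeriv_smul, wordDeriv_smul]
      · rw [Pi.add_apply, Pi.smul_apply, Pi.smul_apply]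
        refine (norm_add_le _ _).trans ?_
        rw [norm_smul, norm_smul, Complex.norm_real, Complex.norm_real, norm_neg, Real.norm_eq_abs,
          Real.norm_eq_abs, abs_of_nonneg (by positivity), abs_of_nonneg (by positivity)]
        gcongr
        · exact hc.1
        · exact hc.2
      · exact contDiff_hermiteC _
      · exact contDiff_hermiteC _
      · exact contDiff_const.smul (contDiff_hermiteC _)
      · exact contDiff_const.smul (contDiff_hermiteC _)
    rw [List.length_append, List.length_singleton, ← add_assoc]
    calc P * ‖wordDeriv (l ++ [k]) (hermiteC n) x‖
        ≤ P * (√(deg n + 1) * ‖wordDeriv l (hermiteC (lower n k)) x‖ +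
          √(deg n + 1) * ‖wordDeriv l (hermiteC (raise n k)) x‖) := by gcongr
      _ = √(deg n + 1) * (P * ‖wordDeriv l (hermiteC (lower n k)) x‖) +
          √(deg n + 1) * (P * ‖wordDeriv l (hermiteC (raise n k)) x‖) := by ring
      _ ≤ √(deg n + 1) * Q + √(deg n + 1) * Q := by gcongr
      _ ≤ 3 * √(deg n + 1) * Q := by
          have : 0 ≤ √(deg n + 1) * Q := by positivity
          linarith
      _ ≤ _ := mul_hermiteBound_le (deg_nonneg n) _

/-! ### The operators `x_k + ∂_k` and the decay of Hermite coefficients -/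

/-- Multiplication by the `k`-th coordinate. -/
def mulCoord (k : Fin d) (f : (Fin d → ℝ) → ℂ) (x : Fin d → ℝ) : ℂ := (x k : ℂ) * f x

/-- The operator `x_k + ∂_k`, a multiple of the `k`-th annihilation operator. -/
noncomputable def annihilate (k : Fin d) (f : (Fin d → ℝ) → ℂ) : (Fin d → ℝ) → ℂ :=
  mulCoord k f + partialDeriv k f

theorem contDiff_mulCoord (k : Fin d) {f : (Fin d → ℝ) → ℂ} (hf : ContDiff ℝ ∞ f) :
    ContDiff ℝ ∞ (mulCoord k f) :=
  (Complex.ofRealCLM.contDiff.comp (contDiff_apply ℝ ℝ k)).mul hf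

theorem contDiff_annihilate (k : Fin d) {f : (Fin d → ℝ) → ℂ} (hf : ContDiff ℝ ∞ f) :
    ContDiff ℝ ∞ (annihilate k f) :=
  (contDiff_mulCoord k hf).add (contDiff_partialDeriv k hf)

theorem partialDeriv_mulCoord (i k : Fin d) {f : (Fin d → ℝ) → ℂ} (hf : ContDiff ℝ ∞ f) :
    partialDeriv i (mulCoord k f) = mulCoord k (partialDeriv i f) + if i = k then f else 0 := by
  funext x
  have h1 : HasFDerivAt (fun x : Fin d → ℝ => (x k : ℂ))
      (Complex.ofRealCLM.comp (ContinuousLinearMap.proj k)) x :=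
    (Complex.ofRealCLM.comp (ContinuousLinearMap.proj (R := ℝ) (φ := fun _ => ℝ) k)).hasFDerivAt
  have h2 := (h1.fun_mul (hf.differentiable (by simp) x).hasFDerivAt).fderiv
  change fderiv ℝ (fun x => (x k : ℂ) * f x) x (Pi.single i 1) = _
  rw [h2]
  by_cases h : i = k
  · subst h
    simp [mulCoord, partialDeriv]
  · simp [mulCoord, partialDeriv, h, eq_comm]

theorem partialDeriv_sum_wordDeriv (i : Fin d) (E : List (List (Fin d))) {f : (Fin d → ℝ) → ℂ}
    (hf : ContDiff ℝ ∞ f) : ContDiff ℝ ∞ (E.map fun l => wordDeriv l f).sum ∧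
      partialDeriv i (E.map fun l => wordDeriv l f).sum =
        (E.map fun l => wordDeriv (i :: l) f).sum := by
  induction E with
  | nil =>
    refine ⟨contDiff_const, ?_⟩
    funext x
    simp [partialDeriv]
  | cons l E ih =>
    simp only [List.map_cons, List.sum_cons]
    refine ⟨(contDiff_wordDeriv l hf).add ih.1, ?_⟩
    rw [partialDeriv_add i (contDiff_wordDeriv l hf) ih.1, ih.2]
    rfl

/-- Commuting `∂_l` with `x_k` produces at most `|l|` derivatives of order `|l| - 1`. -/
theorem exists_wordDeriv_mulCoord (k : Fin d) (l : List (Fin d)) :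
    ∃ E : List (List (Fin d)), E.length ≤ l.length ∧ (∀ l' ∈ E, l'.length + 1 = l.length) ∧
      ∀ f : (Fin d → ℝ) → ℂ, ContDiff ℝ ∞ f → wordDeriv l (mulCoord k f) =
        mulCoord k (wordDeriv l f) + (E.map fun l' => wordDeriv l' f).sum := by
  induction l with
  | nil => exact ⟨[], by simp, by simp, fun f _ => by simp⟩
  | cons i l ih =>
    obtain ⟨E, h1, h2, h3⟩ := ih
    have key : ∀ f : (Fin d → ℝ) → ℂ, ContDiff ℝ ∞ f → wordDeriv (i :: l) (mulCoord k f) =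
        mulCoord k (wordDeriv (i :: l) f) + (if i = k then wordDeriv l f else 0) +
          (E.map fun l' => wordDeriv (i :: l') f).sum := fun f hf => by
      rw [wordDeriv_cons, h3 f hf, partialDeriv_add i
        (contDiff_mulCoord k (contDiff_wordDeriv l hf)) (partialDeriv_sum_wordDeriv i E hf).1,
        (partialDeriv_sum_wordDeriv i E hf).2, partialDeriv_mulCoord i k (contDiff_wordDeriv l hf)]
      rfl
    by_cases hik : i = k
    · refine ⟨l :: E.map (i :: ·), by simpa using h1, ?_, fun f hf => ?_⟩
      · intro l' hl'
        rcases List.mem_cons.1 hl' with rfl | hl'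
        · rfl
        · obtain ⟨l'', hl'', rfl⟩ := List.mem_map.1 hl'
          simpa using h2 l'' hl''
      · rw [key f hf, if_pos hik, List.map_cons, List.sum_cons, List.map_map, add_assoc]
        rfl
    · refine ⟨E.map (i :: ·), by simpa using h1.trans (Nat.le_succ _), ?_, fun f hf => ?_⟩
      · intro l' hl'
        obtain ⟨l'', hl'', rfl⟩ := List.mem_map.1 hl'
        simpa using h2 l'' hl''
      · rw [key f hf, if_neg hik, add_zero, List.map_map]
        rfl

/-- The weight `∏_{k ∈ L} (1 + x_k²)^{1/2}` of a word `L`. -/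
noncomputable def wordWeight (L : List (Fin d)) (x : Fin d → ℝ) : ℝ :=
  (L.map fun k => √(1 + x k ^ 2)).prod

theorem wordWeight_nonneg (L : List (Fin d)) (x : Fin d → ℝ) : 0 ≤ wordWeight L x :=
  List.prod_nonneg fun a ha => by
    obtain ⟨k, -, rfl⟩ := List.mem_map.1 ha
    positivity

/-- `f` is smooth, and a derivative of order `a` times a weight of order `b` is bounded by
`C · G (a + b + j)`. Only the total order enters, which makes the class stable under
`x_k + ∂_k`, up to an index shift; see `ControlledBy.annihilate`. -/
def ControlledBy (G : ℕ → ℝ) (C : ℝ) (j : ℕ) (f : (Fin d → ℝ) → ℂ) : Prop :=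
  ContDiff ℝ ∞ f ∧ ∀ (L l : List (Fin d)) (x : Fin d → ℝ),
    wordWeight L x * ‖wordDeriv l f x‖ ≤ C * G (L.length + l.length + j)

theorem mul_norm_sum_le {P B : ℝ} (hP : 0 ≤ P) (E : List (List (Fin d)))
    (f : (Fin d → ℝ) → ℂ) (x : Fin d → ℝ) (h : ∀ l ∈ E, P * ‖wordDeriv l f x‖ ≤ B) :
    P * ‖(E.map fun l => wordDeriv l f).sum x‖ ≤ E.length * B := by
  induction E with
  | nil => simp
  | cons l E ih =>
    have h1 := ih fun l' hl' => h l' (List.mem_cons_of_mem _ hl')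
    have h2 := h l List.mem_cons_self
    simp only [List.map_cons, List.sum_cons, Pi.add_apply, List.length_cons]
    push_cast
    calc _ ≤ P * (‖wordDeriv l f x‖ + ‖(E.map fun l => wordDeriv l f).sum x‖) := by
          gcongr; exact norm_add_le _ _
      _ ≤ _ := by linarith

theorem ControlledBy.annihilate {G : ℕ → ℝ} (hG0 : ∀ s, 0 ≤ G s) {K : ℝ} (hK : 0 ≤ K)
    (hG : ∀ s : ℕ, ((s : ℝ) + 1) * G s ≤ K * G (s + 2)) {C : ℝ} (hC : 0 ≤ C) {j : ℕ}
    {f : (Fin d → ℝ) → ℂ} (hf : ControlledBy G C j f) (k : Fin d) :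
    ControlledBy G (C * (2 + K)) (j + 1) (annihilate k f) := by
  obtain ⟨hs, hb⟩ := hf
  refine ⟨contDiff_annihilate k hs, fun L l x => ?_⟩
  obtain ⟨E, hE1, hE2, hE3⟩ := exists_wordDeriv_mulCoord k l
  have hP := wordWeight_nonneg L x
  rw [GelfandShilovHermite.annihilate, wordDeriv_add l (contDiff_mulCoord k hs)
    (contDiff_partialDeriv k hs), ← wordDeriv_concat, hE3 f hs]
  simp only [Pi.add_apply]
  set S := L.length + l.length + (j + 1) with hS
  have h1 : wordWeight L x * ‖mulCoord k (wordDeriv l f) x‖ ≤ C * G S := by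
    have h := hb (k :: L) l x
    rw [wordWeight, List.map_cons, List.prod_cons, List.length_cons,
      show L.length + 1 + l.length + j = S by omega] at h
    refine le_trans ?_ h
    rw [mulCoord, norm_mul, Complex.norm_real]
    have hx : ‖x k‖ ≤ √(1 + x k ^ 2) := by
      rw [Real.norm_eq_abs]
      exact Real.abs_le_sqrt (by linarith)
    calc wordWeight L x * (‖x k‖ * ‖wordDeriv l f x‖)
        = ‖x k‖ * wordWeight L x * ‖wordDeriv l f x‖ := by ring
      _ ≤ √(1 + x k ^ 2) * wordWeight L x * ‖wordDeriv l f x‖ := by gcongr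
  have h2 : wordWeight L x * ‖wordDeriv (l ++ [k]) f x‖ ≤ C * G S := by
    have h := hb L (l ++ [k]) x
    rwa [List.length_append, List.length_singleton,
      show L.length + (l.length + 1) + j = S by omega] at h
  have h3 : wordWeight L x * ‖(E.map fun l' => wordDeriv l' f).sum x‖ ≤ C * (K * G S) := by
    rcases hl : l.length with _ | r
    · have : E = [] := List.length_eq_zero_iff.1 (by omega)
      rw [this]
      simpa using mul_nonneg hC (mul_nonneg hK (hG0 S))
    · have h4 := mul_norm_sum_le hP E f x (B := C * G (L.length + r + j)) fun l' hl' => by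
        have h5 := hE2 l' hl'
        have h := hb L l' x
        rwa [show l'.length = r by omega] at h
      refine h4.trans ?_
      have h5 := hG (L.length + r + j)
      rw [show L.length + r + j + 2 = S by omega] at h5
      have h6 : (E.length : ℝ) ≤ ((L.length + r + j : ℕ) : ℝ) + 1 := by
        exact_mod_cast (by omega : E.length ≤ L.length + r + j + 1)
      have h7 := hG0 (L.length + r + j)
      calc (E.length : ℝ) * (C * G (L.length + r + j))
          = C * (E.length * G (L.length + r + j)) := by ring
        _ ≤ C * ((((L.length + r + j : ℕ) : ℝ) + 1) * G (L.length + r + j)) := by gcongr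
        _ ≤ _ := by gcongr
  calc wordWeight L x * ‖mulCoord k (wordDeriv l f) x + (E.map fun l' => wordDeriv l' f).sum x +
        wordDeriv (l ++ [k]) f x‖
      ≤ wordWeight L x * (‖mulCoord k (wordDeriv l f) x‖ +
        ‖(E.map fun l' => wordDeriv l' f).sum x‖ + ‖wordDeriv (l ++ [k]) f x‖) := by
        gcongr
        exact norm_add₃_le
    _ = wordWeight L x * ‖mulCoord k (wordDeriv l f) x‖ +
        wordWeight L x * ‖(E.map fun l' => wordDeriv l' f).sum x‖ +
        wordWeight L x * ‖wordDeriv (l ++ [k]) f x‖ := by ring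
    _ ≤ C * G S + C * (K * G S) + C * G S := by gcongr
    _ = C * (2 + K) * G S := by ring

/-- The Hermite coefficient `a_n(f) = ∫ f H_n`. -/
noncomputable def hermiteCoeff (f : (Fin d → ℝ) → ℂ) (n : Fin d → ℕ) : ℂ :=
  ∫ x : Fin d → ℝ, f x * hermiteC n x

/-- The integrable weight `∏_k (1 + x_k²)⁻¹`. -/
noncomputable def cauchyWeight (x : Fin d → ℝ) : ℝ := ∏ k, (1 + x k ^ 2)⁻¹

theorem cauchyWeight_pos (x : Fin d → ℝ) : 0 < cauchyWeight x :=
  Finset.prod_pos fun k _ => by positivity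

theorem cauchyWeight_le_one (x : Fin d → ℝ) : cauchyWeight x ≤ 1 :=
  Finset.prod_le_one (fun k _ => by positivity) fun k _ =>
    inv_le_one_of_one_le₀ (by linarith [sq_nonneg (x k)])

theorem integrable_cauchyWeight : Integrable (cauchyWeight : (Fin d → ℝ) → ℝ) := by
  have := Integrable.fintype_prod (μ := fun _ : Fin d => (volume : Measure ℝ))
    (f := fun _ t => (1 + t ^ 2)⁻¹) fun _ => integrable_inv_one_add_sq
  exact this

theorem integral_cauchyWeight : ∫ x : Fin d → ℝ, cauchyWeight x = Real.pi ^ d := by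
  simp only [cauchyWeight]
  rw [integral_fintype_prod_volume_eq_prod (fun (_ : Fin d) (t : ℝ) => (1 + t ^ 2)⁻¹)]
  simp

section Decay

variable {f : (Fin d → ℝ) → ℂ} {B : ℝ}

theorem integrable_mul_hermiteC (hf : Continuous f)
    (hb : ∀ x, ‖f x‖ ≤ B * cauchyWeight x) (n : Fin d → ℕ) :
    Integrable fun x : Fin d → ℝ => f x * hermiteC n x := by
  refine Integrable.mono' ((integrable_cauchyWeight (d := d)).const_mul
    (B * hermiteBound d (deg n) 0)) (hf.mul (continuous_hermiteC n)).aestronglyMeasurable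
    (Filter.Eventually.of_forall fun x => ?_)
  rw [norm_mul]
  calc ‖f x‖ * ‖hermiteC n x‖ ≤ B * cauchyWeight x * hermiteBound d (deg n) 0 := by
        gcongr
        · exact (norm_nonneg _).trans (hb x)
        · exact hb x
        · exact norm_hermiteC_le n x
    _ = _ := by ring

/-- The bound is uniform in `n` because the Hermite functions are normalized in `L²`. -/
theorem norm_hermiteCoeff_le (hf : Continuous f)
    (hb : ∀ x, ‖f x‖ ≤ B * cauchyWeight x) (n : Fin d → ℕ) :
    ‖hermiteCoeff f n‖ ≤ (Real.pi ^ d + 1) * B := by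
  have hB : 0 ≤ B := by
    have := (norm_nonneg _).trans (hb 0)
    exact nonneg_of_mul_nonneg_left this (cauchyWeight_pos 0)
  have hi : Integrable fun x : Fin d → ℝ =>
      B * (cauchyWeight x + hermiteFunMulti n x * hermiteFunMulti n x) :=
    (integrable_cauchyWeight.add (integrable_hermiteFunMulti_mul n n)).const_mul _
  calc ‖hermiteCoeff f n‖ ≤ ∫ x : Fin d → ℝ, ‖f x * hermiteC n x‖ :=
        norm_integral_le_integral_norm _
    _ ≤ ∫ x : Fin d → ℝ, B * (cauchyWeight x + hermiteFunMulti n x * hermiteFunMulti n x) := by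
        refine integral_mono (integrable_mul_hermiteC hf hb n).norm hi fun x => ?_
        simp only
        rw [norm_mul, ← norm_hermiteC_sq]
        have h1 := cauchyWeight_pos x
        have h2 := cauchyWeight_le_one x
        calc ‖f x‖ * ‖hermiteC n x‖ ≤ B * cauchyWeight x * ‖hermiteC n x‖ := by
              gcongr; exact hb x
          _ = B * (cauchyWeight x * ‖hermiteC n x‖) := by ring
          _ ≤ _ := by
              gcongr
              nlinarith [sq_nonneg (cauchyWeight x - ‖hermiteC n x‖), sq_nonneg ‖hermiteC n x‖]
    _ = (Real.pi ^ d + 1) * B := by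
        rw [integral_const_mul, integral_add integrable_cauchyWeight
          (integrable_hermiteFunMulti_mul n n), integral_cauchyWeight,
          integral_hermiteFunMulti_mul, if_pos rfl]
        ring

end Decay

section Controlled

variable {f : (Fin d → ℝ) → ℂ} {G : ℕ → ℝ} {C : ℝ} {j : ℕ}

theorem ControlledBy.norm_wordDeriv_le (hf : ControlledBy G C j f) (l : List (Fin d))
    (x : Fin d → ℝ) : ‖wordDeriv l f x‖ ≤ C * G (2 * d + l.length + j) * cauchyWeight x := by
  have h := hf.2 (wordOf fun _ => 2) l x
  rw [length_wordOf, wordWeight, prod_map_wordOf] at h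
  have e : ∏ k, √(1 + x k ^ 2) ^ 2 = (cauchyWeight x)⁻¹ := by
    rw [cauchyWeight, Finset.prod_inv_distrib, inv_inv]
    exact Finset.prod_congr rfl fun k _ => Real.sq_sqrt (by positivity)
  rw [e, inv_mul_le_iff₀ (cauchyWeight_pos x)] at h
  simp only [Finset.sum_const, Finset.card_univ, Fintype.card_fin, smul_eq_mul] at h
  rw [mul_comm d 2] at h
  linarith

theorem ControlledBy.integrable (hf : ControlledBy G C j f) (n : Fin d → ℕ) :
    Integrable fun x : Fin d → ℝ => f x * hermiteC n x :=
  integrable_mul_hermiteC hf.1.continuous (hf.norm_wordDeriv_le []) n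

theorem ControlledBy.norm_hermiteCoeff_le (hf : ControlledBy G C j f) (n : Fin d → ℕ) :
    ‖hermiteCoeff f n‖ ≤ (Real.pi ^ d + 1) * (C * G (2 * d + j)) :=
  GelfandShilovHermite.norm_hermiteCoeff_le hf.1.continuous (hf.norm_wordDeriv_le []) n

/-- Integration by parts: `x_k + ∂_k` shifts the sequence of Hermite coefficients. -/
theorem ControlledBy.hermiteCoeff_annihilate (hf : ControlledBy G C j f) (k : Fin d)
    (n : Fin d → ℕ) : hermiteCoeff (GelfandShilovHermite.annihilate k f) n =
      ((√2 * √((n k : ℝ) + 1) : ℝ) : ℂ) * hermiteCoeff f (raise n k) := by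
  have hi := hf.integrable
  have hi' : Integrable fun x : Fin d → ℝ => partialDeriv k f x * hermiteC n x :=
    integrable_mul_hermiteC (contDiff_partialDeriv k hf.1).continuous (hf.norm_wordDeriv_le [k]) n
  have hiD : Integrable fun x : Fin d → ℝ => f x * partialDeriv k (hermiteC n) x := by
    rw [partialDeriv_hermiteC]
    refine (((hi (lower n k)).const_mul ((√(n k : ℝ) / √2 : ℝ) : ℂ)).add
      ((hi (raise n k)).const_mul ((-(√((n k : ℝ) + 1) / √2) : ℝ) : ℂ))).congr
      (Filter.Eventually.of_forall fun x => ?_)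
    simp only [Pi.add_apply, Pi.smul_apply, smul_eq_mul]
    ring
  have hparts : ∫ x : Fin d → ℝ, f x * partialDeriv k (hermiteC n) x =
      - ∫ x : Fin d → ℝ, partialDeriv k f x * hermiteC n x :=
    integral_mul_fderiv_eq_neg_fderiv_mul_of_integrable hi' hiD (hi n)
      (fun x _ => hf.1.differentiable (by simp) x)
      (fun x _ => (contDiff_hermiteC n).differentiable (by simp) x)
  have e : ∀ x : Fin d → ℝ, GelfandShilovHermite.annihilate k f x * hermiteC n x =
      ((√2 * √((n k : ℝ) + 1) : ℝ) : ℂ) * (f x * hermiteC (raise n k) x) +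
        (f x * partialDeriv k (hermiteC n) x + partialDeriv k f x * hermiteC n x) := by
    intro x
    have h1 := ofReal_mul_hermiteC n k x
    have h2 := congrFun (partialDeriv_hermiteC n k) x
    simp only [Pi.add_apply, Pi.smul_apply, smul_eq_mul] at h2
    have h3 : ((√2 * √((n k : ℝ) + 1) : ℝ) : ℂ) = 2 * ((√((n k : ℝ) + 1) / √2 : ℝ) : ℂ) := by
      have : √2 * √((n k : ℝ) + 1) = 2 * (√((n k : ℝ) + 1) / √2) := by
        have h4 : √(2 : ℝ) * √2 = 2 := Real.mul_self_sqrt (by norm_num)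
        have h5 : √(2 : ℝ) ≠ 0 := by positivity
        field_simp
        linear_combination h4
      rw [this]; push_cast; ring
    rw [h3, h2]
    simp only [GelfandShilovHermite.annihilate, mulCoord, Pi.add_apply]
    push_cast at h1 ⊢
    linear_combination f x * h1
  rw [hermiteCoeff, hermiteCoeff]
  simp only [e]
  have hi2 : Integrable fun x : Fin d → ℝ =>
      f x * partialDeriv k (hermiteC n) x + partialDeriv k f x * hermiteC n x := hiD.add hi'
  rw [integral_add ((hi _).const_mul _) hi2, integral_add hiD hi', hparts,
    integral_const_mul]
  ring

theorem ControlledBy.sqrt_mul_norm_hermiteCoeff_le (hG0 : ∀ s, 0 ≤ G s) {K : ℝ} (hK : 0 ≤ K)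
    (hG : ∀ s : ℕ, ((s : ℝ) + 1) * G s ≤ K * G (s + 2)) (hC : 0 ≤ C) (hf : ControlledBy G C j f)
    (n : Fin d → ℕ) (k : Fin d) (q p : ℕ) :
    √(((q + 1).ascFactorial p : ℕ) : ℝ) * ‖hermiteCoeff f (Function.update n k (q + p))‖ ≤
      (Real.pi ^ d + 1) * (C * (2 + K) ^ p * G (2 * d + j + p)) := by
  induction p generalizing f C j with
  | zero => simpa using hf.norm_hermiteCoeff_le (Function.update n k q)
  | succ p ih =>
    have h1 := ih (mul_nonneg hC (by linarith)) (hf.annihilate hG0 hK hG hC k)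
    rw [hf.hermiteCoeff_annihilate, norm_mul, Complex.norm_real, Real.norm_eq_abs,
      abs_of_nonneg (by positivity)] at h1
    have e : raise (Function.update n k (q + p)) k = Function.update n k (q + (p + 1)) := by
      rw [raise, Function.update_self, Function.update_idem, add_assoc]
    rw [e, Function.update_self] at h1
    have h2 : (((q + 1).ascFactorial (p + 1) : ℕ) : ℝ) =
        (((q + p : ℕ) : ℝ) + 1) * ((q + 1).ascFactorial p : ℕ) := by
      rw [Nat.ascFactorial_succ]; push_cast; ring
    rw [h2, Real.sqrt_mul (by positivity)]
    have h3 : 1 ≤ √(2 : ℝ) := Real.one_le_sqrt.2 (by norm_num)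
    set X := ‖hermiteCoeff f (Function.update n k (q + (p + 1)))‖
    calc √(((q + p : ℕ) : ℝ) + 1) * √(((q + 1).ascFactorial p : ℕ) : ℝ) * X
        ≤ √2 * (√(((q + p : ℕ) : ℝ) + 1) * √(((q + 1).ascFactorial p : ℕ) : ℝ) * X) :=
          le_mul_of_one_le_left (by positivity) h3
      _ = √(((q + 1).ascFactorial p : ℕ) : ℝ) * (√2 * √(((q + p : ℕ) : ℝ) + 1) * X) := by ring
      _ ≤ _ := h1
      _ = _ := by
        rw [show 2 * d + (j + 1) + p = 2 * d + j + (p + 1) by ring, pow_succ]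
        ring

/-- Half of the index `n_k` can be removed by `x_k + ∂_k`, each step gaining at least
`√(n_k / 2)`. -/
theorem ControlledBy.sqrt_pow_mul_norm_hermiteCoeff_le (hG0 : ∀ s, 0 ≤ G s) {K : ℝ} (hK : 0 ≤ K)
    (hG : ∀ s : ℕ, ((s : ℝ) + 1) * G s ≤ K * G (s + 2)) (hC : 0 ≤ C) (hf : ControlledBy G C j f)
    (n : Fin d → ℕ) (k : Fin d) {p : ℕ} (hp : 2 * p ≤ n k) :
    √(n k : ℝ) ^ p * ‖hermiteCoeff f n‖ ≤
      (Real.pi ^ d + 1) * (C * (√2 * (2 + K)) ^ p * G (2 * d + j + p)) := by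
  have h := hf.sqrt_mul_norm_hermiteCoeff_le hG0 hK hG hC n k (n k - p) p
  rw [Nat.sub_add_cancel (by omega), Function.update_eq_self] at h
  have h1 : √(n k : ℝ) ^ p ≤ √2 ^ p * √(((n k - p + 1).ascFactorial p : ℕ) : ℝ) := by
    have h2 : ((n k : ℝ)) ^ p ≤ 2 ^ p * (((n k - p + 1).ascFactorial p : ℕ) : ℝ) := by
      have h3 := Nat.pow_succ_le_ascFactorial (n k - p + 1) p
      have h4 : (n k) ^ p ≤ 2 ^ p * (n k - p + 1) ^ p := by
        rw [← mul_pow]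
        exact Nat.pow_le_pow_left (by omega) _
      exact_mod_cast h4.trans (Nat.mul_le_mul_left _ h3)
    have h5 := Real.sqrt_le_sqrt h2
    rw [Real.sqrt_mul (by positivity)] at h5
    have e : ∀ y : ℝ, 0 ≤ y → √(y ^ p) = √y ^ p := fun y hy => by
      rw [Real.sqrt_eq_iff_mul_self_eq (by positivity) (by positivity), ← mul_pow,
        Real.mul_self_sqrt hy]
    rwa [e _ (by positivity), e _ (by positivity)] at h5
  calc √(n k : ℝ) ^ p * ‖hermiteCoeff f n‖
      ≤ √2 ^ p * √(((n k - p + 1).ascFactorial p : ℕ) : ℝ) * ‖hermiteCoeff f n‖ := by gcongr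
    _ = √2 ^ p * (√(((n k - p + 1).ascFactorial p : ℕ) : ℝ) * ‖hermiteCoeff f n‖) := by ring
    _ ≤ √2 ^ p * ((Real.pi ^ d + 1) * (C * (2 + K) ^ p * G (2 * d + j + p))) := by gcongr
    _ = _ := by rw [mul_pow]; ring

end Controlled

theorem controlledBy_of_weightedDeriv_le (hM1 : LogConvex M) (m : Set.Ioi (0 : ℝ))
    {φ : (Fin d → ℝ) → ℂ} (hφ : ContDiff ℝ ∞ φ) {B : ℝ} (hB : ∀ t, weightedDeriv M m φ t ≤ B) :
    ControlledBy (fun s => M s / (m : ℝ) ^ s) B 0 φ := by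
  refine ⟨hφ, fun L l x => ?_⟩
  have hm : (0 : ℝ) < m := m.2
  have hB0 : 0 ≤ B := (weightedDeriv_nonneg M m φ (0, 0, 0)).trans (hB _)
  have hcount : ∀ l : List (Fin d), ∑ k, l.count k = l.length := fun l => by
    rw [← length_wordOf, ← (perm_wordOf_count l).length_eq]
  have h := hB (fun k => l.count k, fun k => L.count k, x)
  rw [weightedDeriv] at h
  simp only [hcount] at h
  rw [← wordDeriv_eq_multiDeriv l hφ] at h
  have e : ∏ k, (1 + x k ^ 2) ^ ((L.count k : ℝ) / 2) = wordWeight L x := by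
    rw [wordWeight, ((perm_wordOf_count L).map _).prod_eq, prod_map_wordOf]
    refine Finset.prod_congr rfl fun k _ => ?_
    rw [Real.rpow_div_two_eq_sqrt _ (by positivity), Real.rpow_natCast]
  rw [e] at h
  have h1 := M.pos' l.length
  have h2 := M.pos' L.length
  have h3 := weight_mul_le hM1 L.length l.length
  have hp : 0 < (m : ℝ) ^ (L.length + l.length) := by positivity
  rw [add_comm l.length, div_mul_eq_mul_div, div_le_iff₀ (by positivity)] at h
  simp only [add_zero]
  rw [mul_div_assoc', le_div_iff₀ hp, mul_comm]
  refine h.trans ?_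
  rw [mul_comm (M l.length)]
  gcongr

/-- Hermite coefficients of functions in `S^{M_p,m}` decay like `1 / exp M(ε √n_k)` in each
variable separately. Indices `p ≤ n_k / 2` are treated with `(x_k + ∂_k)^p`; for larger `p` the
bound is (M.3)''. -/
theorem exists_norm_hermiteCoeff_mul_expAssoc_le (hM1 : LogConvex M) (hM2 : Separative M)
    (hM3 : NonTrivial M) (d : ℕ) (m : Set.Ioi (0 : ℝ)) :
    ∃ ε C : ℝ, 0 < ε ∧ 0 < C ∧ ∀ (φ : (Fin d → ℝ) → ℂ) (B : ℝ), ContDiff ℝ ∞ φ →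
      (∀ t, weightedDeriv M m φ t ≤ B) → ∀ n : Fin d → ℕ, ‖hermiteCoeff φ n‖ ≤ C * B ∧
        ∀ k, ‖hermiteCoeff φ n‖ * expAssoc M (ε * √(n k : ℝ)) ≤ C * B := by
  obtain ⟨A, H, hA, hH, hAH⟩ := exists_weight_add_le hM2
  obtain ⟨K, hK, hKM⟩ := exists_succ_mul_weight_le hM1 hM3
  obtain ⟨C₀, L, hC₀, hL, hL'⟩ := exists_sqrt_pow_le hM3
  have hm : (0 : ℝ) < m := m.2
  have hM2d := M.pos' (2 * d)
  set K' : ℝ := K * (m : ℝ) ^ 2 with hK'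
  have hK'0 : 0 < K' := by positivity
  set G : ℕ → ℝ := fun s => M s / (m : ℝ) ^ s with hG
  have hG0 : ∀ s, 0 ≤ G s := fun s => div_nonneg (M.pos' s).le (by positivity)
  have hGK : ∀ s : ℕ, ((s : ℝ) + 1) * G s ≤ K' * G (s + 2) := fun s => by
    have h := hKM s
    simp only [hG, hK']
    rw [mul_div_assoc', mul_div_assoc', div_le_div_iff₀ (by positivity) (by positivity), pow_add]
    have h1 : 0 < (m : ℝ) ^ s * (m : ℝ) ^ 2 := by positivity
    calc ((s : ℝ) + 1) * M s * ((m : ℝ) ^ s * (m : ℝ) ^ 2)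
        ≤ K * M (s + 2) * ((m : ℝ) ^ s * (m : ℝ) ^ 2) := by gcongr
      _ = _ := by ring
  set D : ℝ := (Real.pi ^ d + 1) * (A * (H / m) ^ (2 * d) * M (2 * d)) with hD
  have hD0 : 0 < D := by positivity
  set R₁ : ℝ := √2 * (2 + K') * (H / m) with hR₁
  set R₂ : ℝ := √2 * L with hR₂
  have hR₁0 : 0 < R₁ := by positivity
  have hR₂0 : 0 < R₂ := by positivity
  have hGp : ∀ p, G (2 * d + p) ≤ A * (H / m) ^ (2 * d) * M (2 * d) * ((H / m) ^ p * M p) := by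
    intro p
    simp only [hG]
    rw [div_le_iff₀ (by positivity)]
    refine (hAH (2 * d) p).trans (le_of_eq ?_)
    rw [pow_add, pow_add, div_pow, div_pow]
    field_simp
  refine ⟨(R₁ + R₂)⁻¹, D * C₀, by positivity, by positivity, fun φ B hφ hB n => ?_⟩
  have hB0 : 0 ≤ B := (weightedDeriv_nonneg M m φ (0, 0, 0)).trans (hB _)
  have hc := controlledBy_of_weightedDeriv_le hM1 m hφ hB
  have h0 : ‖hermiteCoeff φ n‖ ≤ D * B := by
    refine (hc.norm_hermiteCoeff_le n).trans ?_
    have h1 := hGp 0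
    simp only [add_zero, pow_zero, M.zero', mul_one] at h1 ⊢
    calc (Real.pi ^ d + 1) * (B * G (2 * d))
        ≤ (Real.pi ^ d + 1) * (B * (A * (H / m) ^ (2 * d) * M (2 * d))) := by gcongr
      _ = D * B := by rw [hD]; ring
  have hDC : D * B ≤ D * C₀ * B := by
    have : D * B * 1 ≤ D * B * C₀ := by gcongr
    linarith
  refine ⟨h0.trans hDC, fun k => mul_expAssoc_le (by positivity) (norm_nonneg _) fun p => ?_⟩
  have hMp := M.pos' p
  have key : √(n k : ℝ) ^ p * ‖hermiteCoeff φ n‖ ≤ D * C₀ * B * ((R₁ + R₂) ^ p * M p) := by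
    rcases le_or_gt (2 * p) (n k) with hp | hp
    · refine (hc.sqrt_pow_mul_norm_hermiteCoeff_le hG0 hK'0.le hGK hB0 n k hp).trans ?_
      have h1 := hGp p
      simp only [add_zero]
      calc (Real.pi ^ d + 1) * (B * (√2 * (2 + K')) ^ p * G (2 * d + p))
          ≤ (Real.pi ^ d + 1) * (B * (√2 * (2 + K')) ^ p *
            (A * (H / m) ^ (2 * d) * M (2 * d) * ((H / m) ^ p * M p))) := by gcongr
        _ = D * B * (R₁ ^ p * M p) := by rw [hD, hR₁, mul_pow _ (H / (m : ℝ)) p]; ring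
        _ ≤ D * C₀ * B * ((R₁ + R₂) ^ p * M p) := by
            gcongr
            linarith
    · have h1 : √(n k : ℝ) ^ p ≤ C₀ * (R₂ ^ p * M p) := by
        have h2 : √(n k : ℝ) ≤ √2 * √(p : ℝ) := by
          rw [← Real.sqrt_mul (by norm_num)]
          refine Real.sqrt_le_sqrt ?_
          exact_mod_cast hp.le
        calc √(n k : ℝ) ^ p ≤ (√2 * √(p : ℝ)) ^ p := by gcongr
          _ = √2 ^ p * √(p : ℝ) ^ p := mul_pow _ _ _
          _ ≤ √2 ^ p * (C₀ * L ^ p * M p) := by gcongr; exact hL' p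
          _ = _ := by rw [hR₂, mul_pow]; ring
      calc √(n k : ℝ) ^ p * ‖hermiteCoeff φ n‖ ≤ C₀ * (R₂ ^ p * M p) * (D * B) := by gcongr
        _ = D * C₀ * B * (R₂ ^ p * M p) := by ring
        _ ≤ _ := by
            gcongr
            linarith
  have hR : 0 < (R₁ + R₂) ^ p := by positivity
  rw [mul_pow, inv_pow]
  calc ‖hermiteCoeff φ n‖ * (((R₁ + R₂) ^ p)⁻¹ * √(n k : ℝ) ^ p)
      = ((R₁ + R₂) ^ p)⁻¹ * (√(n k : ℝ) ^ p * ‖hermiteCoeff φ n‖) := by ring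
    _ ≤ ((R₁ + R₂) ^ p)⁻¹ * (D * C₀ * B * ((R₁ + R₂) ^ p * M p)) := by gcongr
    _ = _ := by field_simp

/-- The bounds in the separate variables are combined by looking at the largest factor, with (M.2)
absorbing the power `d`. -/
theorem exists_norm_hermiteCoeff_mul_isoWeight_le (hM1 : LogConvex M) (hM2 : Separative M)
    (hM3 : NonTrivial M) (d : ℕ) (m : Set.Ioi (0 : ℝ)) :
    ∃ ε C : ℝ, 0 < ε ∧ 0 < C ∧ ∀ (φ : (Fin d → ℝ) → ℂ) (B : ℝ), ContDiff ℝ ∞ φ →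
      (∀ t, weightedDeriv M m φ t ≤ B) → ∀ n : Fin d → ℕ,
        ‖hermiteCoeff φ n‖ * isoWeight M ε n ≤ C * B := by
  obtain ⟨ε, C, hε, hC, h⟩ := exists_norm_hermiteCoeff_mul_expAssoc_le hM1 hM2 hM3 d m
  obtain ⟨C', r, hC', hr, hr1, h'⟩ := exists_expAssoc_pow_le hM2 hM3 d
  refine ⟨r * ε, C' * C, by positivity, by positivity, fun φ B hφ hB n => ?_⟩
  obtain ⟨h0, hk⟩ := h φ B hφ hB n
  have hCB : 0 ≤ C * B := (norm_nonneg _).trans h0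
  rcases isEmpty_or_nonempty (Fin d) with hd | hd
  · rw [isoWeight, Finset.univ_eq_empty, Finset.prod_empty, mul_one, mul_assoc]
    exact h0.trans (le_mul_of_one_le_left hCB hC')
  · obtain ⟨k, -, hmax⟩ := Finset.exists_max_image Finset.univ
      (fun k => expAssoc M (r * ε * √(n k : ℝ))) Finset.univ_nonempty
    have h1 : isoWeight M (r * ε) n ≤ C' * expAssoc M (ε * √(n k : ℝ)) := by
      calc isoWeight M (r * ε) n ≤ ∏ _k : Fin d, expAssoc M (r * ε * √(n k : ℝ)) :=
            Finset.prod_le_prod (fun _ _ => (expAssoc_pos _).le) hmax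
        _ = expAssoc M (r * (ε * √(n k : ℝ))) ^ d := by simp [mul_assoc]
        _ ≤ _ := h' _ (by positivity)
    have h2 := hk k
    calc ‖hermiteCoeff φ n‖ * isoWeight M (r * ε) n
        ≤ ‖hermiteCoeff φ n‖ * (C' * expAssoc M (ε * √(n k : ℝ))) := by gcongr
      _ = C' * (‖hermiteCoeff φ n‖ * expAssoc M (ε * √(n k : ℝ))) := by ring
      _ ≤ C' * (C * B) := by gcongr
      _ = _ := by ring

/-! ### Hermite series -/

theorem exists_pos_le_param (θ : Param d) : ∃ ε : ℝ, 0 < ε ∧ ∀ k, ε ≤ θ.1 k := by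
  rcases isEmpty_or_nonempty (Fin d) with hd | hd
  · exact ⟨1, one_pos, fun k => hd.elim k⟩
  · obtain ⟨k, -, hk⟩ := Finset.exists_min_image Finset.univ θ.1 Finset.univ_nonempty
    exact ⟨θ.1 k, θ.2 k, fun i => hk i (Finset.mem_univ i)⟩

/-- `H_n` lies in `S^{M_p,m}` for small `m`, and its norm grows at most like `∏_k exp M(ε √n_k)`. -/
theorem exists_weightedDeriv_hermiteC_le (hM2 : Separative M) (hM3 : NonTrivial M) (d : ℕ)
    {ε : ℝ} (hε : 0 < ε) : ∃ (m : Set.Ioi (0 : ℝ)) (C : ℝ), 0 < C ∧ ∀ (n : Fin d → ℕ) t,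
      weightedDeriv M m (hermiteC n) t ≤ C * isoWeight M ε n := by
  obtain ⟨A, H, hA, hH, hAH⟩ := exists_weight_add_le hM2
  obtain ⟨C₀, L, hC₀, hL, hL'⟩ := exists_sqrt_pow_le hM3
  set S : ℝ := L + d / ε with hS
  have hS0 : 0 < S := by positivity
  have hMd := M.pos' (d + 1)
  -- the bound for `N` letters, after replacing the exponent `N + d` by `P = N + d + 1`
  have hQ : ∀ (n : Fin d → ℕ) (N : ℕ), hermiteBound d (deg n) N ≤
      (2 * C₀ * (12 * S) ^ (N + d + 1) * M (N + d + 1)) * isoWeight M ε n := by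
    intro n N
    set P := N + d + 1 with hP
    have hMP := M.pos' P
    have hW := one_le_isoWeight (M := M) hM3 hε.le n
    set W := isoWeight M ε n
    have hdeg := deg_nonneg n
    have h1 : hermiteBound d (deg n) N ≤ 6 ^ P * √(deg n + P) ^ P := by
      rw [hermiteBound]
      have a : √(deg n + N + 1) ≤ √(deg n + P) := by
        refine Real.sqrt_le_sqrt ?_
        rw [hP]; push_cast
        have : (0 : ℝ) ≤ d := Nat.cast_nonneg _
        linarith
      have a1 : 1 ≤ √(deg n + P) := Real.one_le_sqrt.2 (by
        rw [hP]; push_cast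
        have : (0 : ℝ) ≤ d := Nat.cast_nonneg _
        have : (0 : ℝ) ≤ N := Nat.cast_nonneg _
        linarith)
      have b : √(2 * (deg n + N + 1)) ≤ 2 * √(deg n + P) := by
        rw [Real.sqrt_mul (by norm_num)]
        have : √(2 : ℝ) ≤ 2 := by
          rw [Real.sqrt_le_left (by norm_num)]; norm_num
        gcongr
      set y := √(deg n + P)
      calc 3 ^ N * √(deg n + N + 1) ^ N * √(2 * (deg n + N + 1)) ^ d
          ≤ 3 ^ N * y ^ N * (2 * y) ^ d := by gcongr
        _ = (3 ^ N * 2 ^ d) * (y ^ (N + d)) := by rw [mul_pow, pow_add]; ring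
        _ ≤ (6 ^ N * 6 ^ d) * (y ^ P) := by
            gcongr
            · norm_num
            · norm_num
            · omega
        _ ≤ 6 ^ P * y ^ P := by
            rw [← pow_add]
            gcongr
            · norm_num
            · omega
    have h2 : √(deg n + P) ^ P ≤ 2 ^ P * (√(deg n) ^ P + √(P : ℝ) ^ P) := by
      have a : √(deg n + P) ≤ √(deg n) + √(P : ℝ) := by
        rw [Real.sqrt_le_left (by positivity)]
        have h5 := Real.sq_sqrt hdeg
        have h6 := Real.sq_sqrt (Nat.cast_nonneg (α := ℝ) P)
        have : 0 ≤ √(deg n) * √(P : ℝ) := by positivity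
        nlinarith
      calc √(deg n + P) ^ P ≤ (√(deg n) + √(P : ℝ)) ^ P := by gcongr
        _ ≤ 2 ^ (P - 1) * (√(deg n) ^ P + √(P : ℝ) ^ P) :=
            add_pow_le (Real.sqrt_nonneg _) (Real.sqrt_nonneg _) _
        _ ≤ _ := by
            gcongr
            · norm_num
            · omega
    have h3 : √(P : ℝ) ^ P ≤ C₀ * S ^ P * M P * W := by
      calc √(P : ℝ) ^ P ≤ C₀ * L ^ P * M P := hL' P
        _ ≤ C₀ * S ^ P * M P := by
            gcongr
            rw [hS]
            have : 0 ≤ (d : ℝ) / ε := by positivity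
            linarith
        _ ≤ _ := le_mul_of_one_le_right (by positivity) hW
    have h4 : √(deg n) ^ P ≤ C₀ * S ^ P * M P * W := by
      rcases isEmpty_or_nonempty (Fin d) with hd | hd
      · have : deg n = 0 := by simp [deg]
        rw [this, Real.sqrt_zero, zero_pow (by omega)]
        positivity
      · obtain ⟨k, -, hk⟩ := Finset.exists_max_image Finset.univ n Finset.univ_nonempty
        have hd1 : (1 : ℝ) ≤ d := by
          have : 0 < d := Fin.pos_iff_nonempty.2 hd
          exact_mod_cast this
        have a : √(deg n) ≤ d * √(n k : ℝ) := by
          have : deg n ≤ (d : ℝ) ^ 2 * n k := by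
            calc deg n ≤ ∑ _i : Fin d, (n k : ℝ) :=
                  Finset.sum_le_sum fun i hi => by exact_mod_cast hk i hi
              _ = d * n k := by simp
              _ ≤ _ := by
                  gcongr
                  nlinarith
          calc √(deg n) ≤ √((d : ℝ) ^ 2 * n k) := Real.sqrt_le_sqrt this
            _ = _ := by rw [Real.sqrt_mul (by positivity), Real.sqrt_sq (by positivity)]
        have b : expAssoc M (ε * √(n k : ℝ)) ≤ W := by
          change _ ≤ isoWeight M ε n
          rw [isoWeight, ← Finset.mul_prod_erase _ _ (Finset.mem_univ k)]
          exact le_mul_of_one_le_right (expAssoc_pos _).le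
            (Finset.one_le_prod fun _ _ => one_le_expAssoc hM3 (by positivity))
        have hdS : (d : ℝ) / ε ≤ S := by
          rw [hS]
          linarith
        have hE := (expAssoc_pos (M := M) (ε * √(n k : ℝ))).le
        calc √(deg n) ^ P ≤ (d * √(n k : ℝ)) ^ P := by gcongr
          _ = (d / ε) ^ P * (ε * √(n k : ℝ)) ^ P := by
              rw [← mul_pow]; congr 1; field_simp
          _ ≤ (d / ε) ^ P * (M P * expAssoc M (ε * √(n k : ℝ))) := by
              gcongr
              exact pow_le_mul_expAssoc hM3 (by positivity) P
          _ ≤ S ^ P * (M P * W) := by gcongr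
          _ ≤ C₀ * (S ^ P * (M P * W)) := le_mul_of_one_le_left (by positivity) hC₀
          _ = _ := by ring
    calc hermiteBound d (deg n) N ≤ 6 ^ P * √(deg n + P) ^ P := h1
      _ ≤ 6 ^ P * (2 ^ P * (C₀ * S ^ P * M P * W + C₀ * S ^ P * M P * W)) := by
          refine mul_le_mul_of_nonneg_left (h2.trans ?_) (by positivity)
          gcongr
      _ = _ := by
          rw [mul_pow, show (12 : ℝ) = 6 * 2 by norm_num, mul_pow]; ring
  have hWle : ∀ a b : ℕ, M (a + b + d + 1) ≤
      A ^ 2 * H ^ (2 * (a + b + d + 1)) * M (d + 1) * (M a * M b) := by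
    intro a b
    have h1 := hAH (a + b) (d + 1)
    have h2 := hAH a b
    have := M.pos' a
    have := M.pos' b
    rw [← add_assoc] at h1
    calc M (a + b + d + 1) ≤ A * H ^ (a + b + d + 1) * (M (a + b) * M (d + 1)) := h1
      _ ≤ A * H ^ (a + b + d + 1) * (A * H ^ (a + b) * (M a * M b) * M (d + 1)) := by gcongr
      _ ≤ A * H ^ (a + b + d + 1) * (A * H ^ (a + b + d + 1) * (M a * M b) * M (d + 1)) := by
          have h3 : H ^ (a + b) ≤ H ^ (a + b + d + 1) := pow_le_pow_right₀ hH (by omega)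
          gcongr
      _ = _ := by ring
  set Z : ℝ := 12 * S * H ^ 2 with hZ
  have hZ0 : 0 < Z := by positivity
  refine ⟨⟨Z⁻¹, Set.mem_Ioi.2 (by positivity)⟩,
    2 * C₀ * Z ^ (d + 1) * A ^ 2 * M (d + 1), by positivity, ?_⟩
  rintro n ⟨α, β, x⟩
  set a := ∑ k, α k with ha
  set b := ∑ k, β k with hb
  have hMa := M.pos' a
  have hMb := M.pos' b
  have hW := isoWeight_pos (M := M) ε n
  rw [weightedDeriv]
  simp only [← ha, ← hb]
  have h1 : (∏ k, (1 + x k ^ 2) ^ ((β k : ℝ) / 2)) * ‖multiDeriv α (hermiteC n) x‖ ≤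
      hermiteBound d (deg n) (a + b) := by
    have h2 := prod_mul_norm_wordDeriv_hermiteC_le (wordOf β) (wordOf α) n x
    rw [prod_map_wordOf, length_wordOf, length_wordOf, add_comm, ← multiDeriv_eq_wordDeriv] at h2
    refine le_trans ?_ h2
    gcongr with k _
    rw [Real.rpow_div_two_eq_sqrt _ (by positivity), Real.rpow_natCast]
    gcongr
    rw [Real.sqrt_le_left (by positivity)]
    nlinarith [abs_nonneg (x k), sq_abs (x k)]
  have h3 := h1.trans (hQ n (a + b))
  have h4 := hWle a b
  calc Z⁻¹ ^ (a + b) / (M a * M b) *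
        ((∏ k, (1 + x k ^ 2) ^ ((β k : ℝ) / 2)) * ‖multiDeriv α (hermiteC n) x‖)
      ≤ Z⁻¹ ^ (a + b) / (M a * M b) * ((2 * C₀ * (12 * S) ^ (a + b + d + 1) *
        (A ^ 2 * H ^ (2 * (a + b + d + 1)) * M (d + 1) * (M a * M b))) * isoWeight M ε n) := by
        refine mul_le_mul_of_nonneg_left (h3.trans ?_) (by positivity)
        gcongr
    _ = Z⁻¹ ^ (a + b) * (2 * C₀ * Z ^ (a + b + d + 1) * A ^ 2 * M (d + 1)) * isoWeight M ε n := by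
        rw [hZ, mul_pow (12 * S) (H ^ 2), pow_mul]
        field_simp
    _ = _ := by
        rw [inv_pow, show a + b + d + 1 = (a + b) + (d + 1) by ring, pow_add Z (a + b) (d + 1)]
        generalize Z ^ (d + 1) = z
        field_simp

/-- The Hermite series `∑_n a_n H_n`. -/
noncomputable def hermiteSeries (a : (Fin d → ℕ) → ℂ) (x : Fin d → ℝ) : ℂ :=
  ∑' n, a n * hermiteC n x

theorem norm_multiDeriv_eq (m : Set.Ioi (0 : ℝ)) (f : (Fin d → ℝ) → ℂ) (α : Fin d → ℕ)
    (x : Fin d → ℝ) :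
    ‖multiDeriv α f x‖ = M (∑ k, α k) / (m : ℝ) ^ (∑ k, α k) * weightedDeriv M m f (α, 0, x) := by
  have hm : (0 : ℝ) < m := m.2
  have h := M.pos' (∑ k, α k)
  simp only [weightedDeriv, Pi.zero_apply, Finset.sum_const_zero, add_zero, M.zero', mul_one,
    Nat.cast_zero, zero_div, Real.rpow_zero, Finset.prod_const_one, one_mul]
  field_simp

/-- A Hermite series that converges absolutely in `S^{M_p,m}` defines an element of that space. -/
theorem hermiteSeries_mem (m : Set.Ioi (0 : ℝ)) {a : (Fin d → ℕ) → ℂ} {c : (Fin d → ℕ) → ℝ}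
    (hc : Summable c) (h : ∀ n t, ‖a n‖ * weightedDeriv M m (hermiteC n) t ≤ c n) :
    ContDiff ℝ ∞ (hermiteSeries a) ∧
      ∀ t, weightedDeriv M m (hermiteSeries a) t ≤ ∑' n, c n := by
  have hm : (0 : ℝ) < m := m.2
  have hsmul : ∀ l n, wordDeriv l (fun x => a n * hermiteC n x) =
      a n • wordDeriv l (hermiteC n) := fun l n => wordDeriv_smul l (contDiff_hermiteC n) (a n)
  obtain ⟨h1, h2⟩ := contDiff_tsum_of_wordDeriv (f := fun n x => a n * hermiteC n x)
    (fun n => contDiff_const.mul (contDiff_hermiteC n))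
    (u := fun l n => M (∑ k, l.count k) / (m : ℝ) ^ (∑ k, l.count k) * c n)
    (fun l => hc.mul_left _) (fun l n x => by
      rw [hsmul, Pi.smul_apply, norm_smul, wordDeriv_eq_multiDeriv l (contDiff_hermiteC n),
        norm_multiDeriv_eq (M := M) m]
      have h3 := M.pos' (∑ k, l.count k)
      calc _ = M (∑ k, l.count k) / (m : ℝ) ^ (∑ k, l.count k) *
            (‖a n‖ * weightedDeriv M m (hermiteC n) (fun k => l.count k, 0, x)) := by ring
        _ ≤ _ := by gcongr; exact h n _)
  refine ⟨h1, ?_⟩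
  rintro ⟨α, β, x⟩
  have h3 : multiDeriv α (hermiteSeries a) x = ∑' n, a n * multiDeriv α (hermiteC n) x := by
    rw [multiDeriv_eq_wordDeriv]
    change wordDeriv (wordOf α) (fun x => ∑' n, a n * hermiteC n x) x = _
    rw [h2]
    refine tsum_congr fun n => ?_
    rw [hsmul, multiDeriv_eq_wordDeriv]
    rfl
  have hMa := M.pos' (∑ k, α k)
  have hMb := M.pos' (∑ k, β k)
  have hnorm : Summable fun n => ‖a n * multiDeriv α (hermiteC n) x‖ := by
    refine Summable.of_nonneg_of_le (fun _ => norm_nonneg _) (fun n => ?_)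
      (hc.mul_left (M (∑ k, α k) / (m : ℝ) ^ (∑ k, α k)))
    rw [norm_mul, norm_multiDeriv_eq (M := M) m]
    calc _ = M (∑ k, α k) / (m : ℝ) ^ (∑ k, α k) *
            (‖a n‖ * weightedDeriv M m (hermiteC n) (α, 0, x)) := by ring
        _ ≤ _ := by gcongr; exact h n _
  simp only [weightedDeriv, h3]
  set w : ℝ := (m : ℝ) ^ (∑ k, α k + ∑ k, β k) / (M (∑ k, α k) * M (∑ k, β k)) with hw
  have hw0 : 0 ≤ w := by positivity
  set X : ℝ := ∏ k, (1 + x k ^ 2) ^ ((β k : ℝ) / 2) with hX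
  have hX0 : 0 ≤ X := by positivity
  calc w * (X * ‖∑' n, a n * multiDeriv α (hermiteC n) x‖)
      ≤ w * (X * ∑' n, ‖a n * multiDeriv α (hermiteC n) x‖) := by
        gcongr
        exact norm_tsum_le_tsum_norm hnorm
    _ = ∑' n, w * (X * ‖a n * multiDeriv α (hermiteC n) x‖) := by
        rw [← tsum_mul_left, ← tsum_mul_left]
    _ ≤ ∑' n, c n := by
        refine Summable.tsum_le_tsum (fun n => ?_) ((hnorm.mul_left _).mul_left _) hc
        refine le_trans (le_of_eq ?_) (h n (α, β, x))
        rw [norm_mul]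
        simp only [weightedDeriv, ← hw, ← hX]
        ring

/-- In `s_{M_p,θ}` a sequence decays fast enough to absorb the growth of the norms of the Hermite
functions in a suitable `S^{M_p,m}`. -/
theorem exists_norm_mul_weightedDeriv_hermiteC_le (hM2 : Separative M) (hM3 : NonTrivial M)
    (θ : Param d) : ∃ (m : Set.Ioi (0 : ℝ)) (C : ℝ), 0 < C ∧
      ∀ (a : (Fin d → ℕ) → ℂ) (B : ℝ), 0 ≤ B → (∀ n, ‖a n‖ ^ 2 * seqWeight M θ.1 n ≤ B ^ 2) →
        ∀ n, (∀ t, ‖a n‖ * weightedDeriv M m (hermiteC n) t ≤ C * B * (polyWeight n)⁻¹) ∧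
          ‖a n‖ ≤ C * B * (polyWeight n)⁻¹ := by
  obtain ⟨ε, hε, hεθ⟩ := exists_pos_le_param θ
  obtain ⟨C₁, h, hC₁, hh, hh1, H₁⟩ := exists_isoWeight_pow_le hM2 hM3 d 4
  obtain ⟨C₂, hC₂, H₂⟩ := exists_polyWeight_le hM3 d (mul_pos hh hε)
  obtain ⟨m, C₃, hC₃, H₃⟩ := exists_weightedDeriv_hermiteC_le hM2 hM3 d (mul_pos hh hε)
  refine ⟨m, C₁ * C₂ * (C₃ + 1), by positivity, fun a B hB ha n => ?_⟩
  set W := isoWeight M (h * ε) n with hW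
  have hW1 : 1 ≤ W := one_le_isoWeight hM3 (by positivity) n
  have hW0 : 0 < W := by linarith
  have hP := polyWeight_pos n
  have h1 : ‖a n‖ * W ^ 2 ≤ C₁ * B := by
    have h2 : (‖a n‖ * W ^ 2) ^ 2 ≤ (C₁ * B) ^ 2 := by
      calc (‖a n‖ * W ^ 2) ^ 2 = ‖a n‖ ^ 2 * W ^ 4 := by ring
        _ ≤ ‖a n‖ ^ 2 * (C₁ * seqWeight M θ.1 n) := by
            gcongr
            refine (H₁ ε n hε.le).trans ?_
            gcongr
            exact isoWeight_le_seqWeight hM3 hε.le hεθ n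
        _ = C₁ * (‖a n‖ ^ 2 * seqWeight M θ.1 n) := by ring
        _ ≤ C₁ * B ^ 2 := by gcongr; exact ha n
        _ ≤ C₁ ^ 2 * B ^ 2 := by
            gcongr
            exact le_self_pow₀ hC₁ two_ne_zero
        _ = _ := by ring
    exact (sq_le_sq₀ (by positivity) (by positivity)).1 h2
  have h3 : ‖a n‖ * W ≤ C₁ * C₂ * B * (polyWeight n)⁻¹ := by
    rw [← div_eq_mul_inv, le_div_iff₀ hP]
    calc ‖a n‖ * W * polyWeight n ≤ ‖a n‖ * W * (C₂ * W) := by gcongr; exact H₂ n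
      _ = C₂ * (‖a n‖ * W ^ 2) := by ring
      _ ≤ C₂ * (C₁ * B) := by gcongr
      _ = _ := by ring
  have hR : 0 ≤ C₁ * C₂ * B * (polyWeight n)⁻¹ := by positivity
  refine ⟨fun t => ?_, ?_⟩
  · calc ‖a n‖ * weightedDeriv M m (hermiteC n) t ≤ ‖a n‖ * (C₃ * W) := by gcongr; exact H₃ n t
      _ = C₃ * (‖a n‖ * W) := by ring
      _ ≤ C₃ * (C₁ * C₂ * B * (polyWeight n)⁻¹) := by gcongr
      _ ≤ (C₃ + 1) * (C₁ * C₂ * B * (polyWeight n)⁻¹) := by gcongr; linarith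
      _ = _ := by ring
  · calc ‖a n‖ ≤ ‖a n‖ * W := le_mul_of_one_le_right (norm_nonneg _) hW1
      _ ≤ C₁ * C₂ * B * (polyWeight n)⁻¹ := h3
      _ ≤ (C₃ + 1) * (C₁ * C₂ * B * (polyWeight n)⁻¹) :=
          le_mul_of_one_le_left hR (by linarith)
      _ = _ := by ring

theorem hermiteCoeff_hermiteSeries {a : (Fin d → ℕ) → ℂ} (ha : Summable fun n => ‖a n‖) :
    hermiteCoeff (hermiteSeries a) = a := by
  funext k
  have h1 := hasSum_integral_of_summable_integral_norm (μ := volume)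
    (F := fun (n : Fin d → ℕ) (x : Fin d → ℝ) => a n * (hermiteC n x * hermiteC k x))
    (fun n => (integrable_hermiteC_mul n k).const_mul _) (by
      refine Summable.of_nonneg_of_le (fun n => integral_nonneg fun x => norm_nonneg _)
        (fun n => ?_) ha
      simp only [norm_mul (a n)]
      rw [integral_const_mul]
      exact mul_le_of_le_one_right (norm_nonneg _) (integral_norm_hermiteC_mul_le n k))
  have h2 : HasSum (fun n => ∫ x : Fin d → ℝ, a n * (hermiteC n x * hermiteC k x)) (a k) := by
    simp only [integral_const_mul, integral_hermiteC_mul]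
    convert hasSum_ite_eq k (a k) using 2 with n
    split_ifs with h
    · rw [h, mul_one]
    · rw [mul_zero]
  rw [h2.unique h1, hermiteCoeff]
  congr 1
  funext x
  rw [hermiteSeries, ← tsum_mul_right]
  exact tsum_congr fun n => by ring

/-! ### Completeness of the Hermite functions -/

theorem norm_hermiteC_zero_eq (x : Fin d → ℝ) :
    ‖hermiteC 0 x‖ = ∏ k, Real.pi ^ (-(1 / 4) : ℝ) * Real.exp (-(x k ^ 2 / 2)) := by
  rw [hermiteC, Complex.norm_real, hermiteFunMulti, norm_prod]
  refine Finset.prod_congr rfl fun k _ => ?_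
  rw [Pi.zero_apply, hermiteFun_zero, Real.norm_eq_abs, abs_of_nonneg (by positivity)]

theorem integrable_exp_mul_norm_hermiteC_zero (ξ : Fin d → ℝ) :
    Integrable fun x : Fin d → ℝ => Real.exp |∑ k, ξ k * x k| * ‖hermiteC 0 x‖ := by
  have h := Integrable.fintype_prod (μ := fun _ : Fin d => (volume : Measure ℝ))
    (f := fun k t => Real.exp (ξ k ^ 2) * Real.pi ^ (-(1 / 4) : ℝ) * Real.exp (-(1 / 4) * t ^ 2))
    fun k => (integrable_exp_neg_mul_sq (by norm_num)).const_mul _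
  refine Integrable.mono' h ?_ (Filter.Eventually.of_forall fun x => ?_)
  · refine Continuous.aestronglyMeasurable ?_
    have := continuous_hermiteC (0 : Fin d → ℕ)
    fun_prop
  · rw [Real.norm_eq_abs, abs_of_nonneg (by positivity), norm_hermiteC_zero_eq]
    have h1 : Real.exp |∑ k, ξ k * x k| ≤ ∏ k, Real.exp |ξ k * x k| := by
      rw [← Real.exp_sum]
      exact Real.exp_le_exp.2 (Finset.abs_sum_le_sum_abs _ _)
    calc _ ≤ (∏ k, Real.exp |ξ k * x k|) *
          ∏ k, Real.pi ^ (-(1 / 4) : ℝ) * Real.exp (-(x k ^ 2 / 2)) := by gcongr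
      _ = ∏ k, Real.exp |ξ k * x k| * (Real.pi ^ (-(1 / 4) : ℝ) * Real.exp (-(x k ^ 2 / 2))) :=
          Finset.prod_mul_distrib.symm
      _ ≤ _ := by
          refine Finset.prod_le_prod (fun k _ => by positivity) fun k _ => ?_
          calc Real.exp |ξ k * x k| * (Real.pi ^ (-(1 / 4) : ℝ) * Real.exp (-(x k ^ 2 / 2)))
              = Real.pi ^ (-(1 / 4) : ℝ) * Real.exp (|ξ k * x k| + -(x k ^ 2 / 2)) := by
                rw [Real.exp_add]; ring
            _ ≤ Real.pi ^ (-(1 / 4) : ℝ) * Real.exp (ξ k ^ 2 + -(1 / 4) * x k ^ 2) := by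
                refine mul_le_mul_of_nonneg_left (Real.exp_le_exp.2 ?_) (by positivity)
                rw [abs_mul]
                nlinarith [sq_nonneg (|ξ k| - |x k| / 2), sq_abs (ξ k), sq_abs (x k)]
            _ = _ := by rw [Real.exp_add]; ring

/-- The linear form `∑_k ξ_k x_k` maps Hermite functions to combinations of Hermite functions. -/
theorem integral_pow_mul_hermiteC_eq_zero {f : (Fin d → ℝ) → ℂ}
    (hi : ∀ n, Integrable fun x : Fin d → ℝ => f x * hermiteC n x)
    (h0 : ∀ n, hermiteCoeff f n = 0) (ξ : Fin d → ℝ) (j : ℕ) (n : Fin d → ℕ) :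
    Integrable (fun x : Fin d → ℝ => f x * (((∑ k, ξ k * x k : ℝ) : ℂ) ^ j * hermiteC n x)) ∧
      ∫ x : Fin d → ℝ, f x * (((∑ k, ξ k * x k : ℝ) : ℂ) ^ j * hermiteC n x) = 0 := by
  induction j generalizing n with
  | zero => simpa using ⟨hi n, h0 n⟩
  | succ j ih =>
    have e : ∀ x : Fin d → ℝ, f x * (((∑ k, ξ k * x k : ℝ) : ℂ) ^ (j + 1) * hermiteC n x) =
        ∑ k, (((ξ k * (√((n k : ℝ) + 1) / √2) : ℝ) : ℂ) *
            (f x * (((∑ k, ξ k * x k : ℝ) : ℂ) ^ j * hermiteC (raise n k) x)) +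
          ((ξ k * (√(n k : ℝ) / √2) : ℝ) : ℂ) *
            (f x * (((∑ k, ξ k * x k : ℝ) : ℂ) ^ j * hermiteC (lower n k) x))) := by
      intro x
      set s := ((∑ k, ξ k * x k : ℝ) : ℂ) with hs
      have h1 : s * hermiteC n x = ∑ k, (ξ k : ℂ) * ((x k : ℂ) * hermiteC n x) := by
        rw [hs]; push_cast; rw [Finset.sum_mul]
        exact Finset.sum_congr rfl fun k _ => by ring
      calc f x * (s ^ (j + 1) * hermiteC n x) = f x * s ^ j * (s * hermiteC n x) := by ring
        _ = _ := by
          rw [h1, Finset.mul_sum]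
          refine Finset.sum_congr rfl fun k _ => ?_
          rw [ofReal_mul_hermiteC]
          push_cast
          ring
    simp only [e]
    have hint : ∀ k ∈ (Finset.univ : Finset (Fin d)), Integrable fun x : Fin d → ℝ =>
        ((ξ k * (√((n k : ℝ) + 1) / √2) : ℝ) : ℂ) *
            (f x * (((∑ k, ξ k * x k : ℝ) : ℂ) ^ j * hermiteC (raise n k) x)) +
          ((ξ k * (√(n k : ℝ) / √2) : ℝ) : ℂ) *
            (f x * (((∑ k, ξ k * x k : ℝ) : ℂ) ^ j * hermiteC (lower n k) x)) := fun k _ =>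
      ((ih (raise n k)).1.const_mul _).add ((ih (lower n k)).1.const_mul _)
    refine ⟨integrable_finsetSum _ hint, ?_⟩
    rw [integral_finsetSum _ hint]
    refine Finset.sum_eq_zero fun k _ => ?_
    rw [integral_add ((ih (raise n k)).1.const_mul _) ((ih (lower n k)).1.const_mul _),
      integral_const_mul, integral_const_mul, (ih (raise n k)).2, (ih (lower n k)).2]
    simp

/-- If all Hermite coefficients of `f` vanish, expanding `e^{i⟨ξ,x⟩}` in a power series shows that
the Fourier transform of `f H_0` vanishes. -/
theorem integral_exp_mul_hermiteC_zero_eq_zero {f : (Fin d → ℝ) → ℂ}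
    (hi : ∀ n, Integrable fun x : Fin d → ℝ => f x * hermiteC n x)
    {B : ℝ} (hf : Continuous f) (hB : ∀ x, ‖f x‖ ≤ B)
    (h0 : ∀ n, hermiteCoeff f n = 0) (ξ : Fin d → ℝ) :
    ∫ x : Fin d → ℝ, Complex.exp ((∑ k, ξ k * x k : ℝ) * Complex.I) * (f x * hermiteC 0 x) = 0 := by
  set F : ℕ → (Fin d → ℝ) → ℂ := fun j x =>
    (Complex.I ^ j / (j.factorial : ℂ)) *
      (f x * (((∑ k, ξ k * x k : ℝ) : ℂ) ^ j * hermiteC 0 x)) with hF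
  have hpow := fun j => integral_pow_mul_hermiteC_eq_zero hi h0 ξ j 0
  have hnorm : ∀ j x, ‖F j x‖ =
      (|∑ k, ξ k * x k| ^ j / (j.factorial : ℝ)) * (‖f x‖ * ‖hermiteC 0 x‖) := by
    intro j x
    simp only [hF, norm_mul, norm_div, norm_pow, Complex.norm_I, one_pow, Complex.norm_natCast,
      Complex.norm_real, Real.norm_eq_abs]
    ring
  have hsum : ∀ x, HasSum (fun j => ‖F j x‖)
      (Real.exp |∑ k, ξ k * x k| * (‖f x‖ * ‖hermiteC 0 x‖)) := fun x => by
    simp only [hnorm]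
    have := NormedSpace.expSeries_div_hasSum_exp (𝔸 := ℝ) |∑ k, ξ k * x k|
    rw [← Real.exp_eq_exp_ℝ] at this
    exact this.mul_right _
  have hlim : ∀ x, HasSum (fun j => F j x)
      (Complex.exp ((∑ k, ξ k * x k : ℝ) * Complex.I) * (f x * hermiteC 0 x)) := fun x => by
    have := NormedSpace.expSeries_div_hasSum_exp (𝔸 := ℂ)
      (((∑ k, ξ k * x k : ℝ) : ℂ) * Complex.I)
    rw [← Complex.exp_eq_exp_ℂ] at this
    have h2 := this.mul_right (f x * hermiteC 0 x)
    have e : (fun j => F j x) = fun j => (((∑ k, ξ k * x k : ℝ) : ℂ) * Complex.I) ^ j /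
        (j.factorial : ℂ) * (f x * hermiteC 0 x) := by
      funext j
      simp only [hF, mul_pow]
      ring
    rw [e]
    exact h2
  have hint : Integrable fun x : Fin d → ℝ => ∑' j, ‖F j x‖ := by
    simp only [fun x => (hsum x).tsum_eq]
    refine Integrable.mono' ((integrable_exp_mul_norm_hermiteC_zero ξ).const_mul B) ?_
      (Filter.Eventually.of_forall fun x => ?_)
    · refine Continuous.aestronglyMeasurable ?_
      have := continuous_hermiteC (0 : Fin d → ℕ)
      fun_prop
    · rw [Real.norm_eq_abs, abs_of_nonneg (by positivity)]
      calc _ = ‖f x‖ * (Real.exp |∑ k, ξ k * x k| * ‖hermiteC 0 x‖) := by ring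
        _ ≤ _ := by gcongr; exact hB x
  have h := hasSum_integral_of_dominated_convergence (μ := volume) (F := F)
    (fun j x => ‖F j x‖) (fun j => ((hpow j).1.const_mul _).aestronglyMeasurable)
    (fun j => Filter.Eventually.of_forall fun x => le_rfl)
    (Filter.Eventually.of_forall fun x => (hsum x).summable) hint
    (Filter.Eventually.of_forall hlim)
  refine h.unique ?_
  have : ∀ j, ∫ x, F j x = 0 := fun j => by
    simp only [hF]
    rw [integral_const_mul, (hpow j).2, mul_zero]
  simp only [this]
  exact hasSum_zero

/-- Completeness: a bounded continuous function is determined by its Hermite coefficients. -/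
theorem eq_zero_of_hermiteCoeff_eq_zero {f : (Fin d → ℝ) → ℂ}
    (hi : ∀ n, Integrable fun x : Fin d → ℝ => f x * hermiteC n x)
    {B : ℝ} (hf : Continuous f) (hB : ∀ x, ‖f x‖ ≤ B)
    (h0 : ∀ n, hermiteCoeff f n = 0) : f = 0 := by
  open scoped FourierTransform in
  have hmp := PiLp.volume_preserving_ofLp (Fin d)
  set g : EuclideanSpace ℝ (Fin d) → ℂ := fun v => f v.ofLp * hermiteC 0 v.ofLp with hg
  have hemb : MeasurableEmbedding (WithLp.ofLp : EuclideanSpace ℝ (Fin d) → Fin d → ℝ) :=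
    (MeasurableEquiv.toLp 2 (Fin d → ℝ)).symm.measurableEmbedding
  have hgi : Integrable g := (hmp.integrable_comp_emb hemb).2 (hi 0)
  have hgc : Continuous g := by
    have := continuous_hermiteC (0 : Fin d → ℕ)
    exact (hf.mul this).comp (PiLp.continuous_ofLp 2 _)
  have hF : FourierTransform.fourier g = 0 := by
    funext w
    rw [Real.fourier_eq']
    have h := integral_exp_mul_hermiteC_zero_eq_zero hi hf hB h0 fun k => -2 * Real.pi * w k
    rw [← hmp.integral_comp hemb] at h
    refine Eq.trans ?_ h
    congr 1
    funext v
    have e : -2 * Real.pi * inner ℝ v w = ∑ k, -2 * Real.pi * w k * v k := by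
      rw [PiLp.inner_apply, Finset.mul_sum]
      refine Finset.sum_congr rfl fun k _ => ?_
      simp only [RCLike.inner_apply, conj_trivial]
      ring
    rw [e, smul_eq_mul]
  have h := hgc.fourierInv_fourier_eq hgi (by rw [hF]; exact integrable_zero _ _ _)
  funext x
  have h1 := congrFun h (WithLp.toLp 2 x)
  rw [hF] at h1
  have h2 : f x * hermiteC 0 x = 0 := by
    rw [← show g (WithLp.toLp 2 x) = f x * hermiteC 0 x from rfl, ← h1]
    simp [Real.fourierInv_eq']
  have h3 : hermiteC 0 x ≠ 0 := by
    rw [← norm_pos_iff, norm_hermiteC_zero_eq]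
    exact Finset.prod_pos fun k _ => mul_pos (Real.rpow_pos_of_pos Real.pi_pos _) (Real.exp_pos _)
  simpa [h3] using h2

/-! ### Inductive limits and nuclear maps -/

section InductiveLimit

variable {ι : Type*} {X : ι → Type*} [∀ i, AddCommGroup (X i)] [∀ i, Module ℂ (X i)]
  [∀ i, TopologicalSpace (X i)] {E : Type*} [AddCommGroup E] [Module ℂ E]

theorem inductiveLimitTopology_locallyConvexSpace (j : ∀ i, X i →ₗ[ℂ] E) :
    @LocallyConvexSpace ℝ E _ _ _ _ (inductiveLimitTopology j) :=
  LocallyConvexSpace.sInf fun _ h => h.2.2.1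

theorem continuous_inductiveLimit_incl (j : ∀ i, X i →ₗ[ℂ] E) (i : ι) :
    @Continuous (X i) E _ (inductiveLimitTopology j) (j i) :=
  continuous_sInf_rng.2 fun _ h => h.2.2.2 i

/-- The universal property of the locally convex inductive limit. -/
theorem continuous_of_forall_comp_incl (j : ∀ i, X i →ₗ[ℂ] E) {F : Type*} [AddCommGroup F]
    [Module ℂ F] [t : TopologicalSpace F] [IsTopologicalAddGroup F] [ContinuousSMul ℂ F]
    [LocallyConvexSpace ℝ F] (f : E →ₗ[ℂ] F) (h : ∀ i, Continuous fun x => f (j i x)) :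
    @Continuous E F (inductiveLimitTopology j) t f := by
  rw [continuous_iff_le_induced]
  refine sInf_le ⟨topologicalAddGroup_induced f, continuousSMul_induced f,
    LocallyConvexSpace.induced (f.restrictScalars ℝ), fun i => continuous_induced_rng.2 (h i)⟩

end InductiveLimit

/-- The identity of `E` as a linear map to `E` with the seminorm `p`. -/
def toWithSeminorm {E : Type*} [AddCommGroup E] [Module ℂ E] (p : Seminorm ℂ E) :
    E →ₗ[ℂ] WithSeminorm p where
  toFun x := x
  map_add' _ _ := rfl
  map_smul' _ _ := rfl

theorem continuous_seminorm_inductiveLimit {ι : Type*} {X : ι → Type*}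
    [∀ i, NormedAddCommGroup (X i)] [∀ i, NormedSpace ℂ (X i)] {E : Type*} [AddCommGroup E]
    [Module ℂ E] (j : ∀ i, X i →ₗ[ℂ] E) (q : Seminorm ℂ E)
    (h : ∀ i, ∃ C : ℝ, ∀ x, q (j i x) ≤ C * ‖x‖) :
    @Continuous E ℝ (inductiveLimitTopology j) _ q := by
  have hf : @Continuous E (WithSeminorm q) (inductiveLimitTopology j) _ (toWithSeminorm q) := by
    refine continuous_of_forall_comp_incl j (toWithSeminorm q) fun i => ?_
    obtain ⟨C, hC⟩ := h i
    exact (((toWithSeminorm q).comp (j i)).mkContinuous C hC).continuous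
  let _ := inductiveLimitTopology j
  exact continuous_norm.comp hf

section Nuclear

variable {E : Type*} [AddCommGroup E] [Module ℂ E]

/-- An expansion `x = ∑ f_n(x) e_n` with `∑ ‖f_n‖_q p(e_n) < ∞` makes `Ê_q → Ê_p` nuclear. -/
theorem isNuclearMap_canonicalMap {ι : Type*} [Countable ι] {p q : Seminorm ℂ E} (h : p ≤ q)
    (e : ι → E) (f : ι → E →ₗ[ℂ] ℂ) {c : ι → ℝ} (hc : ∀ n, 0 ≤ c n)
    (hf : ∀ n x, ‖f n x‖ ≤ c n * q x) (hs : Summable fun n => c n * p (e n))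
    (hx : ∀ x : E, HasSum (fun n => toWithSeminorm p (f n x • e n)) (toWithSeminorm p x)) :
    IsNuclearMap (canonicalMap h) := by
  let g : ι → WithSeminorm q →L[ℂ] ℂ := fun n =>
    LinearMap.mkContinuous (show WithSeminorm q →ₗ[ℂ] ℂ from f n) (c n) (hf n)
  let F : ι → LocalBanach q →L[ℂ] ℂ := fun n => (g n).fromCompletion
  let y : ι → LocalBanach p := fun n => (toWithSeminorm p (e n) : LocalBanach p)
  have hFc : ∀ n (x : WithSeminorm q), F n (x : LocalBanach q) = f n x := fun n x =>
    ContinuousLinearMap.fromCompletion_apply_coe (g n) x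
  have hF : ∀ n, ‖F n‖ ≤ c n := fun n => by
    refine ContinuousLinearMap.opNorm_le_bound _ (hc n) fun x => ?_
    induction x using UniformSpace.Completion.induction_on with
    | hp => exact isClosed_le (by fun_prop) (by fun_prop)
    | ih x =>
      rw [hFc, UniformSpace.Completion.norm_coe]
      exact hf n x
  have hy : ∀ n, ‖y n‖ = p (e n) := fun n => UniformSpace.Completion.norm_coe _
  have hsum : Summable fun n => ‖F n‖ * ‖y n‖ := by
    refine Summable.of_nonneg_of_le (fun n => by positivity) (fun n => ?_) hs
    rw [hy]
    exact mul_le_mul_of_nonneg_right (hF n) (apply_nonneg p _)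
  have hU : Summable fun n => (F n).smulRight (y n) :=
    Summable.of_norm (by simpa [ContinuousLinearMap.norm_smulRight_apply] using hsum)
  have hUx : ∀ x, HasSum (fun n => F n x • y n) ((∑' n, (F n).smulRight (y n)) x) := fun x =>
    hU.hasSum.mapL (ContinuousLinearMap.apply ℂ (LocalBanach p) x)
  have key : ∀ x, HasSum (fun n => F n x • y n) (canonicalMap h x) := by
    intro x
    have e1 : (∑' n, (F n).smulRight (y n)) x = canonicalMap h x := by
      induction x using UniformSpace.Completion.induction_on with
      | hp => exact isClosed_eq (by fun_prop) (by fun_prop)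
      | ih x =>
        refine (hUx x).unique ?_
        have h1 := (hx x).map (UniformSpace.Completion.toCompl (α := WithSeminorm p))
          UniformSpace.Completion.continuous_toCompl
        have h2 : canonicalMap h (x : LocalBanach q) =
            (toWithSeminorm p x : LocalBanach p) :=
          ContinuousLinearMap.completion_apply_coe (idOfLE h) x
        rw [h2]
        have e2 : (fun n => F n (x : LocalBanach q) • y n) =
            UniformSpace.Completion.toCompl ∘ fun n => toWithSeminorm p (f n x • e n) := by
          funext n
          rw [hFc]
          exact (UniformSpace.Completion.coe_smul (f n x) (toWithSeminorm p (e n))).symm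
        rw [e2]
        exact h1
    rw [← e1]
    exact hUx x
  obtain ⟨φ, hφ⟩ := exists_injective_nat ι
  refine ⟨Function.extend φ F 0, Function.extend φ y 0, ?_, fun x => ?_⟩
  · refine (hφ.summable_iff fun k hk => ?_).1 ?_
    · rw [Function.extend_apply' _ _ _ (by simpa using hk)]
      simp
    · refine hsum.congr fun n => ?_
      simp [hφ.extend_apply]
  · refine (hφ.hasSum_iff fun k hk => ?_).1 ?_
    · rw [Function.extend_apply' _ _ _ (by simpa using hk)]
      simp
    · convert key x using 2 with n
      simp [hφ.extend_apply]

end Nuclear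

/-! ### The isomorphism -/

section Step

variable {m : Set.Ioi (0 : ℝ)}

theorem GelfandShilovStep.weightedDeriv_le_norm (ψ : GelfandShilovStep M d m)
    (t : (Fin d → ℕ) × (Fin d → ℕ) × (Fin d → ℝ)) : weightedDeriv M m ψ.1 t ≤ ‖ψ‖ :=
  le_ciSup (GelfandShilovStep.bddAbove M m ψ) t

theorem GelfandShilovStep.norm_le_of_forall (ψ : GelfandShilovStep M d m) {B : ℝ}
    (h : ∀ t, weightedDeriv M m ψ.1 t ≤ B) : ‖ψ‖ ≤ B :=
  ciSup_le h

theorem GelfandShilovStep.norm_apply_le (ψ : GelfandShilovStep M d m) (x : Fin d → ℝ) :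
    ‖ψ.1 x‖ ≤ ‖ψ‖ := by
  have h := norm_multiDeriv_eq (M := M) m ψ.1 0 x
  have h1 : multiDeriv (0 : Fin d → ℕ) ψ.1 = ψ.1 := by simp [multiDeriv]
  rw [h1] at h
  simp only [Pi.zero_apply, Finset.sum_const_zero, M.zero', pow_zero, div_one, one_mul] at h
  rw [h]
  exact ψ.weightedDeriv_le_norm _

theorem FalloffStep.norm_sq_mul_seqWeight_le {θ : Param d} (a : FalloffStep M d θ)
    (n : Fin d → ℕ) : ‖a.1 n‖ ^ 2 * seqWeight M θ.1 n ≤ ‖a‖ ^ 2 := by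
  have h0 : ∀ n, 0 ≤ ‖a.1 n‖ ^ 2 * seqWeight M θ.1 n := fun n =>
    mul_nonneg (sq_nonneg _) (Real.exp_pos _).le
  have h : ‖a‖ ^ 2 = ∑' n, ‖a.1 n‖ ^ 2 * seqWeight M θ.1 n := Real.sq_sqrt (tsum_nonneg h0)
  rw [h]
  exact Summable.le_tsum a.2 n fun k _ => h0 k

end Step

theorem exists_incl_eq (φ : GelfandShilov M d) :
    ∃ (m : Set.Ioi (0 : ℝ)) (ψ : GelfandShilovStep M d m), GelfandShilov.incl M d m ψ = φ := by
  obtain ⟨m, hm⟩ := (mem_iSup_stepFunctions M d _).1 φ.2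
  exact ⟨m, ⟨φ.1, hm⟩, rfl⟩

theorem integrable_mul_hermiteC_of_gelfandShilov (hM1 : LogConvex M) (φ : GelfandShilov M d)
    (n : Fin d → ℕ) : Integrable fun x : Fin d → ℝ => φ.1 x * hermiteC n x := by
  obtain ⟨m, ψ, rfl⟩ := exists_incl_eq φ
  exact (controlledBy_of_weightedDeriv_le hM1 m ψ.2.1 ψ.weightedDeriv_le_norm).integrable n

theorem hermiteCoeff_add (hM1 : LogConvex M) (φ ψ : GelfandShilov M d) :
    hermiteCoeff (φ.1 + ψ.1) = hermiteCoeff φ.1 + hermiteCoeff ψ.1 := by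
  funext n
  rw [Pi.add_apply, hermiteCoeff, hermiteCoeff, hermiteCoeff, ← integral_add
    (integrable_mul_hermiteC_of_gelfandShilov hM1 φ n)
    (integrable_mul_hermiteC_of_gelfandShilov hM1 ψ n)]
  simp only [Pi.add_apply, add_mul]

theorem hermiteCoeff_smul (c : ℂ) (f : (Fin d → ℝ) → ℂ) :
    hermiteCoeff (c • f) = c • hermiteCoeff f := by
  funext n
  rw [Pi.smul_apply, hermiteCoeff, hermiteCoeff, smul_eq_mul, ← integral_const_mul]
  simp only [Pi.smul_apply, smul_eq_mul, mul_assoc]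

theorem eq_of_hermiteCoeff_eq (hM1 : LogConvex M) {φ ψ : GelfandShilov M d}
    (h : hermiteCoeff φ.1 = hermiteCoeff ψ.1) : φ = ψ := by
  have h0 : hermiteCoeff (φ - ψ).1 = 0 := by
    have h1 : (φ - ψ).1 = φ.1 + (-ψ).1 := by
      rw [sub_eq_add_neg]; rfl
    have h2 : (-ψ).1 = (-1 : ℂ) • ψ.1 := by
      funext x
      change -(ψ.1 x) = (-1 : ℂ) * ψ.1 x
      ring
    rw [h1, hermiteCoeff_add hM1, h2, hermiteCoeff_smul, h]
    simp
  obtain ⟨m, χ, hχ⟩ := exists_incl_eq (φ - ψ)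
  have h1 : (φ - ψ).1 = χ.1 := by rw [← hχ]; rfl
  have h2 : (φ - ψ).1 = 0 := by
    refine eq_zero_of_hermiteCoeff_eq_zero (B := ‖χ‖)
      (integrable_mul_hermiteC_of_gelfandShilov hM1 (φ - ψ)) ?_ ?_ fun n => congrFun h0 n
    · rw [h1]; exact χ.2.1.continuous
    · rw [h1]; exact χ.norm_apply_le
  exact sub_eq_zero.1 (Subtype.ext h2)

theorem exists_norm_sq_hermiteCoeff_le (hM1 : LogConvex M) (hM2 : Separative M)
    (hM3 : NonTrivial M) (m : Set.Ioi (0 : ℝ)) :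
    ∃ (θ : Param d) (C : ℝ), 0 < C ∧ ∀ (ψ : GelfandShilovStep M d m) (n : Fin d → ℕ),
      ‖hermiteCoeff ψ.1 n‖ ^ 2 * seqWeight M θ.1 n ≤ (C * ‖ψ‖) ^ 2 * (polyWeight n)⁻¹ := by
  obtain ⟨ε, C, hε, hC, h⟩ := exists_norm_hermiteCoeff_mul_isoWeight_le hM1 hM2 hM3 d m
  obtain ⟨C', hC', h'⟩ := exists_polyWeight_le hM3 d hε
  refine ⟨⟨fun _ => ε, fun _ => hε⟩, C' * C, by positivity, fun ψ n => ?_⟩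
  have h1 := h ψ.1 ‖ψ‖ ψ.2.1 ψ.weightedDeriv_le_norm n
  rw [seqWeight_eq_prod]
  change _ * isoWeight M ε n ≤ _
  have hW := isoWeight_pos (M := M) ε n
  have hP := polyWeight_pos n
  rw [← div_eq_mul_inv, le_div_iff₀ hP]
  calc ‖hermiteCoeff ψ.1 n‖ ^ 2 * isoWeight M ε n * polyWeight n
      ≤ ‖hermiteCoeff ψ.1 n‖ ^ 2 * isoWeight M ε n * (C' * isoWeight M ε n) := by
        gcongr; exact h' n
    _ = C' * (‖hermiteCoeff ψ.1 n‖ * isoWeight M ε n) ^ 2 := by ring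
    _ ≤ C' * (C * ‖ψ‖) ^ 2 := by gcongr
    _ ≤ C' ^ 2 * (C * ‖ψ‖) ^ 2 := by
        gcongr
        exact le_self_pow₀ hC' two_ne_zero
    _ = _ := by ring

theorem hermiteCoeff_mem_stepSequences {m : Set.Ioi (0 : ℝ)} {θ : Param d} {C : ℝ}
    (h : ∀ (ψ : GelfandShilovStep M d m) (n : Fin d → ℕ),
      ‖hermiteCoeff ψ.1 n‖ ^ 2 * seqWeight M θ.1 n ≤ (C * ‖ψ‖) ^ 2 * (polyWeight n)⁻¹)
    (ψ : GelfandShilovStep M d m) : hermiteCoeff ψ.1 ∈ stepSequences M d θ :=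
  Summable.of_nonneg_of_le (fun _ => mul_nonneg (sq_nonneg _) (Real.exp_pos _).le) (h ψ)
    ((summable_inv_polyWeight d).mul_left _)

instance : IsTopologicalAddGroup (UltrafastFalloff M d) :=
  inductiveLimitTopology_isTopologicalAddGroup _

instance : ContinuousSMul ℂ (UltrafastFalloff M d) := inductiveLimitTopology_continuousSMul _

instance : LocallyConvexSpace ℝ (UltrafastFalloff M d) :=
  inductiveLimitTopology_locallyConvexSpace _

instance : LocallyConvexSpace ℝ (GelfandShilov M d) :=
  inductiveLimitTopology_locallyConvexSpace _

/-- The map `φ ↦ (a_n(φ))_n` from `S^{M_p}` to `s_{M_p}`. -/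
noncomputable def coeffMap (hM1 : LogConvex M) (hM2 : Separative M) (hM3 : NonTrivial M) (d : ℕ) :
    GelfandShilov M d →ₗ[ℂ] UltrafastFalloff M d where
  toFun φ := ⟨hermiteCoeff φ.1, by
    obtain ⟨m, ψ, rfl⟩ := exists_incl_eq φ
    obtain ⟨θ, C, -, h⟩ := exists_norm_sq_hermiteCoeff_le (d := d) hM1 hM2 hM3 m
    exact Submodule.mem_iSup_of_mem θ (hermiteCoeff_mem_stepSequences h ψ)⟩
  map_add' φ ψ := Subtype.ext (hermiteCoeff_add hM1 φ ψ)
  map_smul' c φ := Subtype.ext (hermiteCoeff_smul c φ.1)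

theorem continuous_coeffMap (hM1 : LogConvex M) (hM2 : Separative M) (hM3 : NonTrivial M) :
    Continuous (coeffMap hM1 hM2 hM3 d) := by
  refine continuous_of_forall_comp_incl (GelfandShilov.incl M d) (coeffMap hM1 hM2 hM3 d)
    fun m => ?_
  obtain ⟨θ, C, hC, h⟩ := exists_norm_sq_hermiteCoeff_le (d := d) hM1 hM2 hM3 m
  let u : GelfandShilovStep M d m →ₗ[ℂ] FalloffStep M d θ :=
    { toFun := fun ψ => ⟨hermiteCoeff ψ.1, hermiteCoeff_mem_stepSequences h ψ⟩
      map_add' := fun φ ψ => Subtype.ext (hermiteCoeff_add hM1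
        (GelfandShilov.incl M d m φ) (GelfandShilov.incl M d m ψ))
      map_smul' := fun c φ => Subtype.ext (hermiteCoeff_smul c φ.1) }
  have hu : ∀ ψ, ‖u ψ‖ ≤ C * √(∑' n : Fin d → ℕ, (polyWeight n)⁻¹) * ‖ψ‖ := fun ψ => by
    have h1 : ∑' n, ‖hermiteCoeff ψ.1 n‖ ^ 2 * seqWeight M θ.1 n ≤
        (C * ‖ψ‖) ^ 2 * ∑' n : Fin d → ℕ, (polyWeight n)⁻¹ := by
      rw [← tsum_mul_left]
      exact Summable.tsum_le_tsum (h ψ) (hermiteCoeff_mem_stepSequences h ψ)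
        ((summable_inv_polyWeight d).mul_left _)
    calc ‖u ψ‖ = √(∑' n, ‖hermiteCoeff ψ.1 n‖ ^ 2 * seqWeight M θ.1 n) := rfl
      _ ≤ √((C * ‖ψ‖) ^ 2 * ∑' n : Fin d → ℕ, (polyWeight n)⁻¹) := Real.sqrt_le_sqrt h1
      _ = _ := by
        rw [Real.sqrt_mul (sq_nonneg _), Real.sqrt_sq (by positivity)]
        ring
  exact (continuous_inductiveLimit_incl (UltrafastFalloff.incl M d) θ).comp
    (u.mkContinuous _ hu).continuous

theorem summable_mul_hermiteC {m : Set.Ioi (0 : ℝ)} {a : (Fin d → ℕ) → ℂ}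
    {c : (Fin d → ℕ) → ℝ} (hc : Summable c)
    (h : ∀ n t, ‖a n‖ * weightedDeriv M m (hermiteC n) t ≤ c n) (x : Fin d → ℝ) :
    Summable fun n => a n * hermiteC n x := by
  refine Summable.of_norm_bounded hc fun n => ?_
  have h1 := norm_multiDeriv_eq (M := M) m (hermiteC n) 0 x
  have h2 : multiDeriv (0 : Fin d → ℕ) (hermiteC n) = hermiteC n := by simp [multiDeriv]
  rw [h2] at h1
  simp only [Pi.zero_apply, Finset.sum_const_zero, M.zero', pow_zero, div_one, one_mul] at h1
  rw [norm_mul, h1]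
  exact h n _

theorem summable_const_mul_inv_polyWeight (d : ℕ) (C : ℝ) :
    Summable fun n : Fin d → ℕ => C * (polyWeight n)⁻¹ :=
  (summable_inv_polyWeight d).mul_left C

/-- The Hermite series of `a ∈ s_{M_p,θ}` converges absolutely in some `S^{M_p,m}`. -/
theorem exists_hermiteSeries_mem (hM2 : Separative M) (hM3 : NonTrivial M) (θ : Param d) :
    ∃ (m : Set.Ioi (0 : ℝ)) (C : ℝ), 0 < C ∧ ∀ a : FalloffStep M d θ,
      (∀ n t, ‖a.1 n‖ * weightedDeriv M m (hermiteC n) t ≤ C * ‖a‖ * (polyWeight n)⁻¹) ∧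
      (Summable fun n => ‖a.1 n‖) ∧ ContDiff ℝ ∞ (hermiteSeries a.1) ∧
      ∀ t, weightedDeriv M m (hermiteSeries a.1) t ≤
        C * (∑' n : Fin d → ℕ, (polyWeight n)⁻¹) * ‖a‖ := by
  obtain ⟨m, C, hC, h⟩ := exists_norm_mul_weightedDeriv_hermiteC_le hM2 hM3 θ
  refine ⟨m, C, hC, fun a => ?_⟩
  have ha := h a.1 ‖a‖ (norm_nonneg _) a.norm_sq_mul_seqWeight_le
  have hs := summable_const_mul_inv_polyWeight d (C * ‖a‖)
  obtain ⟨h1, h2⟩ := hermiteSeries_mem m hs fun n t => (ha n).1 t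
  refine ⟨fun n => (ha n).1, Summable.of_nonneg_of_le (fun _ => norm_nonneg _)
    (fun n => (ha n).2) hs, h1, fun t => (h2 t).trans (le_of_eq ?_)⟩
  rw [tsum_mul_left]
  ring

theorem exists_falloffStep_incl_eq (hM3 : NonTrivial M) (a : UltrafastFalloff M d) :
    ∃ (θ : Param d) (b : FalloffStep M d θ), UltrafastFalloff.incl M d θ b = a := by
  obtain ⟨θ, hθ⟩ := (mem_iSup_stepSequences hM3 d _).1 a.2
  exact ⟨θ, ⟨a.1, hθ⟩, rfl⟩

theorem summable_hermiteSeries (hM2 : Separative M) (hM3 : NonTrivial M)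
    (a : UltrafastFalloff M d) (x : Fin d → ℝ) : Summable fun n => a.1 n * hermiteC n x := by
  obtain ⟨θ, b, rfl⟩ := exists_falloffStep_incl_eq hM3 a
  obtain ⟨m, C, -, h⟩ := exists_hermiteSeries_mem hM2 hM3 θ
  exact summable_mul_hermiteC (summable_const_mul_inv_polyWeight d _) (h b).1 x

theorem hermiteSeries_add (hM2 : Separative M) (hM3 : NonTrivial M) (a b : UltrafastFalloff M d) :
    hermiteSeries (a.1 + b.1) = hermiteSeries a.1 + hermiteSeries b.1 := by
  funext x
  rw [Pi.add_apply, hermiteSeries, hermiteSeries, hermiteSeries,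
    ← (summable_hermiteSeries hM2 hM3 a x).tsum_add (summable_hermiteSeries hM2 hM3 b x)]
  exact tsum_congr fun n => by rw [Pi.add_apply, add_mul]

theorem hermiteSeries_smul (c : ℂ) (a : (Fin d → ℕ) → ℂ) :
    hermiteSeries (c • a) = c • hermiteSeries a := by
  funext x
  rw [Pi.smul_apply, hermiteSeries, hermiteSeries, smul_eq_mul, ← tsum_mul_left]
  exact tsum_congr fun n => by rw [Pi.smul_apply, smul_eq_mul, mul_assoc]

/-- The map `a ↦ ∑_n a_n H_n` from `s_{M_p}` to `S^{M_p}`. -/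
noncomputable def seriesMap (hM2 : Separative M) (hM3 : NonTrivial M) (d : ℕ) :
    UltrafastFalloff M d →ₗ[ℂ] GelfandShilov M d where
  toFun a := ⟨hermiteSeries a.1, by
    obtain ⟨θ, b, rfl⟩ := exists_falloffStep_incl_eq hM3 a
    obtain ⟨m, C, -, h⟩ := exists_hermiteSeries_mem hM2 hM3 θ
    exact Submodule.mem_iSup_of_mem m ⟨(h b).2.2.1, _, (h b).2.2.2⟩⟩
  map_add' a b := Subtype.ext (hermiteSeries_add hM2 hM3 a b)
  map_smul' c a := Subtype.ext (hermiteSeries_smul c a.1)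

theorem continuous_seriesMap (hM2 : Separative M) (hM3 : NonTrivial M) :
    Continuous (seriesMap hM2 hM3 d) := by
  refine continuous_of_forall_comp_incl (UltrafastFalloff.incl M d) (seriesMap hM2 hM3 d)
    fun θ => ?_
  obtain ⟨m, C, hC, h⟩ := exists_hermiteSeries_mem hM2 hM3 θ
  let u : FalloffStep M d θ →ₗ[ℂ] GelfandShilovStep M d m :=
    { toFun := fun a => ⟨hermiteSeries a.1, (h a).2.2.1, _, (h a).2.2.2⟩
      map_add' := fun a b => Subtype.ext (hermiteSeries_add hM2 hM3
        (UltrafastFalloff.incl M d θ a) (UltrafastFalloff.incl M d θ b))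
      map_smul' := fun c a => Subtype.ext (hermiteSeries_smul c a.1) }
  have hu : ∀ a, ‖u a‖ ≤ C * (∑' n : Fin d → ℕ, (polyWeight n)⁻¹) * ‖a‖ := fun a =>
    (u a).norm_le_of_forall (h a).2.2.2
  exact (continuous_inductiveLimit_incl (GelfandShilov.incl M d) m).comp
    (u.mkContinuous _ hu).continuous

theorem coeffMap_seriesMap (hM1 : LogConvex M) (hM2 : Separative M) (hM3 : NonTrivial M)
    (a : UltrafastFalloff M d) : coeffMap hM1 hM2 hM3 d (seriesMap hM2 hM3 d a) = a := by
  obtain ⟨θ, b, rfl⟩ := exists_falloffStep_incl_eq hM3 a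
  obtain ⟨m, C, -, h⟩ := exists_hermiteSeries_mem hM2 hM3 θ
  exact Subtype.ext (hermiteCoeff_hermiteSeries (h b).2.1)

theorem seriesMap_coeffMap (hM1 : LogConvex M) (hM2 : Separative M) (hM3 : NonTrivial M)
    (φ : GelfandShilov M d) : seriesMap hM2 hM3 d (coeffMap hM1 hM2 hM3 d φ) = φ :=
  eq_of_hermiteCoeff_eq hM1
    (congrArg Subtype.val (coeffMap_seriesMap hM1 hM2 hM3 (coeffMap hM1 hM2 hM3 d φ)))

/-- The Fourier–Hermite isomorphism `S^{M_p}(ℝ^d) ≃ s_{M_p}`. -/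
noncomputable def coeffEquiv (hM1 : LogConvex M) (hM2 : Separative M) (hM3 : NonTrivial M)
    (d : ℕ) : GelfandShilov M d ≃L[ℂ] UltrafastFalloff M d :=
  ContinuousLinearEquiv.equivOfInverse
    ⟨coeffMap hM1 hM2 hM3 d, continuous_coeffMap hM1 hM2 hM3⟩
    ⟨seriesMap hM2 hM3 d, continuous_seriesMap hM2 hM3⟩
    (seriesMap_coeffMap hM1 hM2 hM3) (coeffMap_seriesMap hM1 hM2 hM3)

/-! ### Nuclearity -/

/-- Evaluation at `x` as a linear functional on `S^{M_p}`. -/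
def evalAt (x : Fin d → ℝ) : GelfandShilov M d →ₗ[ℂ] ℂ where
  toFun φ := φ.1 x
  map_add' _ _ := rfl
  map_smul' _ _ := rfl

theorem t2Space_gelfandShilov (M : WeightSequence) (d : ℕ) : T2Space (GelfandShilov M d) := by
  refine T2Space.of_injective_continuous (f := fun φ : GelfandShilov M d => φ.1)
    Subtype.val_injective (continuous_pi fun x => ?_)
  refine continuous_of_forall_comp_incl (GelfandShilov.incl M d) (evalAt x) fun m => ?_
  exact (((evalAt x).comp (GelfandShilov.incl M d m)).mkContinuous 1 fun ψ => by
    rw [one_mul]; exact ψ.norm_apply_le x).continuous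

/-- The Hermite function `H_n` as an element of `S^{M_p}`. -/
noncomputable def hermiteElt (hM2 : Separative M) (hM3 : NonTrivial M) (n : Fin d → ℕ) :
    GelfandShilov M d :=
  ⟨hermiteC n, by
    obtain ⟨m, C, -, h⟩ := exists_weightedDeriv_hermiteC_le hM2 hM3 d one_pos
    exact Submodule.mem_iSup_of_mem m ⟨contDiff_hermiteC n, _, h n⟩⟩

theorem exists_seminorm_incl_le {p : Seminorm ℂ (GelfandShilov M d)} (hp : Continuous p)
    (m : Set.Ioi (0 : ℝ)) : ∃ C : ℝ, 0 < C ∧ ∀ ψ, p (GelfandShilov.incl M d m ψ) ≤ C * ‖ψ‖ :=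
  Seminorm.bound_of_continuous_normedSpace (p.comp (GelfandShilov.incl M d m))
    (hp.comp (continuous_inductiveLimit_incl (GelfandShilov.incl M d) m))

theorem exists_seminorm_hermiteElt_le (hM2 : Separative M) (hM3 : NonTrivial M)
    {p : Seminorm ℂ (GelfandShilov M d)} (hp : Continuous p) {ε : ℝ} (hε : 0 < ε) :
    ∃ C : ℝ, 0 < C ∧ ∀ n, p (hermiteElt hM2 hM3 n) ≤ C * isoWeight M ε n := by
  obtain ⟨m, C, hC, h⟩ := exists_weightedDeriv_hermiteC_le hM2 hM3 d hε
  obtain ⟨C', hC', h'⟩ := exists_seminorm_incl_le hp m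
  refine ⟨C' * C, by positivity, fun n => ?_⟩
  let ψ : GelfandShilovStep M d m := ⟨hermiteC n, contDiff_hermiteC n, _, h n⟩
  calc p (hermiteElt hM2 hM3 n) = p (GelfandShilov.incl M d m ψ) := rfl
    _ ≤ C' * ‖ψ‖ := h' ψ
    _ ≤ C' * (C * isoWeight M ε n) := by
      gcongr
      exact ψ.norm_le_of_forall (h n)
    _ = _ := by ring

/-- The coefficient `a_n(φ)` decays faster than any continuous seminorm of `H_n` grows. -/
theorem exists_norm_hermiteCoeff_mul_seminorm_le (hM1 : LogConvex M) (hM2 : Separative M)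
    (hM3 : NonTrivial M) {p : Seminorm ℂ (GelfandShilov M d)} (hp : Continuous p)
    (m : Set.Ioi (0 : ℝ)) :
    ∃ C : ℝ, ∀ (ψ : GelfandShilovStep M d m) (n : Fin d → ℕ),
      ‖hermiteCoeff ψ.1 n‖ * ((p (hermiteElt hM2 hM3 n) + 1) * polyWeight n) ≤
        C * ‖ψ‖ * (polyWeight n)⁻¹ := by
  obtain ⟨ε, C, hε, hC, h⟩ := exists_norm_hermiteCoeff_mul_isoWeight_le hM1 hM2 hM3 d m
  obtain ⟨C₁, r, hC₁, hr, -, h₁⟩ := exists_isoWeight_pow_le hM2 hM3 d 3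
  obtain ⟨C₂, hC₂, h₂⟩ := exists_polyWeight_le hM3 d (mul_pos hr hε)
  obtain ⟨C₃, hC₃, h₃⟩ := exists_seminorm_hermiteElt_le hM2 hM3 hp (mul_pos hr hε)
  refine ⟨(C₃ + 1) * C₂ ^ 2 * C₁ * C, fun ψ n => ?_⟩
  have hP := polyWeight_pos n
  have hW : 1 ≤ isoWeight M (r * ε) n := one_le_isoWeight hM3 (mul_pos hr hε).le n
  rw [← div_eq_mul_inv, le_div_iff₀ hP]
  calc ‖hermiteCoeff ψ.1 n‖ * ((p (hermiteElt hM2 hM3 n) + 1) * polyWeight n) * polyWeight n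
      ≤ ‖hermiteCoeff ψ.1 n‖ * (((C₃ + 1) * isoWeight M (r * ε) n) *
          (C₂ * isoWeight M (r * ε) n)) * (C₂ * isoWeight M (r * ε) n) := by
        have h4 : p (hermiteElt hM2 hM3 n) + 1 ≤ (C₃ + 1) * isoWeight M (r * ε) n := by
          linarith [h₃ n]
        gcongr
        · exact h₂ n
        · exact h₂ n
    _ = (C₃ + 1) * C₂ ^ 2 * (‖hermiteCoeff ψ.1 n‖ * isoWeight M (r * ε) n ^ 3) := by ring
    _ ≤ (C₃ + 1) * C₂ ^ 2 * (‖hermiteCoeff ψ.1 n‖ * (C₁ * isoWeight M ε n)) := by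
        gcongr
        exact h₁ ε n hε.le
    _ = (C₃ + 1) * C₂ ^ 2 * C₁ * (‖hermiteCoeff ψ.1 n‖ * isoWeight M ε n) := by ring
    _ ≤ (C₃ + 1) * C₂ ^ 2 * C₁ * (C * ‖ψ‖) := by
        refine mul_le_mul_of_nonneg_left ?_ (by positivity)
        exact h ψ.1 ‖ψ‖ ψ.2.1 ψ.weightedDeriv_le_norm n
    _ = _ := by ring

/-- The Hermite functions expand every element of `S^{M_p}`, in the topology of `S^{M_p}`. -/
theorem hasSum_hermiteElt (hM1 : LogConvex M) (hM2 : Separative M) (hM3 : NonTrivial M)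
    (φ : GelfandShilov M d) :
    HasSum (fun n => hermiteCoeff φ.1 n • hermiteElt hM2 hM3 n) φ := by
  obtain ⟨θ, a, ha⟩ := exists_falloffStep_incl_eq hM3 (coeffMap hM1 hM2 hM3 d φ)
  have ha1 : hermiteCoeff φ.1 = a.1 := (congrArg Subtype.val ha).symm
  obtain ⟨m, C, hC, h⟩ := exists_hermiteSeries_mem hM2 hM3 θ
  have hb := (h a).1
  set c : (Fin d → ℕ) → ℝ := fun n => C * ‖a‖ * (polyWeight n)⁻¹ with hcdef
  have hc : Summable c := summable_const_mul_inv_polyWeight d _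
  have hφ : φ.1 = hermiteSeries a.1 := by
    rw [← ha1]
    exact (congrArg Subtype.val (seriesMap_coeffMap hM1 hM2 hM3 φ)).symm
  -- The remainder after the terms in `F` is the Hermite series of `a` cut off to the complement.
  have htail : ∀ (F : Finset (Fin d → ℕ)) n t,
      ‖((F : Set (Fin d → ℕ))ᶜ.indicator a.1) n‖ * weightedDeriv M m (hermiteC n) t ≤
        ((F : Set (Fin d → ℕ))ᶜ.indicator c) n := by
    intro F n t
    by_cases hn : n ∈ (F : Set (Fin d → ℕ))ᶜ
    · simpa [Set.indicator_of_mem hn] using hb n t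
    · simp [Set.indicator_of_notMem hn]
  have hmem := fun F : Finset (Fin d → ℕ) => hermiteSeries_mem m (hc.indicator _) (htail F)
  let R : Finset (Fin d → ℕ) → GelfandShilovStep M d m := fun F =>
    ⟨hermiteSeries ((F : Set (Fin d → ℕ))ᶜ.indicator a.1), (hmem F).1, _, (hmem F).2⟩
  have hR : Filter.Tendsto R Filter.atTop (nhds 0) := by
    rw [tendsto_zero_iff_norm_tendsto_zero]
    refine squeeze_zero (fun F => norm_nonneg _)
      (fun F => (R F).norm_le_of_forall (hmem F).2) ?_
    refine (tendsto_tsum_compl_atTop_zero c).congr fun F => ?_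
    exact tsum_subtype ((F : Set (Fin d → ℕ))ᶜ) c
  have hval : ∀ F : Finset (Fin d → ℕ),
      (∑ n ∈ F, hermiteCoeff φ.1 n • hermiteElt hM2 hM3 n : GelfandShilov M d) =
        φ - GelfandShilov.incl M d m (R F) := by
    intro F
    rw [eq_sub_iff_add_eq]
    refine Subtype.ext (funext fun x => ?_)
    change evalAt x (∑ n ∈ F, hermiteCoeff φ.1 n • hermiteElt hM2 hM3 n +
      GelfandShilov.incl M d m (R F)) = φ.1 x
    rw [map_add, map_sum]
    have hs : Summable fun n => a.1 n * hermiteC n x := summable_mul_hermiteC hc hb x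
    have h1 : evalAt x (GelfandShilov.incl M d m (R F)) =
        ∑' n, (F : Set (Fin d → ℕ))ᶜ.indicator (fun n => a.1 n * hermiteC n x) n := by
      refine tsum_congr fun n => ?_
      by_cases hn : n ∈ (F : Set (Fin d → ℕ))ᶜ
      · rw [Set.indicator_of_mem hn, Set.indicator_of_mem hn]
      · rw [Set.indicator_of_notMem hn, Set.indicator_of_notMem hn, zero_mul]
    have h2 : ∀ n, evalAt x (hermiteCoeff φ.1 n • hermiteElt hM2 hM3 n) = a.1 n * hermiteC n x := by
      intro n
      rw [ha1]
      rfl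
    rw [h1, ← tsum_subtype, Finset.sum_congr rfl fun n _ => h2 n]
    refine Eq.trans ?_ (congrFun hφ x).symm
    exact hs.sum_add_tsum_compl
  have hlim := ((continuous_inductiveLimit_incl (GelfandShilov.incl M d) m).tendsto 0).comp hR
  rw [map_zero] at hlim
  have := hlim.const_sub φ
  rw [sub_zero] at this
  exact this.congr fun F => (hval F).symm

/-- The `n`-th Fourier–Hermite coefficient as a linear functional. -/
noncomputable def coeffFunctional (hM1 : LogConvex M) (n : Fin d → ℕ) :
    GelfandShilov M d →ₗ[ℂ] ℂ where
  toFun φ := hermiteCoeff φ.1 n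
  map_add' φ ψ := congrFun (hermiteCoeff_add hM1 φ ψ) n
  map_smul' c φ := congrFun (hermiteCoeff_smul c φ.1) n

/-- The canonical map `Ê_q → Ê_p` is nuclear for `q(φ) = ∑_n |a_n(φ)| (p(H_n) + 1) w_n`, where
`∑_n 1 / w_n` converges: the expansion of `φ` in Hermite functions displays it as nuclear. -/
theorem isNuclearSpace_gelfandShilov (hM1 : LogConvex M) (hM2 : Separative M)
    (hM3 : NonTrivial M) (d : ℕ) : IsNuclearSpace (GelfandShilov M d) := by
  refine ⟨t2Space_gelfandShilov M d, inferInstance, fun p hp => ?_⟩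
  set e : (Fin d → ℕ) → GelfandShilov M d := hermiteElt hM2 hM3 with he
  have hw1 : ∀ n : Fin d → ℕ, 1 ≤ polyWeight n := one_le_polyWeight
  have hpe : ∀ n, 0 ≤ p (e n) := fun n => apply_nonneg p _
  let w : (Fin d → ℕ) → ℝ := fun n => (p (e n) + 1) * polyWeight n
  have hw : ∀ n, 0 < w n := fun n =>
    mul_pos (by linarith [hpe n]) (polyWeight_pos n)
  have hpw : ∀ n, p (e n) ≤ w n := fun n => by
    have := mul_le_mul (le_add_of_nonneg_right zero_le_one : p (e n) ≤ p (e n) + 1) (hw1 n)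
      zero_le_one (by linarith [hpe n])
    simpa using this
  have hsum : ∀ φ : GelfandShilov M d, Summable fun n => ‖hermiteCoeff φ.1 n‖ * w n := by
    intro φ
    obtain ⟨m, ψ, rfl⟩ := exists_incl_eq φ
    obtain ⟨C, h⟩ := exists_norm_hermiteCoeff_mul_seminorm_le hM1 hM2 hM3 hp m
    exact Summable.of_nonneg_of_le (fun n => mul_nonneg (norm_nonneg _) (hw n).le) (h ψ)
      (summable_const_mul_inv_polyWeight d _)
  let q : Seminorm ℂ (GelfandShilov M d) :=
    Seminorm.of (fun φ => ∑' n, ‖hermiteCoeff φ.1 n‖ * w n)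
      (fun φ ψ => by
        rw [← (hsum φ).tsum_add (hsum ψ)]
        refine (hsum (φ + ψ)).tsum_le_tsum (fun n => ?_) ((hsum φ).add (hsum ψ))
        have h1 : hermiteCoeff (φ + ψ).1 n = hermiteCoeff φ.1 n + hermiteCoeff ψ.1 n :=
          congrFun (hermiteCoeff_add hM1 φ ψ) n
        rw [h1, ← add_mul]
        exact mul_le_mul_of_nonneg_right (norm_add_le _ _) (hw n).le)
      (fun c φ => by
        rw [← tsum_mul_left]
        refine tsum_congr fun n => ?_
        have h1 : hermiteCoeff (c • φ).1 n = c * hermiteCoeff φ.1 n :=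
          congrFun (hermiteCoeff_smul c φ.1) n
        rw [h1, norm_mul, mul_assoc])
  have hterm : ∀ φ n, ‖hermiteCoeff φ.1 n‖ * w n ≤ q φ := fun φ n =>
    (hsum φ).le_tsum n fun k _ => mul_nonneg (norm_nonneg _) (hw k).le
  have hpq : p ≤ q := by
    intro φ
    refine le_of_tendsto ((hp.tendsto φ).comp (hasSum_hermiteElt hM1 hM2 hM3 φ))
      (Filter.Eventually.of_forall fun F => ?_)
    calc p (∑ n ∈ F, hermiteCoeff φ.1 n • e n) ≤ ∑ n ∈ F, p (hermiteCoeff φ.1 n • e n) :=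
          Finset.le_sum_of_subadditive p (map_zero p).le (map_add_le_add p) F _
      _ ≤ ∑ n ∈ F, ‖hermiteCoeff φ.1 n‖ * w n := Finset.sum_le_sum fun n _ => by
          rw [map_smul_eq_mul]
          exact mul_le_mul_of_nonneg_left (hpw n) (norm_nonneg _)
      _ ≤ q φ := (hsum φ).sum_le_tsum F fun n _ => mul_nonneg (norm_nonneg _) (hw n).le
  refine ⟨q, ?_, hpq, ?_⟩
  · refine continuous_seminorm_inductiveLimit (GelfandShilov.incl M d) q fun m => ?_
    obtain ⟨C, h⟩ := exists_norm_hermiteCoeff_mul_seminorm_le hM1 hM2 hM3 hp m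
    refine ⟨C * ∑' n : Fin d → ℕ, (polyWeight n)⁻¹, fun ψ => ?_⟩
    have h1 := (hsum (GelfandShilov.incl M d m ψ)).tsum_le_tsum (h ψ)
      (summable_const_mul_inv_polyWeight d _)
    rw [tsum_mul_left] at h1
    exact h1.trans (le_of_eq (by ring))
  · refine isNuclearMap_canonicalMap hpq e (coeffFunctional hM1) (c := fun n => (w n)⁻¹)
      (fun n => (inv_pos.2 (hw n)).le) (fun n φ => ?_) ?_ fun φ => ?_
    · rw [inv_mul_eq_div, le_div_iff₀ (hw n)]
      exact hterm φ n
    · refine Summable.of_nonneg_of_le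
        (fun n => mul_nonneg (inv_pos.2 (hw n)).le (hpe n)) (fun n => ?_)
        (summable_inv_polyWeight d)
      rw [mul_inv, mul_right_comm]
      refine mul_le_of_le_one_left (inv_pos.2 (polyWeight_pos n)).le ?_
      rw [inv_mul_eq_div]
      exact div_le_one_of_le₀ (by linarith) (by linarith [hpe n])
    · have hcont : Continuous (toWithSeminorm p) := by
        refine continuous_of_forall_comp_incl (GelfandShilov.incl M d) _ fun m => ?_
        obtain ⟨C, -, h⟩ := exists_seminorm_incl_le hp m
        exact (((toWithSeminorm p).comp (GelfandShilov.incl M d m)).mkContinuous C h).continuous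
      exact (hasSum_hermiteElt hM1 hM2 hM3 φ).map (toWithSeminorm p) hcont

end GelfandShilovHermite

open GelfandShilovHermite in
theorem theorem2p1 (M : WeightSequence) (hM1 : LogConvex M) (hM2 : Separative M)
    (hM3 : NonTrivial M) (d : ℕ) :
    (∃ T : GelfandShilov M d ≃L[ℂ] UltrafastFalloff M d,
      ∀ (φ : GelfandShilov M d) (n : Fin d → ℕ),
        MeasureTheory.Integrable (fun x : Fin d → ℝ => φ x * (hermiteFunMulti n x : ℂ)) ∧
        T φ n = ∫ x : Fin d → ℝ, φ x * (hermiteFunMulti n x : ℂ)) ∧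
    IsNuclearSpace (GelfandShilov M d) :=
  ⟨⟨coeffEquiv hM1 hM2 hM3 d, fun φ n =>
    ⟨integrable_mul_hermiteC_of_gelfandShilov hM1 φ n, rfl⟩⟩,
    isNuclearSpace_gelfandShilov hM1 hM2 hM3 d⟩
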